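/- Let $T^2=\mathbb R^2/\mathbb Z^2$. For an immersion $f:T^2\to S^3\subset\mathbb R^4$ let $\mathcal W(f)=\int_{T^2}(H^2+1)\,dA$ be its Willmore energy, where $H$ is half the trace of the second fundamental form in $S^3$ and $dA$ is the induced area, and let $\Pi(f)=(\Pi^1(f),\Pi^2(f))$ be its conformal class in the Teichmüller space of $T^2$, identified with the upper half plane: $\Pi(f)=\tau=(\tau_1,\tau_2)$ if $T^2$ with the induced metric admits an orientation preserving conformal diffeomorphism onto $\mathbb C/(\mathbb Z+\tau\mathbb Z)$, $\tau = \tau_1+i\tau_2$, lifting to $\Phi:\mathbb R^2\to\mathbb C$ with $\Phi(x,y)-(x+\tau y)$ periodic. Put $\mathcal W_{\alpha,\beta}=\mathcal W-\alpha\Pi^1-\beta\Pi^2$. For a functional $\mathcal F$ and a $W^{4,2}$ vector field $\varphi$ along $f$ tangent to $S^3$, let $\delta\mathcal F(f)(\varphi)$ and $\delta^2\mathcal F(f)(\varphi,\varphi)$ be the first and second derivatives at $t=0$ of $t\mapsto \mathcal F\big((f+t\varphi)/|f+t\varphi|\big)$. Let $a_0,b_0>0$ and $B=(1-b_0,1+b_0)$.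 For $(a,b)\in[0,a_0^2)\times B$ let $\tilde f^{(a,b)}:T^2\to S^3$ be a smooth immersion with $\Pi(\tilde f^{(a,b)})=(a,b)$, and let $\tilde\alpha(a,b),\tilde\beta(a,b)\in\mathbb R$. Write $a=\tilde a^2$ with $\tilde a\in[0,a_0)$, and suppose that - $(\tilde a,b)\mapsto\tilde f^{(\tilde a^2,b)}$ is of class $C^2$ from $[0,a_0)\times B$ to $W^{4,2}(T^2,\mathbb R^4)$, and $(\tilde a,b)\mapsto\tilde\alpha(\tilde a^2,b)$, $(\tilde a,b)\mapsto\tilde\beta(\tilde a^2,b)$ are of class $C^2$ on $[0,a_0)\times B$; - $\delta\Pi^1(\tilde f^{(0,b)})=0$ for all $b\in B$, and $\delta\Pi^1(\tilde f^{(a,b)})\neq0$ for all $a\in(0,a_0^2)$, $b\in B$; - for all $a\in(0,a_0^2)$ and $b\in B$ the constrained Willmore equation $\delta\mathcal W=\tilde\alpha(a,b)\,\delta\Pi^1+\tilde\beta(a,b)\,\delta\Pi^2$ holds at $\tilde f^{(a,b)}$. Let $\tilde\omega(a,b)=\mathcal W(\tilde f^{(a,b)})$, $\tilde\alpha^b=\tilde\alpha(0,b)$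 and $\tilde\beta^b=\tilde\beta(0,b)$. Then for every $b\in B$: 1. $\partial_a\tilde\omega(a,b)$ exists and equals $\tilde\alpha(a,b)$ for all $a\in(0,a_0^2)$, and $\lim_{a\to0^+}\partial_a\tilde\omega(a,b)=\tilde\alpha^b$; 2. $\partial_b\tilde\omega(a,b)$ exists and equals $\tilde\beta(a,b)$ for all $a\in(0,a_0^2)$, and $\lim_{a\to0^+}\partial_b\tilde\omega(a,b)=\tilde\beta^b$; 3. the one-sided derivative $\varphi^b=\partial_{\tilde a}\tilde f^{(\tilde a^2,b)}|_{\tilde a=0}\in W^{4,2}(T^2,\mathbb R^4)$ is tangent to $S^3$ along $\tilde f^{(0,b)}$, the map $t\mapsto\mathcal W_{\tilde\alpha^b,\tilde\beta^b}\big((\tilde f^{(0,b)}+t\varphi^b)/|\tilde f^{(0,b)}+t\varphi^b|\big)$ is $C^2$ near $t=0$, and $\delta^2\mathcal W_{\tilde\alpha^b,\tilde\beta^b}(\tilde f^{(0,b)})(\varphi^b,\varphi^b)=0$. -/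

import Mathlib

open MeasureTheory Set Filter Topology
open scoped RealInnerProductSpace

namespace CWillmore

/-! ### Calculus on the torus `T² = ℝ² / ℤ²`: maps on `T²` are `ℤ²`-periodic maps on `ℝ × ℝ` -/

section Sobolev

variable {V : Type*} [NormedAddCommGroup V] [NormedSpace ℝ V]

/-- Partial derivative in the first coordinate. -/
noncomputable def pd₁ (u : ℝ × ℝ → V) : ℝ × ℝ → V := fun p => fderiv ℝ u p (1, 0)

/-- Partial derivative in the second coordinate. -/
noncomputable def pd₂ (u : ℝ × ℝ → V) : ℝ × ℝ → V := fun p => fderiv ℝ u p (0, 1)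

/-- `u` descends to the torus `ℝ² / ℤ²`. -/
def Periodic₂ {W : Type*} (u : ℝ × ℝ → W) : Prop :=
  ∀ x y : ℝ, u (x + 1, y) = u (x, y) ∧ u (x, y + 1) = u (x, y)

/-- Lebesgue measure on the fundamental domain `(0,1]²`, i.e. the measure of the torus. -/
noncomputable def cell : Measure (ℝ × ℝ) := volume.restrict (Ioc (0 : ℝ) 1 ×ˢ Ioc (0 : ℝ) 1)

/-- The multi-indices `(i, j)` with `i + j ≤ 4`. -/
abbrev MultiIndex : Type :=
  ↥((Finset.range 5 ×ˢ Finset.range 5).filter (fun α : ℕ × ℕ => α.1 + α.2 ≤ 4))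

/-- The mixed partial derivative `∂₁ⁱ ∂₂ʲ`. -/
noncomputable def pdiff (α : ℕ × ℕ) (u : ℝ × ℝ → V) : ℝ × ℝ → V := pd₁^[α.1] (pd₂^[α.2] u)

/-- `w` is the weak derivative `D^α u` on the torus: test functions are the smooth functions on
the torus. -/
def IsWeakDeriv (α : ℕ × ℕ) (u w : ℝ × ℝ → V) : Prop :=
  ∀ ψ : ℝ × ℝ → ℝ, ContDiff ℝ (⊤ : ℕ∞) ψ → Periodic₂ ψ →
    ∫ p, ψ p • w p ∂cell = (-1 : ℝ) ^ (α.1 + α.2) • ∫ p, pdiff α ψ p • u p ∂cell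

variable (V) in
/-- Square integrable functions on the torus, one for each multi-index of order at most 4,
with the Hilbert sum norm. -/
abbrev JetL2 : Type _ := PiLp 2 (fun _ : MultiIndex => Lp V 2 cell)

instance : IsFiniteMeasure cell := by
  refine ⟨?_⟩
  rw [cell, Measure.restrict_apply_univ, Measure.volume_eq_prod, Measure.prod_prod]
  simp

theorem contDiff_pd₁ {u : ℝ × ℝ → V} (h : ContDiff ℝ (⊤ : ℕ∞) u) :
    ContDiff ℝ (⊤ : ℕ∞) (pd₁ u) :=
  (h.fderiv_right (m := ((⊤ : ℕ∞) : WithTop ℕ∞)) (by simp)).clm_apply contDiff_const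

theorem contDiff_pd₂ {u : ℝ × ℝ → V} (h : ContDiff ℝ (⊤ : ℕ∞) u) :
    ContDiff ℝ (⊤ : ℕ∞) (pd₂ u) :=
  (h.fderiv_right (m := ((⊤ : ℕ∞) : WithTop ℕ∞)) (by simp)).clm_apply contDiff_const

theorem contDiff_pdiff (α : ℕ × ℕ) {u : ℝ × ℝ → V} (h : ContDiff ℝ (⊤ : ℕ∞) u) :
    ContDiff ℝ (⊤ : ℕ∞) (pdiff α u) := by
  have h2 : ∀ n : ℕ, ContDiff ℝ (⊤ : ℕ∞) (pd₂^[n] u) := by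
    intro n
    induction n with
    | zero => simpa using h
    | succ n ih => rw [Function.iterate_succ_apply']; exact contDiff_pd₂ ih
  have h1 : ∀ n : ℕ, ContDiff ℝ (⊤ : ℕ∞) (pd₁^[n] (pd₂^[α.2] u)) := by
    intro n
    induction n with
    | zero => simpa using h2 α.2
    | succ n ih => rw [Function.iterate_succ_apply']; exact contDiff_pd₁ ih
  exact h1 α.1

theorem integrable_cell_of_continuous {W : Type*} [NormedAddCommGroup W] {u : ℝ × ℝ → W} (h : Continuous u) :
    Integrable u cell := by
  have hK : IsCompact (Icc (0 : ℝ) 1 ×ˢ Icc (0 : ℝ) 1) := isCompact_Icc.prod isCompact_Icc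
  have := h.continuousOn.integrableOn_compact (μ := (volume : Measure (ℝ × ℝ))) hK
  exact this.mono_set (prod_mono Ioc_subset_Icc_self Ioc_subset_Icc_self)

theorem integrable_smul_cell {ψ : ℝ × ℝ → ℝ} (hψ : Continuous ψ) (w : Lp V 2 cell) :
    Integrable (fun p => ψ p • w p) cell := by
  have hw : Integrable (w : ℝ × ℝ → V) cell := (Lp.memLp w).integrable (by norm_num)
  have hK : IsCompact (Icc (0 : ℝ) 1 ×ˢ Icc (0 : ℝ) 1) := isCompact_Icc.prod isCompact_Icc
  obtain ⟨C, hC⟩ := hK.exists_bound_of_continuousOn hψ.continuousOn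
  refine hw.bdd_smul C hψ.aestronglyMeasurable ?_
  refine (ae_restrict_iff' (measurableSet_Ioc.prod measurableSet_Ioc)).2 (ae_of_all _ ?_)
  intro p hp
  exact hC p (prod_mono Ioc_subset_Icc_self Ioc_subset_Icc_self hp)

theorem eq_zero_of_ae_cell {W : Type*} [NormedAddCommGroup W] {u : ℝ × ℝ → W} (hp : Periodic₂ u) (hc : Continuous u)
    (h : u =ᵐ[cell] 0) : u = 0 := by
  set U : Set (ℝ × ℝ) := Ioo (0 : ℝ) 1 ×ˢ Ioo (0 : ℝ) 1 with hU
  have hsub : U ⊆ Ioc (0 : ℝ) 1 ×ˢ Ioc (0 : ℝ) 1 :=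
    prod_mono Ioo_subset_Ioc_self Ioo_subset_Ioc_self
  have h1 : u =ᵐ[volume.restrict U] 0 :=
    ae_mono (Measure.restrict_mono hsub le_rfl) h
  have h2 : EqOn u 0 U :=
    Measure.eqOn_open_of_ae_eq h1 (isOpen_Ioo.prod isOpen_Ioo) hc.continuousOn
      continuousOn_const
  have h3 : EqOn u 0 (closure U) := h2.closure hc continuous_const
  have h4 : closure U = Icc (0 : ℝ) 1 ×ˢ Icc (0 : ℝ) 1 := by
    rw [hU, closure_prod_eq, closure_Ioo (by norm_num)]
  funext ⟨x, y⟩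
  have hx : Function.Periodic (fun x => u (x, Int.fract y)) 1 := fun x => (hp x _).1
  have hy : Function.Periodic (fun y => u (x, y)) 1 := fun y => (hp x y).2
  have e1 : u (x, Int.fract y) = u (x, y) := by
    have h := hy.sub_int_mul_eq (x := y) ⌊y⌋
    rw [mul_one] at h
    exact h
  have e2 : u (Int.fract x, Int.fract y) = u (x, Int.fract y) := by
    have h := hx.sub_int_mul_eq (x := x) ⌊x⌋
    rw [mul_one] at h
    exact h
  rw [← e1, ← e2]
  apply h3
  rw [h4]
  exact ⟨⟨Int.fract_nonneg x, (Int.fract_lt_one x).le⟩,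
    ⟨Int.fract_nonneg y, (Int.fract_lt_one y).le⟩⟩

variable (V) in
/-- Pairs `(u, (D^α u)_α)`, where `u` is a function of class `W^{4,2}` on the torus, given by its
`C²` representative (by Sobolev's embedding theorem in dimension two there is exactly one), and
`D^α u`, of order at most 4, are its weak derivatives, all in `L²`. -/
noncomputable def sobolevSubmodule : Submodule ℝ ((ℝ × ℝ → V) × JetL2 V) where
  carrier := {z | Periodic₂ z.1 ∧ ContDiff ℝ 2 z.1 ∧
    (∀ α : MultiIndex, α.1 = (0, 0) → z.2 α =ᵐ[cell] z.1) ∧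
    ∀ α : MultiIndex, IsWeakDeriv α.1 z.1 (z.2 α)}
  zero_mem' := by
    refine ⟨fun x y => by simp, contDiff_const, fun α _ => Lp.coeFn_zero V 2 cell, ?_⟩
    intro α ψ _ _
    have h : ∫ p, ψ p • (0 : Lp V 2 cell) p ∂cell = 0 := by
      rw [← integral_zero (ℝ × ℝ) V (μ := cell)]
      refine integral_congr_ae ?_
      filter_upwards [Lp.coeFn_zero V 2 cell] with p hp
      rw [hp, Pi.zero_apply, smul_zero]
    simpa using h
  add_mem' := by
    rintro ⟨u, d⟩ ⟨u', d'⟩ ⟨h1, h2, h3, h4⟩ ⟨h1', h2', h3', h4'⟩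
    simp only at h1 h2 h3 h4 h1' h2' h3' h4'
    refine ⟨fun x y => ?_, h2.add h2', fun α hα => ?_, fun α ψ hψ hψp => ?_⟩
    · simp [(h1 x y).1, (h1 x y).2, (h1' x y).1, (h1' x y).2]
    · exact (Lp.coeFn_add (d α) (d' α)).trans ((h3 α hα).add (h3' α hα))
    · have hc := (contDiff_pdiff α.1 hψ).continuous
      have e1 : ∫ p, ψ p • (d α + d' α : Lp V 2 cell) p ∂cell =
          ∫ p, ψ p • d α p ∂cell + ∫ p, ψ p • d' α p ∂cell := by
        rw [← integral_add (integrable_smul_cell hψ.continuous _)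
          (integrable_smul_cell hψ.continuous _)]
        refine integral_congr_ae ?_
        filter_upwards [Lp.coeFn_add (d α) (d' α)] with p hp
        rw [hp, Pi.add_apply, smul_add]
      have e2 : ∫ p, pdiff α.1 ψ p • (u + u') p ∂cell =
          ∫ p, pdiff α.1 ψ p • u p ∂cell + ∫ p, pdiff α.1 ψ p • u' p ∂cell := by
        have i1 : Integrable (fun p => pdiff α.1 ψ p • u p) cell :=
          integrable_cell_of_continuous (hc.smul h2.continuous)
        have i2 : Integrable (fun p => pdiff α.1 ψ p • u' p) cell :=
          integrable_cell_of_continuous (hc.smul h2'.continuous)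
        rw [← integral_add i1 i2]
        simp only [Pi.add_apply, smul_add]
      have e3 := h4 α ψ hψ hψp
      have e4 := h4' α ψ hψ hψp
      change ∫ p, ψ p • (d α + d' α : Lp V 2 cell) p ∂cell =
        (-1 : ℝ) ^ (α.1.1 + α.1.2) • ∫ p, pdiff α.1 ψ p • (u + u') p ∂cell
      rw [e1, e2, smul_add, e3, e4]
  smul_mem' := by
    rintro c ⟨u, d⟩ ⟨h1, h2, h3, h4⟩
    simp only at h1 h2 h3 h4
    refine ⟨fun x y => ?_, contDiff_const.smul h2, fun α hα => ?_, fun α ψ hψ hψp => ?_⟩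
    · simp [(h1 x y).1, (h1 x y).2]
    · exact (Lp.coeFn_smul c (d α)).trans ((h3 α hα).const_smul c)
    · have e1 : ∫ p, ψ p • (c • d α : Lp V 2 cell) p ∂cell = c • ∫ p, ψ p • d α p ∂cell := by
        rw [← integral_smul]
        refine integral_congr_ae ?_
        filter_upwards [Lp.coeFn_smul c (d α)] with p hp
        simp [hp, smul_comm (ψ p) c]
      have e2 : ∫ p, pdiff α.1 ψ p • (c • u) p ∂cell =
          c • ∫ p, pdiff α.1 ψ p • u p ∂cell := by
        rw [← integral_smul]
        simp [smul_comm _ c]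
      change ∫ p, ψ p • (c • d α : Lp V 2 cell) p ∂cell =
        (-1 : ℝ) ^ (α.1.1 + α.1.2) • ∫ p, pdiff α.1 ψ p • (c • u) p ∂cell
      rw [e1, e2, h4 α ψ hψ hψp, smul_comm]

variable (V) in
/-- The Sobolev space `W^{4,2}(T², V)` of the torus `T² = ℝ² / ℤ²`. -/
def W42 : Type _ := ↥(sobolevSubmodule V)

noncomputable instance : AddCommGroup (W42 V) := inferInstanceAs (AddCommGroup ↥(sobolevSubmodule V))

noncomputable instance : Module ℝ (W42 V) := inferInstanceAs (Module ℝ ↥(sobolevSubmodule V))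

instance : CoeFun (W42 V) (fun _ => ℝ × ℝ → V) := ⟨fun u => u.1.1⟩

/-- The weak derivatives of order at most 4. -/
noncomputable def W42.jet : W42 V →ₗ[ℝ] JetL2 V :=
  (LinearMap.snd ℝ (ℝ × ℝ → V) (JetL2 V)).comp (sobolevSubmodule V).subtype

theorem W42.jet_injective : Function.Injective (W42.jet (V := V)) := by
  rw [injective_iff_map_eq_zero]
  rintro ⟨⟨u, d⟩, h1, h2, h3, h4⟩ h
  have hd : d = 0 := h
  have hu : u = 0 := by
    refine eq_zero_of_ae_cell h1 h2.continuous ?_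
    have hz := h3 ⟨(0, 0), by simp⟩ rfl
    rw [hd] at hz
    exact hz.symm.trans (Lp.coeFn_zero V 2 cell)
  exact Subtype.ext (Prod.ext hu hd)

/-- The `W^{4,2}` norm `(∑_{|α| ≤ 4} ‖D^α u‖²_{L²})^{1/2}`. -/
noncomputable instance : NormedAddCommGroup (W42 V) :=
  NormedAddCommGroup.induced (W42 V) (JetL2 V) W42.jet W42.jet_injective

noncomputable instance : NormedSpace ℝ (W42 V) :=
  NormedSpace.induced ℝ (W42 V) (JetL2 V) W42.jet

end Sobolev

/-! ### Immersions of the torus into `S³ ⊆ ℝ⁴` -/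

/-- Euclidean 4-space. -/
abbrev E4 : Type := EuclideanSpace ℝ (Fin 4)

/-- `F` is a smooth immersion of the torus into the unit sphere `S³`. -/
def IsSmoothImmersion (F : ℝ × ℝ → E4) : Prop :=
  Periodic₂ F ∧ ContDiff ℝ (⊤ : ℕ∞) F ∧ (∀ p, ‖F p‖ = 1) ∧
    ∀ p, Function.Injective (fderiv ℝ F p)

section Geometry

variable (F : ℝ × ℝ → E4) (p : ℝ × ℝ)

/-- Coefficient `g₁₁` of the induced metric. -/
noncomputable def g₁₁ : ℝ := ⟪pd₁ F p, pd₁ F p⟫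

/-- Coefficient `g₁₂` of the induced metric. -/
noncomputable def g₁₂ : ℝ := ⟪pd₁ F p, pd₂ F p⟫

/-- Coefficient `g₂₂` of the induced metric. -/
noncomputable def g₂₂ : ℝ := ⟪pd₂ F p, pd₂ F p⟫

/-- Determinant of the induced metric. -/
noncomputable def gdet : ℝ := g₁₁ F p * g₂₂ F p - g₁₂ F p ^ 2

/-- The unit normal of the immersion in `S³`: the normalized triple vector product in `ℝ⁴` of
`F`, `∂₁F` and `∂₂F`. -/
noncomputable def unitNormal : E4 :=
  (√(gdet F p))⁻¹ • WithLp.toLp 2 (fun k : Fin 4 =>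
    (Matrix.of ![WithLp.ofLp (F p), WithLp.ofLp (pd₁ F p), WithLp.ofLp (pd₂ F p),
      Pi.single k 1]).det)

/-- Mean curvature in `S³`: half the trace, with respect to the induced metric, of the second
fundamental form `II(∂ᵢ, ∂ⱼ) = ⟨∂ᵢ∂ⱼF, ν⟩`. -/
noncomputable def meanCurvature : ℝ :=
  (g₂₂ F p * ⟪pd₁ (pd₁ F) p, unitNormal F p⟫ - 2 * g₁₂ F p * ⟪pd₁ (pd₂ F) p, unitNormal F p⟫
    + g₁₁ F p * ⟪pd₂ (pd₂ F) p, unitNormal F p⟫) / (2 * gdet F p)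

/-- The Willmore energy `∫ (H² + 1) dA` of an immersion into `S³`. -/
noncomputable def willmore : ℝ := ∫ q, (meanCurvature F q ^ 2 + 1) * √(gdet F q) ∂cell

end Geometry

/-! ### The projection to Teichmüller space -/

/-- The metric induced by `F` on the marked torus `ℝ² / ℤ²` has conformal class `τ`: there is an
orientation preserving conformal diffeomorphism onto `ℂ / (ℤ + τ ℤ)` that respects the marking,
i.e. a diffeomorphism `Φ : ℝ² → ℂ` such that `Φ(x, y) - (x + τ y)` is periodic, and the induced
metric is a positive multiple of the pull-back of the Euclidean metric. The diffeomorphism has the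
Sobolev regularity of the immersions considered. -/
def HasConformalClass (F : ℝ × ℝ → E4) (τ : ℂ) : Prop :=
  0 < τ.im ∧ ∃ Φ : ℝ × ℝ → ℂ,
    (∃ v : W42 ℂ, ∀ p : ℝ × ℝ, Φ p = (p.1 : ℂ) + τ * (p.2 : ℂ) + v p) ∧
    Function.Bijective Φ ∧
    (∀ p, 0 < (pd₁ Φ p).re * (pd₂ Φ p).im - (pd₁ Φ p).im * (pd₂ Φ p).re) ∧
    ∀ p, ∃ r : ℝ, 0 < r ∧ g₁₁ F p = r * ⟪pd₁ Φ p, pd₁ Φ p⟫ ∧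
      g₁₂ F p = r * ⟪pd₁ Φ p, pd₂ Φ p⟫ ∧ g₂₂ F p = r * ⟪pd₂ Φ p, pd₂ Φ p⟫

open Classical in
/-- The projection `Π` from immersions to Teichmüller space, modelled by the upper half plane. -/
noncomputable def teichmuller (F : ℝ × ℝ → E4) : ℂ :=
  if h : ∃ τ, HasConformalClass F τ then h.choose else 0

/-- First component of the projection to Teichmüller space. -/
noncomputable def teich₁ (F : ℝ × ℝ → E4) : ℝ := (teichmuller F).re

/-- Second component of the projection to Teichmüller space. -/
noncomputable def teich₂ (F : ℝ × ℝ → E4) : ℝ := (teichmuller F).im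

/-- The penalized Willmore functional `W - α Π¹ - β Π²`. -/
noncomputable def penalizedWillmore (α β : ℝ) (F : ℝ × ℝ → E4) : ℝ :=
  willmore F - α * teich₁ F - β * teich₂ F

/-! ### First and second variation -/

/-- `φ` is a vector field along `f` tangent to `S³`. -/
def IsTangentField (f φ : ℝ × ℝ → E4) : Prop := ∀ p, ⟪f p, φ p⟫ = 0

/-- The variation `t ↦ (f + tφ) / |f + tφ|` of `f` in `S³` in the direction of a field `φ` tangent
to `S³`. It agrees with the geodesic variation `t ↦ exp_f (tφ)` to second order at `t = 0`. -/
noncomputable def variation (f φ : ℝ × ℝ → E4) (t : ℝ) : ℝ × ℝ → E4 :=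
  fun p => ‖f p + t • φ p‖⁻¹ • (f p + t • φ p)

/-- The first variation `δ𝓕(f)(φ)`. -/
noncomputable def firstVariation (𝓕 : (ℝ × ℝ → E4) → ℝ) (f φ : ℝ × ℝ → E4) : ℝ :=
  deriv (fun t => 𝓕 (variation f φ t)) 0

/-- The second variation `δ²𝓕(f)(φ, φ)`. -/
noncomputable def secondVariation (𝓕 : (ℝ × ℝ → E4) → ℝ) (f φ : ℝ × ℝ → E4) : ℝ :=
  iteratedDeriv 2 (fun t => 𝓕 (variation f φ t)) 0

/-- `δ𝓕(f) = 0`. -/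
def IsCriticalFor (𝓕 : (ℝ × ℝ → E4) → ℝ) (f : ℝ × ℝ → E4) : Prop :=
  ∀ φ : W42 E4, IsTangentField f φ → firstVariation 𝓕 f φ = 0

/-- The constrained Euler-Lagrange equation `δW = α δΠ¹ + β δΠ²` at `f`. -/
def IsConstrainedWillmore (f : ℝ × ℝ → E4) (α β : ℝ) : Prop :=
  ∀ φ : W42 E4, IsTangentField f φ →
    firstVariation willmore f φ = α * firstVariation teich₁ f φ + β * firstVariation teich₂ f φ

end CWillmore

/-!
# Constrained Willmore tori at a degenerate point of the projection to Teichmüller space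

Both the Willmore energy `W` and the conformal class `Π = Π¹ + i Π²`, composed with the radial
projection `u ↦ u / |u|` to the sphere, are `C²` on a neighbourhood in `W^{4,2}(T², ℝ⁴)` of a smooth
immersion that has a conformal class (`contDiffAt_willmore`, `contDiffAt_teichmuller`). Given this,
the theorem is the calculus of Lagrange multipliers in a Banach space.

*First derivatives.* Composed with the radial projection, the functionals do not change under normal
variations, so the constrained Willmore equation is `DW = α DΠ¹ + β DΠ²` in all directions
(`IsConstrainedWillmore.fderiv_eq`). Since `Π (f a b) = a + i b`, the chain rule gives `α` and `β`
as the derivatives of the energy (`hasDerivAt_of_lagrange`).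

*Second variation.* Let `c s = f (s²) b` and let `P` be the penalized functional with the
multipliers at `a = 0`. The Lagrange equation passes to the limit, so `DP (c 0) = 0`. For `s > 0`,
`DP (c s) (c' s) = 2 s (α (s²) b - α 0 b)`, because `Π¹ (c s) = s²` and `Π²` is constant along `c`.
The derivative at `s = 0` of the left hand side is `D²P (φ, φ)` with `φ = c' 0`, that of the right
hand side is zero (`second_fderiv_eq_zero_of_lagrange`).

*Smoothness of the energy.* The complex Sobolev spaces `W^{k,2}` of the torus, `k ≥ 2`, are spaces
of Fourier series with weighted square summable coefficients, and commutative Banach algebras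
(`Sob`). The components of elements of `W^{4,2}` belong to `Sob 2` (`toSob`), and conversely
(`exists_W42_of_sob`). The energy is built from them by derivatives, products, inverses of units and
square roots of squares of units, which are smooth operations; square roots come from the inverse
function theorem (`exists_local_sqrt`).

*Smoothness of the conformal class.* A conformal diffeomorphism `Φ = x + τ y + v` for the metric
solves `∂₂Φ = σ ∂₁Φ`, where `σ` is the complex structure of the metric, a function with values in
the upper half plane. For given `σ` this is a linear equation for `τ` and the derivatives of `v`.
With `w = τ + ∂₂ v - i M ∂₁ v` it becomes `(1 - (σ - i M) R) w = σ`, where `R` is a Fourier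
multiplier with symbol bounded by `1 / M`. For large `M` one has `sup |σ - i M| < M`, so the
operator is inverted by a Neumann series on `L²`, and also on `W^{3,2}` for the norm with weight
`(1 + ε |n|)³` and small `ε`, in which multiplication by a smooth function is almost bounded by its
supremum (`Sob.isUnit_one_sub_mul_multiplier`). Hence `τ`, the mean of `w`, is unique and depends
smoothly on `σ`. The map `Φ` obtained for a nearby metric is a diffeomorphism, being `C¹`-close to
the given one (`bijective_of_close`).
-/

/-! ### Fourier analysis on the torus -/

namespace CWillmore

/-- The character `p ↦ exp (2πi ⟨n, p⟩)` of the torus. -/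
noncomputable def character (n : ℤ × ℤ) (p : ℝ × ℝ) : ℂ :=
  Complex.exp (2 * Real.pi * Complex.I * (n.1 * p.1 + n.2 * p.2))

theorem character_zero (p : ℝ × ℝ) : character 0 p = 1 := by simp [character]

theorem character_add (n m : ℤ × ℤ) (p : ℝ × ℝ) :
    character (n + m) p = character n p * character m p := by
  rw [character, character, character, ← Complex.exp_add]
  congr 1
  push_cast [Prod.fst_add, Prod.snd_add]
  ring

theorem norm_character (n : ℤ × ℤ) (p : ℝ × ℝ) : ‖character n p‖ = 1 := by
  have : (2 * Real.pi * Complex.I * (n.1 * p.1 + n.2 * p.2) : ℂ)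
      = ((2 * Real.pi * (n.1 * p.1 + n.2 * p.2) : ℝ) : ℂ) * Complex.I := by
    push_cast; ring
  rw [character, this, Complex.norm_exp_ofReal_mul_I]

theorem conj_character (n : ℤ × ℤ) (p : ℝ × ℝ) :
    (starRingEnd ℂ) (character n p) = character (-n) p := by
  rw [character, character, ← Complex.exp_conj]
  congr 1
  simp only [map_mul, map_add, Complex.conj_I, Complex.conj_ofReal, map_ofNat, map_intCast,
    Prod.fst_neg, Prod.snd_neg, Int.cast_neg]
  ring

theorem contDiff_character (n : ℤ × ℤ) : ContDiff ℝ (⊤ : ℕ∞) (character n) := by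
  have h1 : ContDiff ℝ (⊤ : ℕ∞) (fun p : ℝ × ℝ => (p.1 : ℂ)) :=
    Complex.ofRealCLM.contDiff.comp contDiff_fst
  have h2 : ContDiff ℝ (⊤ : ℕ∞) (fun p : ℝ × ℝ => (p.2 : ℂ)) :=
    Complex.ofRealCLM.contDiff.comp contDiff_snd
  exact (contDiff_const.mul ((contDiff_const.mul h1).add (contDiff_const.mul h2))).cexp

theorem periodic₂_character (n : ℤ × ℤ) : Periodic₂ (character n) := by
  intro x y
  constructor
  · rw [character, character, Complex.exp_eq_exp_iff_exists_int]
    exact ⟨n.1, by push_cast; ring⟩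
  · rw [character, character, Complex.exp_eq_exp_iff_exists_int]
    exact ⟨n.2, by push_cast; ring⟩

theorem hasFDerivAt_character (n : ℤ × ℤ) (p : ℝ × ℝ) :
    HasFDerivAt (character n)
      ((Complex.ofRealCLM.comp (ContinuousLinearMap.fst ℝ ℝ ℝ)).smulRight
          (2 * Real.pi * Complex.I * n.1 * character n p) +
        (Complex.ofRealCLM.comp (ContinuousLinearMap.snd ℝ ℝ ℝ)).smulRight
          (2 * Real.pi * Complex.I * n.2 * character n p)) p := by
  have h1 : HasFDerivAt (fun p : ℝ × ℝ => (p.1 : ℂ))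
      (Complex.ofRealCLM.comp (ContinuousLinearMap.fst ℝ ℝ ℝ)) p :=
    (Complex.ofRealCLM.comp (ContinuousLinearMap.fst ℝ ℝ ℝ)).hasFDerivAt
  have h2 : HasFDerivAt (fun p : ℝ × ℝ => (p.2 : ℂ))
      (Complex.ofRealCLM.comp (ContinuousLinearMap.snd ℝ ℝ ℝ)) p :=
    (Complex.ofRealCLM.comp (ContinuousLinearMap.snd ℝ ℝ ℝ)).hasFDerivAt
  have h := (((h1.const_mul (n.1 : ℂ)).add (h2.const_mul (n.2 : ℂ))).const_mul
    (2 * Real.pi * Complex.I : ℂ)).cexp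
  refine h.congr_fderiv ?_
  ext <;> simp [character] <;> ring

theorem pd₁_character (n : ℤ × ℤ) :
    pd₁ (character n) = fun p => 2 * Real.pi * Complex.I * n.1 * character n p := by
  funext p
  rw [pd₁, (hasFDerivAt_character n p).fderiv]
  simp

theorem pd₂_character (n : ℤ × ℤ) :
    pd₂ (character n) = fun p => 2 * Real.pi * Complex.I * n.2 * character n p := by
  funext p
  rw [pd₂, (hasFDerivAt_character n p).fderiv]
  simp

/-- Fubini's theorem on the torus. -/
theorem integral_cell {W : Type*} [NormedAddCommGroup W] [NormedSpace ℝ W] {u : ℝ × ℝ → W}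
    (h : Continuous u) :
    ∫ p, u p ∂cell = ∫ x in (0 : ℝ)..1, ∫ y in (0 : ℝ)..1, u (x, y) := by
  have hi := integrable_cell_of_continuous h
  rw [cell, Measure.volume_eq_prod, ← Measure.prod_restrict] at hi ⊢
  rw [integral_prod _ hi, intervalIntegral.integral_of_le zero_le_one]
  simp only [intervalIntegral.integral_of_le zero_le_one]

theorem integral_cell_symm {W : Type*} [NormedAddCommGroup W] [NormedSpace ℝ W] {u : ℝ × ℝ → W}
    (h : Continuous u) :
    ∫ p, u p ∂cell = ∫ y in (0 : ℝ)..1, ∫ x in (0 : ℝ)..1, u (x, y) := by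
  have hi := integrable_cell_of_continuous h
  rw [cell, Measure.volume_eq_prod, ← Measure.prod_restrict] at hi ⊢
  rw [integral_prod_symm _ hi, intervalIntegral.integral_of_le zero_le_one]
  simp only [intervalIntegral.integral_of_le zero_le_one]

section PartialDerivatives

variable {V : Type*} [NormedAddCommGroup V] [NormedSpace ℝ V]

theorem continuous_pd₁ {u : ℝ × ℝ → V} (h : ContDiff ℝ 1 u) : Continuous (pd₁ u) :=
  (h.continuous_fderiv (by norm_num)).clm_apply continuous_const

theorem continuous_pd₂ {u : ℝ × ℝ → V} (h : ContDiff ℝ 1 u) : Continuous (pd₂ u) :=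
  (h.continuous_fderiv (by norm_num)).clm_apply continuous_const

theorem Periodic₂.fderiv {u : ℝ × ℝ → V} (h : Periodic₂ u) : Periodic₂ (fderiv ℝ u) := by
  intro x y
  constructor
  · have e : (fun p : ℝ × ℝ => u (p + (1, 0))) = u := by
      funext ⟨x, y⟩
      simpa using (h x y).1
    have := fderiv_comp_add_right (𝕜 := ℝ) (f := u) (x := (x, y)) (1, 0)
    rw [e] at this
    simpa using this.symm
  · have e : (fun p : ℝ × ℝ => u (p + (0, 1))) = u := by
      funext ⟨x, y⟩
      simpa using (h x y).2
    have := fderiv_comp_add_right (𝕜 := ℝ) (f := u) (x := (x, y)) (0, 1)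
    rw [e] at this
    simpa using this.symm

theorem Periodic₂.pd₁ {u : ℝ × ℝ → V} (h : Periodic₂ u) : Periodic₂ (pd₁ u) := fun x y =>
  ⟨congrArg (fun L => L (1, 0)) (h.fderiv x y).1, congrArg (fun L => L (1, 0)) (h.fderiv x y).2⟩

theorem Periodic₂.pd₂ {u : ℝ × ℝ → V} (h : Periodic₂ u) : Periodic₂ (pd₂ u) := fun x y =>
  ⟨congrArg (fun L => L (0, 1)) (h.fderiv x y).1, congrArg (fun L => L (0, 1)) (h.fderiv x y).2⟩

theorem integral_pd₁_eq_zero [CompleteSpace V] {u : ℝ × ℝ → V} (hp : Periodic₂ u)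
    (h : ContDiff ℝ 1 u) : ∫ p, pd₁ u p ∂cell = 0 := by
  rw [integral_cell_symm (continuous_pd₁ h)]
  have : ∀ y : ℝ, ∫ x in (0 : ℝ)..1, CWillmore.pd₁ u (x, y) = 0 := by
    intro y
    have hd : ∀ x ∈ uIcc (0 : ℝ) 1, HasDerivAt (fun x => u (x, y)) (CWillmore.pd₁ u (x, y)) x := by
      intro x _
      exact ((h.differentiable (by norm_num)) (x, y)).hasFDerivAt.comp_hasDerivAt x
        ((hasDerivAt_id x).prodMk (hasDerivAt_const x y))
    rw [intervalIntegral.integral_eq_sub_of_hasDerivAt hd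
      (((continuous_pd₁ h).comp (by fun_prop)).intervalIntegrable _ _)]
    have := (hp 0 y).1
    rw [zero_add] at this
    rw [this, sub_self]
  simp [this]

theorem integral_pd₂_eq_zero [CompleteSpace V] {u : ℝ × ℝ → V} (hp : Periodic₂ u)
    (h : ContDiff ℝ 1 u) : ∫ p, pd₂ u p ∂cell = 0 := by
  rw [integral_cell (continuous_pd₂ h)]
  have : ∀ x : ℝ, ∫ y in (0 : ℝ)..1, CWillmore.pd₂ u (x, y) = 0 := by
    intro x
    have hd : ∀ y ∈ uIcc (0 : ℝ) 1, HasDerivAt (fun y => u (x, y)) (CWillmore.pd₂ u (x, y)) y := by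
      intro y _
      exact ((h.differentiable (by norm_num)) (x, y)).hasFDerivAt.comp_hasDerivAt y
        ((hasDerivAt_const y x).prodMk (hasDerivAt_id y))
    rw [intervalIntegral.integral_eq_sub_of_hasDerivAt hd
      (((continuous_pd₂ h).comp (by fun_prop)).intervalIntegrable _ _)]
    have := (hp x 0).2
    rw [zero_add] at this
    rw [this, sub_self]
  simp [this]

end PartialDerivatives

/-- The `n`-th Fourier coefficient of a function on the torus. -/
noncomputable def fourierCoef (u : ℝ × ℝ → ℂ) (n : ℤ × ℤ) : ℂ :=
  ∫ p, character (-n) p * u p ∂cell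

theorem pd₁_mul {u v : ℝ × ℝ → ℂ} (hu : ContDiff ℝ 1 u) (hv : ContDiff ℝ 1 v) (p : ℝ × ℝ) :
    pd₁ (fun p => u p * v p) p = u p * pd₁ v p + pd₁ u p * v p := by
  have := ((hu.differentiable (by norm_num)) p).hasFDerivAt.mul
    ((hv.differentiable (by norm_num)) p).hasFDerivAt
  simp only [pd₁]
  rw [show (fun p => u p * v p) = u * v from rfl, this.fderiv]
  simp; ring

theorem pd₂_mul {u v : ℝ × ℝ → ℂ} (hu : ContDiff ℝ 1 u) (hv : ContDiff ℝ 1 v) (p : ℝ × ℝ) :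
    pd₂ (fun p => u p * v p) p = u p * pd₂ v p + pd₂ u p * v p := by
  have := ((hu.differentiable (by norm_num)) p).hasFDerivAt.mul
    ((hv.differentiable (by norm_num)) p).hasFDerivAt
  simp only [pd₂]
  rw [show (fun p => u p * v p) = u * v from rfl, this.fderiv]
  simp; ring

theorem Periodic₂.mul {u v : ℝ × ℝ → ℂ} (hu : Periodic₂ u) (hv : Periodic₂ v) :
    Periodic₂ (fun p => u p * v p) := fun x y => by
  simp only [(hu x y).1, (hu x y).2, (hv x y).1, (hv x y).2, and_self]

theorem fourierCoef_pd₁ {u : ℝ × ℝ → ℂ} (hp : Periodic₂ u) (h : ContDiff ℝ 1 u) (n : ℤ × ℤ) :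
    fourierCoef (pd₁ u) n = 2 * Real.pi * Complex.I * n.1 * fourierCoef u n := by
  have hc : ContDiff ℝ 1 (character (-n)) := (contDiff_character _).of_le (by exact_mod_cast le_top)
  have h0 := integral_pd₁_eq_zero ((periodic₂_character (-n)).mul hp) (hc.mul h)
  have i1 : Integrable (fun p => character (-n) p * pd₁ u p) cell :=
    integrable_cell_of_continuous (hc.continuous.mul (continuous_pd₁ h))
  have i2 : Integrable (fun p => pd₁ (character (-n)) p * u p) cell :=
    integrable_cell_of_continuous ((continuous_pd₁ hc).mul h.continuous)
  simp only [pd₁_mul hc h] at h0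
  rw [integral_add i1 i2] at h0
  rw [fourierCoef, eq_neg_of_add_eq_zero_left h0, fourierCoef, ← integral_const_mul,
    ← integral_neg]
  refine integral_congr_ae (ae_of_all _ fun p => ?_)
  simp only [pd₁_character, Prod.fst_neg]
  push_cast; ring

theorem fourierCoef_pd₂ {u : ℝ × ℝ → ℂ} (hp : Periodic₂ u) (h : ContDiff ℝ 1 u) (n : ℤ × ℤ) :
    fourierCoef (pd₂ u) n = 2 * Real.pi * Complex.I * n.2 * fourierCoef u n := by
  have hc : ContDiff ℝ 1 (character (-n)) := (contDiff_character _).of_le (by exact_mod_cast le_top)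
  have h0 := integral_pd₂_eq_zero ((periodic₂_character (-n)).mul hp) (hc.mul h)
  have i1 : Integrable (fun p => character (-n) p * pd₂ u p) cell :=
    integrable_cell_of_continuous (hc.continuous.mul (continuous_pd₂ h))
  have i2 : Integrable (fun p => pd₂ (character (-n)) p * u p) cell :=
    integrable_cell_of_continuous ((continuous_pd₂ hc).mul h.continuous)
  simp only [pd₂_mul hc h] at h0
  rw [integral_add i1 i2] at h0
  rw [fourierCoef, eq_neg_of_add_eq_zero_left h0, fourierCoef, ← integral_const_mul,
    ← integral_neg]
  refine integral_congr_ae (ae_of_all _ fun p => ?_)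
  simp only [pd₂_character, Prod.snd_neg]
  push_cast; ring

theorem integral_exp_int (m : ℤ) :
    ∫ x in (0 : ℝ)..1, Complex.exp (2 * Real.pi * Complex.I * m * x) = if m = 0 then 1 else 0 := by
  split_ifs with h
  · simp [h]
  · have hne : (2 * Real.pi * Complex.I * m : ℂ) ≠ 0 := by
      simp [h, Real.pi_ne_zero]
    rw [integral_exp_mul_complex hne]
    have : Complex.exp (2 * Real.pi * Complex.I * m * (1 : ℝ)) = 1 := by
      rw [Complex.exp_eq_one_iff]
      exact ⟨m, by push_cast; ring⟩
    rw [this]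
    simp

theorem integral_character (n : ℤ × ℤ) :
    ∫ p, character n p ∂cell = if n = 0 then 1 else 0 := by
  rw [integral_cell (contDiff_character n).continuous]
  have : ∀ x y : ℝ, character n (x, y) = Complex.exp (2 * Real.pi * Complex.I * n.1 * x) *
      Complex.exp (2 * Real.pi * Complex.I * n.2 * y) := by
    intro x y
    rw [character, ← Complex.exp_add]
    congr 1; ring
  simp only [this, intervalIntegral.integral_const_mul, intervalIntegral.integral_mul_const,
    integral_exp_int]
  rcases n with ⟨a, b⟩
  by_cases ha : a = 0 <;> by_cases hb : b = 0 <;> simp [ha, hb]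

theorem fourierCoef_character (m n : ℤ × ℤ) :
    fourierCoef (character m) n = if m = n then 1 else 0 := by
  simp only [fourierCoef, ← character_add, integral_character]
  refine if_congr ?_ rfl rfl
  rw [neg_add_eq_zero, eq_comm]

/-- A continuous periodic function on the line is determined by its Fourier coefficients. -/
theorem eq_zero_of_integral_exp_eq_zero {g : ℝ → ℂ} (hp : Function.Periodic g 1)
    (hc : Continuous g)
    (h : ∀ m : ℤ, ∫ x in (0 : ℝ)..1, Complex.exp (2 * Real.pi * Complex.I * m * x) * g x = 0) :
    g = 0 := by
  let G : C(AddCircle (1 : ℝ), ℂ) := ⟨hp.lift, by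
    refine continuous_coinduced_dom.2 ?_
    exact hc⟩
  have hG : ∀ x : ℝ, G (x : AddCircle (1 : ℝ)) = g x := fun x => hp.lift_coe x
  have hz : ∀ n, fourierCoeff G n = 0 := by
    intro n
    rw [fourierCoeff_eq_intervalIntegral _ n 0]
    simp only [zero_add, hG, fourier_coe_apply, smul_eq_mul]
    rw [← h (-n)]
    simp
  have hs : Summable (fourierCoeff G) := by
    rw [show fourierCoeff G = fun _ => 0 from funext hz]
    exact summable_zero
  funext x
  have := has_pointwise_sum_fourier_series_of_summable hs (x : AddCircle (1 : ℝ))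
  simp only [hz, zero_smul] at this
  rw [← hG x]
  exact this.unique hasSum_zero

/-- A continuous function on the torus is determined by its Fourier coefficients. -/
theorem eq_zero_of_fourierCoef_eq_zero {u : ℝ × ℝ → ℂ} (hp : Periodic₂ u) (hc : Continuous u)
    (h : ∀ n, fourierCoef u n = 0) : u = 0 := by
  have hE : ∀ m : ℤ, Continuous fun x : ℝ => Complex.exp (2 * Real.pi * Complex.I * m * x) := by
    intro m; fun_prop
  -- the Fourier coefficients in `x` are periodic functions of `y`, and their own Fourier
  -- coefficients vanish
  have key : ∀ m : ℤ, (fun y => ∫ x in (0 : ℝ)..1,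
      Complex.exp (2 * Real.pi * Complex.I * m * x) * u (x, y)) = 0 := by
    intro m
    have hcont : Continuous (Function.uncurry fun y x : ℝ =>
        Complex.exp (2 * Real.pi * Complex.I * m * x) * u (x, y)) :=
      ((hE m).comp continuous_snd).mul (hc.comp (continuous_snd.prodMk continuous_fst))
    refine eq_zero_of_integral_exp_eq_zero (fun y => ?_)
      (intervalIntegral.continuous_parametric_intervalIntegral_of_continuous' hcont 0 1) fun k => ?_
    · simp only [fun x => (hp x y).2]
    · have h0 := h (-m, -k)
      rw [fourierCoef, integral_cell_symm (u := fun p => character (-(-m, -k)) p * u p)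
        ((contDiff_character _).continuous.mul hc)] at h0
      rw [← h0]
      refine intervalIntegral.integral_congr fun y _ => ?_
      simp only [← intervalIntegral.integral_const_mul]
      refine intervalIntegral.integral_congr fun x _ => ?_
      simp only [character, ← mul_assoc, ← Complex.exp_add]
      congr 2
      push_cast [Prod.fst_neg, Prod.snd_neg]
      ring
  funext ⟨x, y⟩
  have h2 := eq_zero_of_integral_exp_eq_zero (g := fun x => u (x, y)) (fun x => (hp x y).1)
    (by fun_prop) (fun m => congrFun (key m) y)
  exact congrFun h2 x

end CWillmore

/-! ### Sobolev spaces of the torus as Banach algebras -/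

namespace CWillmore

/-- Cauchy–Schwarz for series of nonnegative reals. -/
theorem tsum_mul_sq_le {ι : Type*} {f g : ι → ℝ} (hf0 : ∀ i, 0 ≤ f i) (hg0 : ∀ i, 0 ≤ g i)
    (hf : Summable fun i => f i ^ 2) (hg : Summable fun i => g i ^ 2) :
    Summable (fun i => f i * g i) ∧
      (∑' i, f i * g i) ^ 2 ≤ (∑' i, f i ^ 2) * ∑' i, g i ^ 2 := by
  have hs : Summable (fun i => f i * g i) := by
    refine Summable.of_nonneg_of_le (fun i => mul_nonneg (hf0 i) (hg0 i)) (fun i => ?_)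
      (hf.add hg)
    nlinarith [sq_nonneg (f i - g i), sq_nonneg (f i), sq_nonneg (g i), hf0 i, hg0 i]
  refine ⟨hs, ?_⟩
  refine le_of_tendsto' ((hs.hasSum : Tendsto _ _ _).pow 2) fun s => ?_
  refine (Finset.sum_mul_sq_le_sq_mul_sq s f g).trans ?_
  exact mul_le_mul (hf.sum_le_tsum s fun i _ => sq_nonneg _)
    (hg.sum_le_tsum s fun i _ => sq_nonneg _) (Finset.sum_nonneg fun i _ => sq_nonneg _)
    (tsum_nonneg fun i => sq_nonneg _)

/-- The weight `1 + |n₁| + |n₂|` on the frequencies. -/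
def wt (n : ℤ × ℤ) : ℝ := 1 + |(n.1 : ℝ)| + |(n.2 : ℝ)|

theorem one_le_wt (n : ℤ × ℤ) : 1 ≤ wt n := by
  have := abs_nonneg (n.1 : ℝ); have := abs_nonneg (n.2 : ℝ); unfold wt; linarith

theorem wt_pos (n : ℤ × ℤ) : 0 < wt n := one_pos.trans_le (one_le_wt n)

theorem wt_neg (n : ℤ × ℤ) : wt (-n) = wt n := by simp [wt]

theorem wt_add_le (m n : ℤ × ℤ) : wt (m + n) ≤ wt m + wt n := by
  have h1 := abs_add_le (m.1 : ℝ) n.1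
  have h2 := abs_add_le (m.2 : ℝ) n.2
  simp only [wt, Prod.fst_add, Prod.snd_add, Int.cast_add]
  linarith

theorem summable_wt {k : ℕ} (hk : 4 ≤ k) : Summable fun n : ℤ × ℤ => (wt n ^ k)⁻¹ := by
  have h1 : Summable fun n : ℤ => ((1 + |(n : ℝ)|) ^ 2)⁻¹ := by
    refine Summable.of_norm_bounded_eventually
      ((Real.summable_one_div_int_pow (p := 2)).2 one_lt_two) ?_
    filter_upwards [(Set.finite_singleton (0 : ℤ)).compl_mem_cofinite] with n hn
    have hn' : (0 : ℝ) < |(n : ℝ)| := by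
      have : n ≠ 0 := hn
      positivity
    rw [Real.norm_of_nonneg (by positivity), one_div, ← sq_abs (n : ℝ)]
    gcongr
    linarith
  have h2 := h1.mul_of_nonneg h1 (fun n => by positivity) (fun n => by positivity)
  refine Summable.of_nonneg_of_le (fun n => inv_nonneg.2 (pow_nonneg (wt_pos n).le _))
    (fun n => ?_) h2
  rw [← mul_inv]
  refine inv_anti₀ (by positivity) ?_
  refine le_trans ?_ (pow_le_pow_right₀ (one_le_wt n) hk)
  have ha := abs_nonneg (n.1 : ℝ)
  have hb := abs_nonneg (n.2 : ℝ)
  -- `(1 + |n₁|)² (1 + |n₂|)² ≤ (1 + |n₁| + |n₂|)⁴`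
  rw [← mul_pow, show (4 : ℕ) = 2 * 2 from rfl, pow_mul]
  gcongr
  unfold wt
  nlinarith [mul_nonneg ha hb]

theorem one_le_tsum_wt (j : ℕ) : 1 ≤ ∑' n : ℤ × ℤ, (wt n ^ (2 * (j + 2)))⁻¹ := by
  have := (summable_wt (k := 2 * (j + 2)) (by omega)).le_tsum 0
    (fun n _ => inv_nonneg.2 (pow_nonneg (wt_pos n).le _))
  simpa [wt] using this

/-- The normalising constant that makes the `W^{j+2,2}` norm submultiplicative. -/
noncomputable def sobConst (j : ℕ) : ℝ :=
  √(2 ^ (2 * (j + 2)) * 2 * ∑' n : ℤ × ℤ, (wt n ^ (2 * (j + 2)))⁻¹)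

theorem sobConst_pos (j : ℕ) : 0 < sobConst j := by
  have := one_le_tsum_wt j
  unfold sobConst
  positivity

/-- The weight defining the norm of `W^{j+2,2}`. -/
noncomputable def sobWeight (j : ℕ) (n : ℤ × ℤ) : ℝ := sobConst j * wt n ^ (j + 2)

theorem sobWeight_pos (j : ℕ) (n : ℤ × ℤ) : 0 < sobWeight j n :=
  mul_pos (sobConst_pos j) (pow_pos (wt_pos n) _)

theorem summable_sobWeight (j : ℕ) : Summable fun n => ((sobWeight j n)⁻¹) ^ 2 := by
  have := (summable_wt (k := 2 * (j + 2)) (by omega)).mul_left ((sobConst j)⁻¹ ^ 2)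
  refine this.congr fun n => ?_
  rw [sobWeight, mul_inv, mul_pow, mul_comm 2, pow_mul, inv_pow, inv_pow]

/-- The inequality behind the algebra property: the weight is essentially subadditive, and its
inverse is square summable. -/
theorem tsum_sobWeight_conv_le (j : ℕ) (n : ℤ × ℤ) :
    Summable (fun m => ((sobWeight j m)⁻¹ * (sobWeight j (n - m))⁻¹) ^ 2) ∧
      ∑' m, ((sobWeight j m)⁻¹ * (sobWeight j (n - m))⁻¹) ^ 2 ≤ ((sobWeight j n)⁻¹) ^ 2 := by
  set k := j + 2 with hk
  set S := ∑' n : ℤ × ℤ, (wt n ^ (2 * k))⁻¹ with hS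
  have hS1 : 1 ≤ S := one_le_tsum_wt j
  have hsum : Summable fun n : ℤ × ℤ => (wt n ^ (2 * k))⁻¹ := summable_wt (by omega)
  have hsum' : Summable fun m : ℤ × ℤ => (wt (n - m) ^ (2 * k))⁻¹ :=
    (Equiv.subLeft n).summable_iff.2 hsum
  have hts' : ∑' m : ℤ × ℤ, (wt (n - m) ^ (2 * k))⁻¹ = S :=
    (Equiv.subLeft n).tsum_eq fun m => (wt m ^ (2 * k))⁻¹
  have hC : sobConst j ^ 2 = 2 ^ (2 * k) * 2 * S := Real.sq_sqrt (by positivity)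
  have hC0 := sobConst_pos j
  set B : ℝ := ((sobConst j) ^ 4 * wt n ^ (2 * k))⁻¹ * 2 ^ (2 * k) with hB
  have hle : ∀ m, ((sobWeight j m)⁻¹ * (sobWeight j (n - m))⁻¹) ^ 2 ≤
      B * ((wt m ^ (2 * k))⁻¹ + (wt (n - m) ^ (2 * k))⁻¹) := by
    intro m
    have hm := wt_pos m
    have hnm := wt_pos (n - m)
    have hn := wt_pos n
    have h1 : wt n ^ (2 * k) ≤ 2 ^ (2 * k) * (wt m ^ (2 * k) + wt (n - m) ^ (2 * k)) := by
      have ht : wt n ≤ wt m + wt (n - m) := by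
        simpa using wt_add_le m (n - m)
      -- one of the frequencies `m`, `n - m` has at least half the weight of `n`
      rcases le_total (wt m) (wt (n - m)) with h | h
      · calc wt n ^ (2 * k) ≤ (2 * wt (n - m)) ^ (2 * k) := by gcongr; linarith
          _ = 2 ^ (2 * k) * wt (n - m) ^ (2 * k) := mul_pow _ _ _
          _ ≤ _ := by gcongr; simp; positivity
      · calc wt n ^ (2 * k) ≤ (2 * wt m) ^ (2 * k) := by gcongr; linarith
          _ = 2 ^ (2 * k) * wt m ^ (2 * k) := mul_pow _ _ _
          _ ≤ _ := by gcongr; simp; positivity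
    have e : ((sobWeight j m)⁻¹ * (sobWeight j (n - m))⁻¹) ^ 2 =
        (sobConst j ^ 4 * (wt m ^ (2 * k) * wt (n - m) ^ (2 * k)))⁻¹ := by
      rw [sobWeight, sobWeight, ← hk, ← mul_inv, inv_pow]
      congr 1; ring
    rw [e, hB, ← sub_nonneg]
    have : ((sobConst j) ^ 4 * wt n ^ (2 * k))⁻¹ * 2 ^ (2 * k) *
        ((wt m ^ (2 * k))⁻¹ + (wt (n - m) ^ (2 * k))⁻¹) -
        (sobConst j ^ 4 * (wt m ^ (2 * k) * wt (n - m) ^ (2 * k)))⁻¹ =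
        (2 ^ (2 * k) * (wt m ^ (2 * k) + wt (n - m) ^ (2 * k)) - wt n ^ (2 * k)) *
        (sobConst j ^ 4 * wt n ^ (2 * k) * wt m ^ (2 * k) * wt (n - m) ^ (2 * k))⁻¹ := by
      field_simp
      ring
    rw [this]
    exact mul_nonneg (sub_nonneg.2 h1) (by positivity)
  have hs2 := (hsum.add hsum').mul_left B
  have hs1 := Summable.of_nonneg_of_le (fun m => sq_nonneg _) hle hs2
  refine ⟨hs1, (hs1.tsum_le_tsum hle hs2).trans_eq ?_⟩
  have hn := wt_pos n
  rw [tsum_mul_left, hsum.tsum_add hsum', hts', ← hS, hB, sobWeight, ← hk, inv_pow, mul_pow,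
    ← pow_mul, mul_comm k 2, show (4 : ℕ) = 2 * 2 from rfl, pow_mul, hC]
  field_simp
  ring

/-- Square summable families on the frequency lattice. -/
abbrev EllTwo : Type := lp (fun _ : ℤ × ℤ => ℂ) 2

/-- Bounded continuous complex functions on the plane. -/
abbrev BC : Type := BoundedContinuousFunction (ℝ × ℝ) ℂ

theorem EllTwo.summable_sq (x : EllTwo) : Summable fun n => ‖x n‖ ^ 2 := by
  have := (lp.memℓp x).summable (by norm_num)
  simpa using this

theorem EllTwo.norm_sq (x : EllTwo) : ‖x‖ ^ 2 = ∑' n, ‖x n‖ ^ 2 := by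
  have := lp.norm_rpow_eq_tsum (p := 2) (by norm_num) x
  simpa using this

theorem EllTwo.norm_apply_le (x : EllTwo) (n : ℤ × ℤ) : ‖x n‖ ≤ ‖x‖ :=
  lp.norm_apply_le_norm (by norm_num) x n

/-- A square summable family as an element of `EllTwo`. -/
def EllTwo.mk (f : ℤ × ℤ → ℂ) (h : Summable fun n => ‖f n‖ ^ 2) : EllTwo :=
  ⟨f, memℓp_gen (by simpa using h)⟩

@[simp] theorem EllTwo.mk_apply (f : ℤ × ℤ → ℂ) (h : Summable fun n => ‖f n‖ ^ 2) (n : ℤ × ℤ) :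
    EllTwo.mk f h n = f n := rfl

/-- The character as a bounded continuous function. -/
noncomputable def characterBC (n : ℤ × ℤ) : BC :=
  BoundedContinuousFunction.ofNormedAddCommGroup (character n) (contDiff_character n).continuous 1
    fun p => (norm_character n p).le

theorem norm_characterBC_le (n : ℤ × ℤ) : ‖characterBC n‖ ≤ 1 :=
  BoundedContinuousFunction.norm_ofNormedAddCommGroup_le _ zero_le_one _

theorem cell_univ : cell univ = 1 := by
  rw [cell, Measure.restrict_apply_univ, Measure.volume_eq_prod, Measure.prod_prod]
  simp

instance : IsProbabilityMeasure cell := ⟨cell_univ⟩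

/-- Integration over the torus, as a functional on bounded continuous functions. -/
noncomputable def integralBC : BC →L[ℂ] ℂ :=
  LinearMap.mkContinuous
    { toFun := fun u => ∫ p, u p ∂cell
      map_add' := fun u v => integral_add (integrable_cell_of_continuous u.continuous)
        (integrable_cell_of_continuous v.continuous)
      map_smul' := fun c u => integral_const_mul c _ } 1 (fun u => by
        have := norm_integral_le_of_norm_le_const (μ := cell) (ae_of_all _ u.norm_coe_le_norm)
        simpa using this)

@[simp] theorem integralBC_apply (u : BC) : integralBC u = ∫ p, u p ∂cell := rfl

/-- The `n`-th Fourier coefficient as a functional on bounded continuous functions. -/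
noncomputable def fourierBC (n : ℤ × ℤ) : BC →L[ℂ] ℂ :=
  integralBC.comp (ContinuousLinearMap.mul ℂ BC (characterBC (-n)))

theorem fourierBC_apply (n : ℤ × ℤ) (u : BC) : fourierBC n u = fourierCoef u n := rfl

/-- The `n`-th Fourier coefficient encoded by an element of the weighted `ℓ²` space. -/
noncomputable def wcoef (j : ℕ) (x : EllTwo) (n : ℤ × ℤ) : ℂ := ((sobWeight j n)⁻¹ : ℝ) * x n

theorem norm_wcoef (j : ℕ) (x : EllTwo) (n : ℤ × ℤ) :
    ‖wcoef j x n‖ = (sobWeight j n)⁻¹ * ‖x n‖ := by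
  rw [wcoef, norm_mul, Complex.norm_real,
    Real.norm_of_nonneg (inv_nonneg.2 (sobWeight_pos j n).le)]

theorem summable_norm_wcoef (j : ℕ) (x : EllTwo) : Summable fun n => ‖wcoef j x n‖ := by
  simp only [norm_wcoef]
  exact (tsum_mul_sq_le (fun n => inv_nonneg.2 (sobWeight_pos j n).le) (fun n => norm_nonneg _)
    (summable_sobWeight j) x.summable_sq).1

/-- Sums of Fourier series. -/
noncomputable def series (c : ℤ × ℤ → ℂ) : BC := ∑' n, c n • characterBC n

theorem norm_smul_characterBC_le (c : ℂ) (n : ℤ × ℤ) : ‖c • characterBC n‖ ≤ ‖c‖ := by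
  rw [norm_smul]
  exact mul_le_of_le_one_right (norm_nonneg _) (norm_characterBC_le n)

theorem summable_series {c : ℤ × ℤ → ℂ} (h : Summable fun n => ‖c n‖) :
    Summable fun n => c n • characterBC n :=
  Summable.of_norm_bounded h fun n => norm_smul_characterBC_le _ n

theorem hasSum_series_apply {c : ℤ × ℤ → ℂ} (h : Summable fun n => ‖c n‖) (p : ℝ × ℝ) :
    HasSum (fun n => c n * character n p) (series c p) :=
  (BoundedContinuousFunction.evalCLM ℂ p).hasSum (summable_series h).hasSum

theorem fourierCoef_series {c : ℤ × ℤ → ℂ} (h : Summable fun n => ‖c n‖) (n : ℤ × ℤ) :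
    fourierCoef (series c) n = c n := by
  rw [← fourierBC_apply, series, (fourierBC n).map_tsum (summable_series h)]
  rw [tsum_eq_single n]
  · rw [map_smul, fourierBC_apply]
    change c n • fourierCoef (character n) n = _
    rw [fourierCoef_character]; simp
  · intro m hm
    rw [map_smul, fourierBC_apply]
    change c m • fourierCoef (character m) n = _
    rw [fourierCoef_character]; simp [hm]

theorem periodic₂_series {c : ℤ × ℤ → ℂ} (h : Summable fun n => ‖c n‖) :
    Periodic₂ (series c) := by
  intro x y
  constructor
  · refine (hasSum_series_apply h _).unique ?_
    simpa only [(periodic₂_character _ x y).1] using hasSum_series_apply h (x, y)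
  · refine (hasSum_series_apply h _).unique ?_
    simpa only [(periodic₂_character _ x y).2] using hasSum_series_apply h (x, y)

/-- A continuous function on the torus whose Fourier coefficients are absolutely summable is the
sum of its Fourier series. -/
theorem eq_series {u : ℝ × ℝ → ℂ} (hp : Periodic₂ u) (hc : Continuous u)
    (h : Summable fun n => ‖fourierCoef u n‖) : u = series (fourierCoef u) := by
  have := eq_zero_of_fourierCoef_eq_zero (u := u - series (fourierCoef u)) (fun x y => ?_)
    (hc.sub (series (fourierCoef u)).continuous) fun n => ?_
  · exact sub_eq_zero.1 this
  · simp only [Pi.sub_apply, (hp x y).1, (hp x y).2, (periodic₂_series h x y).1,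
      (periodic₂_series h x y).2, and_self]
  · have h1 := fourierCoef_series h n
    rw [fourierCoef] at h1 ⊢
    have i1 : Integrable (fun p => character (-n) p * u p) cell :=
      integrable_cell_of_continuous ((contDiff_character _).continuous.mul hc)
    have i2 : Integrable (fun p => character (-n) p * series (fourierCoef u) p) cell :=
      integrable_cell_of_continuous
        ((contDiff_character _).continuous.mul (series (fourierCoef u)).continuous)
    simp only [Pi.sub_apply, mul_sub]
    rw [integral_sub i1 i2, h1, fourierCoef, sub_self]

theorem fourierCoef_character_mul (m n : ℤ × ℤ) (u : ℝ × ℝ → ℂ) :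
    fourierCoef (fun p => character m p * u p) n = fourierCoef u (n - m) := by
  simp only [fourierCoef, ← mul_assoc, ← character_add]
  congr 3
  funext p
  congr 2
  abel

/-- Fourier coefficients of a product. -/
theorem fourierCoef_series_mul {c : ℤ × ℤ → ℂ} (h : Summable fun n => ‖c n‖) (u : BC)
    (n : ℤ × ℤ) :
    HasSum (fun m => c m * fourierCoef u (n - m)) (fourierCoef (series c * u) n) := by
  have h1 := ((fourierBC n).comp ((ContinuousLinearMap.mul ℂ BC).flip u)).hasSum
    (summable_series h).hasSum
  have e : ∀ m, ((fourierBC n).comp ((ContinuousLinearMap.mul ℂ BC).flip u)) (c m • characterBC m)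
      = c m * fourierCoef u (n - m) := by
    intro m
    rw [map_smul, ← fourierCoef_character_mul]
    rfl
  simp only [e] at h1
  exact h1

/-- The convolution of two summable families of nonnegative reals is summable. -/
theorem summable_conv {F G : ℤ × ℤ → ℝ} (hF0 : ∀ n, 0 ≤ F n) (hG0 : ∀ n, 0 ≤ G n)
    (hF : Summable F) (hG : Summable G) :
    (∀ n, Summable fun m => F m * G (n - m)) ∧ (Summable fun n => ∑' m, F m * G (n - m)) ∧
      ∑' n, ∑' m, F m * G (n - m) = (∑' n, F n) * ∑' n, G n := by
  have h0 : Summable fun q : (ℤ × ℤ) × (ℤ × ℤ) => F q.1 * G q.2 := hF.mul_of_nonneg hG hF0 hG0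
  let e : (ℤ × ℤ) × (ℤ × ℤ) ≃ (ℤ × ℤ) × (ℤ × ℤ) :=
    { toFun := fun q => (q.2, q.1 - q.2)
      invFun := fun q => (q.1 + q.2, q.1)
      left_inv := fun q => by simp
      right_inv := fun q => by simp }
  have h1 : Summable fun q : (ℤ × ℤ) × (ℤ × ℤ) => F q.2 * G (q.1 - q.2) := e.summable_iff.2 h0
  have h2 : ∑' q : (ℤ × ℤ) × (ℤ × ℤ), F q.2 * G (q.1 - q.2) =
      ∑' q : (ℤ × ℤ) × (ℤ × ℤ), F q.1 * G q.2 := e.tsum_eq fun q => F q.1 * G q.2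
  refine ⟨fun n => h1.prod_factor n, h1.prod, ?_⟩
  rw [← h1.tsum_prod, h2, hF.tsum_mul_tsum hG h0]

/-- The weighted convolution of two elements of `EllTwo` is square summable: Cauchy–Schwarz and
`tsum_sobWeight_conv_le`. -/
theorem sobWeight_conv (j : ℕ) (x y : EllTwo) :
    Summable (fun n => (sobWeight j n * ∑' m, ‖wcoef j x m‖ * ‖wcoef j y (n - m)‖) ^ 2) ∧
    ∑' n, (sobWeight j n * ∑' m, ‖wcoef j x m‖ * ‖wcoef j y (n - m)‖) ^ 2 ≤ (‖x‖ * ‖y‖) ^ 2 := by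
  obtain ⟨hfib, hsum, htsum⟩ := summable_conv (F := fun n => ‖x n‖ ^ 2) (G := fun n => ‖y n‖ ^ 2)
    (fun n => sq_nonneg _) (fun n => sq_nonneg _) x.summable_sq y.summable_sq
  have hle : ∀ n, (sobWeight j n * ∑' m, ‖wcoef j x m‖ * ‖wcoef j y (n - m)‖) ^ 2 ≤
      ∑' m, ‖x m‖ ^ 2 * ‖y (n - m)‖ ^ 2 := by
    intro n
    obtain ⟨h1, h2⟩ := tsum_sobWeight_conv_le j n
    have h3 := (tsum_mul_sq_le
      (f := fun m => (sobWeight j m)⁻¹ * (sobWeight j (n - m))⁻¹)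
      (g := fun m => ‖x m‖ * ‖y (n - m)‖)
      (fun m => mul_nonneg (inv_nonneg.2 (sobWeight_pos j m).le)
        (inv_nonneg.2 (sobWeight_pos j _).le))
      (fun m => by positivity) h1 (by simpa only [mul_pow] using hfib n)).2
    have e : ∀ m, ‖wcoef j x m‖ * ‖wcoef j y (n - m)‖ =
        (sobWeight j m)⁻¹ * (sobWeight j (n - m))⁻¹ * (‖x m‖ * ‖y (n - m)‖) := by
      intro m; rw [norm_wcoef, norm_wcoef]; ring
    simp only [e, mul_pow (sobWeight j n)]
    simp only [mul_pow ‖x _‖] at h3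
    have hw := sobWeight_pos j n
    have h0 : 0 ≤ ∑' m, ‖x m‖ ^ 2 * ‖y (n - m)‖ ^ 2 :=
      tsum_nonneg fun m => by positivity
    calc _ ≤ sobWeight j n ^ 2 * ((sobWeight j n)⁻¹ ^ 2 * ∑' m, ‖x m‖ ^ 2 * ‖y (n - m)‖ ^ 2) := by
          gcongr
          exact h3.trans (by gcongr)
      _ = _ := by field_simp
  have hs := Summable.of_nonneg_of_le (fun n => sq_nonneg _) hle hsum
  refine ⟨hs, (hs.tsum_le_tsum hle hsum).trans_eq ?_⟩
  rw [htsum, mul_pow, EllTwo.norm_sq, EllTwo.norm_sq]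

/-- The Fourier series with weighted square summable coefficients. -/
noncomputable def sobSeries (j : ℕ) : EllTwo →ₗ[ℂ] BC where
  toFun x := series (wcoef j x)
  map_add' x y := by
    rw [series, series, series, ← (summable_series (summable_norm_wcoef j x)).tsum_add
      (summable_series (summable_norm_wcoef j y))]
    refine tsum_congr fun n => ?_
    rw [← add_smul]; congr 1
    simp [wcoef, mul_add]
  map_smul' c x := by
    rw [series, series, RingHom.id_apply,
      ← (summable_series (summable_norm_wcoef j x)).tsum_const_smul]
    refine tsum_congr fun n => ?_
    rw [smul_smul]; congr 1
    simp [wcoef]; ring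

theorem fourierCoef_sobSeries (j : ℕ) (x : EllTwo) (n : ℤ × ℤ) :
    fourierCoef (sobSeries j x) n = wcoef j x n :=
  fourierCoef_series (summable_norm_wcoef j x) n

theorem sobSeries_injective (j : ℕ) : Function.Injective (sobSeries j) := by
  intro x y h
  ext n
  have := fourierCoef_sobSeries j x n
  rw [h, fourierCoef_sobSeries, wcoef, wcoef] at this
  have hw : (((sobWeight j n)⁻¹ : ℝ) : ℂ) ≠ 0 := by
    exact_mod_cast (inv_pos.2 (sobWeight_pos j n)).ne'
  exact (mul_left_cancel₀ hw this).symm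

/-- Membership in the range of `sobSeries` through Fourier coefficients. -/
theorem exists_sobSeries_eq (j : ℕ) {u : BC} (hp : Periodic₂ u)
    (h : Summable fun n => ‖(sobWeight j n : ℂ) * fourierCoef u n‖ ^ 2) :
    sobSeries j (EllTwo.mk _ h) = u := by
  have e : wcoef j (EllTwo.mk _ h) = fourierCoef u := by
    funext n
    have hw : ((sobWeight j n : ℝ) : ℂ) ≠ 0 := by exact_mod_cast (sobWeight_pos j n).ne'
    rw [wcoef, EllTwo.mk_apply, Complex.ofReal_inv, inv_mul_cancel_left₀ hw]
  have hs := summable_norm_wcoef j (EllTwo.mk _ h)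
  rw [e] at hs
  refine DFunLike.coe_injective ?_
  change ⇑(series (wcoef j (EllTwo.mk _ h))) = u
  rw [e]
  exact (eq_series hp u.continuous hs).symm

/-- The functions of class `W^{j+2,2}` form an algebra, and their norm is submultiplicative. -/
theorem sobSeries_mul (j : ℕ) (x y : EllTwo) :
    ∃ z, sobSeries j z = sobSeries j x * sobSeries j y ∧ ‖z‖ ≤ ‖x‖ * ‖y‖ := by
  obtain ⟨h1, h2⟩ := sobWeight_conv j x y
  have hle : ∀ n, ‖(sobWeight j n : ℂ) * fourierCoef (sobSeries j x * sobSeries j y) n‖ ^ 2 ≤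
      (sobWeight j n * ∑' m, ‖wcoef j x m‖ * ‖wcoef j y (n - m)‖) ^ 2 := by
    intro n
    rw [norm_mul, Complex.norm_real, Real.norm_of_nonneg (sobWeight_pos j n).le]
    have hw := sobWeight_pos j n
    gcongr
    have hs := fourierCoef_series_mul (summable_norm_wcoef j x) (sobSeries j y) n
    simp only [fourierCoef_sobSeries] at hs
    change ‖fourierCoef (series (wcoef j x) * sobSeries j y) n‖ ≤ _
    rw [← hs.tsum_eq]
    have hsy : Summable fun m => ‖wcoef j y (n - m)‖ :=
      (Equiv.subLeft n).summable_iff.2 (summable_norm_wcoef j y)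
    have hsn : Summable fun m => ‖wcoef j x m‖ * ‖wcoef j y (n - m)‖ := by
      refine Summable.of_nonneg_of_le (fun m => by positivity) (fun m => ?_)
        ((summable_norm_wcoef j x).mul_right (∑' m, ‖wcoef j y (n - m)‖))
      gcongr
      exact hsy.le_tsum m fun _ _ => norm_nonneg _
    refine (norm_tsum_le_tsum_norm (by simpa only [norm_mul] using hsn)).trans_eq ?_
    simp only [norm_mul]
  have hs := Summable.of_nonneg_of_le (fun n => sq_nonneg _) hle h1
  have hper : Periodic₂ (sobSeries j x * sobSeries j y) :=
    (periodic₂_series (summable_norm_wcoef j x)).mul (periodic₂_series (summable_norm_wcoef j y))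
  refine ⟨EllTwo.mk _ hs, exists_sobSeries_eq j hper hs, ?_⟩
  refine le_of_sq_le_sq ?_ (by positivity)
  rw [EllTwo.norm_sq]
  exact (hs.tsum_le_tsum hle h1).trans h2

theorem sobSeries_const (j : ℕ) (c : ℂ) : ∃ z, sobSeries j z = algebraMap ℂ BC c := by
  have e : ∀ n, fourierCoef (algebraMap ℂ BC c) n = if n = 0 then c else 0 := by
    intro n
    have := fourierCoef_character 0 n
    simp only [fourierCoef, character_zero, mul_one] at this
    change ∫ p, character (-n) p * c ∂cell = _
    rw [integral_mul_const, this]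
    by_cases h : n = 0
    · simp [h]
    · simp [h, Ne.symm h]
  refine ⟨_, exists_sobSeries_eq j (fun x y => ⟨rfl, rfl⟩) ?_⟩
  refine summable_of_ne_finset_zero (s := {0}) fun n hn => ?_
  rw [e, if_neg (by simpa using hn)]
  simp

/-- The functions of class `W^{j+2,2}` on the torus, a subalgebra of the continuous functions. -/
noncomputable def sobSubalgebra (j : ℕ) : Subalgebra ℂ BC where
  carrier := range (sobSeries j)
  mul_mem' := by
    rintro _ _ ⟨x, rfl⟩ ⟨y, rfl⟩
    obtain ⟨z, hz, -⟩ := sobSeries_mul j x y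
    exact ⟨z, hz⟩
  add_mem' := by
    rintro _ _ ⟨x, rfl⟩ ⟨y, rfl⟩
    exact ⟨x + y, map_add _ _ _⟩
  algebraMap_mem' := fun c => sobSeries_const j c

/-- The complex Sobolev space `W^{j+2,2}` of the torus, normed by a multiple of the weighted
`ℓ²` norm of the Fourier coefficients, so that it is a commutative Banach algebra. -/
def Sob (j : ℕ) : Type := ↥(sobSubalgebra j)

namespace Sob

variable {j : ℕ}

noncomputable instance : CommRing (Sob j) := inferInstanceAs (CommRing ↥(sobSubalgebra j))

noncomputable instance : Algebra ℂ (Sob j) := inferInstanceAs (Algebra ℂ ↥(sobSubalgebra j))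

/-- The underlying bounded continuous function. -/
noncomputable def ev : Sob j →ₐ[ℂ] BC := (sobSubalgebra j).val

theorem ev_injective : Function.Injective (ev (j := j)) := Subtype.val_injective

/-- The function with given weighted Fourier coefficients. -/
noncomputable def ofCoord : EllTwo ≃ₗ[ℂ] Sob j :=
  LinearEquiv.ofBijective
    ({ toFun := fun x => ⟨sobSeries j x, x, rfl⟩
       map_add' := fun x y => Subtype.ext (map_add _ x y)
       map_smul' := fun c x => Subtype.ext (map_smul _ c x) } : EllTwo →ₗ[ℂ] Sob j)
    ⟨fun _ _ h => sobSeries_injective j (congrArg Subtype.val h),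
      fun ⟨_, x, hx⟩ => ⟨x, Subtype.ext hx⟩⟩

theorem ev_ofCoord (x : EllTwo) : ev (ofCoord x : Sob j) = sobSeries j x := rfl

noncomputable instance : NormedAddCommGroup (Sob j) :=
  NormedAddCommGroup.induced (Sob j) EllTwo (ofCoord (j := j)).symm.toLinearMap
    (ofCoord (j := j)).symm.injective

theorem norm_def (u : Sob j) : ‖u‖ = ‖ofCoord.symm u‖ := rfl

theorem norm_ofCoord (x : EllTwo) : ‖(ofCoord x : Sob j)‖ = ‖x‖ := by
  rw [norm_def, LinearEquiv.symm_apply_apply]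

noncomputable instance : NormedCommRing (Sob j) where
  __ := (inferInstance : NormedAddCommGroup (Sob j))
  __ := (inferInstance : CommRing (Sob j))
  norm_mul_le u v := by
    obtain ⟨x, rfl⟩ := ofCoord.surjective u
    obtain ⟨y, rfl⟩ := ofCoord.surjective v
    obtain ⟨z, hz, hn⟩ := sobSeries_mul j x y
    have : (ofCoord x * ofCoord y : Sob j) = ofCoord z := ev_injective (by
      rw [map_mul, ev_ofCoord, ev_ofCoord, ev_ofCoord, hz])
    change ‖(ofCoord x * ofCoord y : Sob j)‖ ≤ ‖(ofCoord x : Sob j)‖ * ‖(ofCoord y : Sob j)‖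
    rw [this, norm_ofCoord, norm_ofCoord, norm_ofCoord]
    exact hn

noncomputable instance : NormedAlgebra ℂ (Sob j) where
  norm_smul_le c u := by
    rw [norm_def, norm_def, map_smul, norm_smul]

/-- The isometry with the space of weighted Fourier coefficients. -/
noncomputable def isom : EllTwo ≃ₗᵢ[ℂ] Sob j := ⟨ofCoord, norm_ofCoord⟩

theorem ev_isom (x : EllTwo) : ev (isom x : Sob j) = sobSeries j x := rfl

instance : CompleteSpace (Sob j) :=
  ((isom (j := j)).isometry.isUniformInducing.completeSpace_congr (isom (j := j)).surjective).1
    inferInstance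

end Sob
end CWillmore

/-! ### Fourier multipliers, derivatives and smooth functions -/

namespace CWillmore

namespace Sob

variable {j k : ℕ}

/-- The Fourier coefficients of an element of the Sobolev algebra. -/
noncomputable def coef (u : Sob j) (n : ℤ × ℤ) : ℂ := fourierCoef (ev u) n

theorem coef_isom (x : EllTwo) (n : ℤ × ℤ) :
    coef (isom x : Sob j) n = ((sobWeight j n)⁻¹ : ℝ) * x n :=
  fourierCoef_sobSeries j x n

theorem isom_symm_apply (u : Sob j) (n : ℤ × ℤ) : isom.symm u n = sobWeight j n * coef u n := by
  obtain ⟨x, rfl⟩ := isom.surjective u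
  have hw : ((sobWeight j n : ℝ) : ℂ) ≠ 0 := by exact_mod_cast (sobWeight_pos j n).ne'
  rw [coef_isom, LinearIsometryEquiv.symm_apply_apply, Complex.ofReal_inv,
    mul_inv_cancel_left₀ hw]

theorem ext_coef {u v : Sob j} (h : ∀ n, coef u n = coef v n) : u = v := by
  refine isom.symm.injective ?_
  ext n
  rw [isom_symm_apply, isom_symm_apply, h]

theorem summable_sq_coef (u : Sob j) : Summable fun n => (sobWeight j n * ‖coef u n‖) ^ 2 := by
  refine (isom.symm u).summable_sq.congr fun n => ?_
  rw [isom_symm_apply, norm_mul, Complex.norm_real, Real.norm_of_nonneg (sobWeight_pos j n).le]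

theorem summable_coef (u : Sob j) : Summable fun n => ‖coef u n‖ := by
  obtain ⟨x, rfl⟩ := isom.surjective u
  refine (summable_norm_wcoef j x).congr fun n => ?_
  rw [coef_isom, wcoef]

/-- Cauchy–Schwarz: two of the `j + 2` orders of decay are used for absolute summability. -/
theorem summable_wt_coef (u : Sob j) : Summable fun n => wt n ^ j * ‖coef u n‖ := by
  have h := (tsum_mul_sq_le (f := fun n => (wt n ^ 2)⁻¹) (g := fun n => wt n ^ (j + 2) * ‖coef u n‖)
    (fun n => inv_nonneg.2 (pow_nonneg (wt_pos n).le _))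
    (fun n => mul_nonneg (pow_nonneg (wt_pos n).le _) (norm_nonneg _)) ?_ ?_).1
  · refine h.congr fun n => ?_
    have := wt_pos n
    rw [pow_add]; field_simp
  · refine (summable_wt (k := 4) le_rfl).congr fun n => ?_
    rw [inv_pow, ← pow_mul]
  · refine ((summable_sq_coef u).mul_left ((sobConst j)⁻¹ ^ 2)).congr fun n => ?_
    have := sobConst_pos j
    rw [sobWeight]; field_simp

theorem hasSum_apply (u : Sob j) (p : ℝ × ℝ) :
    HasSum (fun n => coef u n * character n p) (ev u p) := by
  obtain ⟨x, rfl⟩ := isom.surjective u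
  refine (hasSum_series_apply (summable_norm_wcoef j x) p).congr_fun fun n => ?_
  rw [coef_isom, wcoef]

theorem periodic (u : Sob j) : Periodic₂ (ev u) := by
  obtain ⟨x, rfl⟩ := isom.surjective u
  exact periodic₂_series (summable_norm_wcoef j x)

/-- A continuous function on the torus whose Fourier coefficients are square summable with the
weights of `W^{j+2,2}` belongs to this space. -/
theorem exists_ev_eq {u : ℝ × ℝ → ℂ} (hp : Periodic₂ u) (hc : Continuous u)
    (h : Summable fun n => (wt n ^ (j + 2) * ‖fourierCoef u n‖) ^ 2) :
    ∃ v : Sob j, ⇑(ev v) = u ∧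
      ‖v‖ ^ 2 = sobConst j ^ 2 * ∑' n, (wt n ^ (j + 2) * ‖fourierCoef u n‖) ^ 2 := by
  have e : ∀ n, ‖(sobWeight j n : ℂ) * fourierCoef u n‖ ^ 2 =
      sobConst j ^ 2 * (wt n ^ (j + 2) * ‖fourierCoef u n‖) ^ 2 := by
    intro n
    rw [norm_mul, Complex.norm_real, Real.norm_of_nonneg (sobWeight_pos j n).le, sobWeight]
    ring
  have h' : Summable fun n => ‖(sobWeight j n : ℂ) * fourierCoef u n‖ ^ 2 := by
    simpa only [e] using h.mul_left (sobConst j ^ 2)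
  have ew : wcoef j (EllTwo.mk _ h') = fourierCoef u := by
    funext n
    have hw : ((sobWeight j n : ℝ) : ℂ) ≠ 0 := by exact_mod_cast (sobWeight_pos j n).ne'
    rw [wcoef, EllTwo.mk_apply, Complex.ofReal_inv, inv_mul_cancel_left₀ hw]
  have hs := summable_norm_wcoef j (EllTwo.mk _ h')
  refine ⟨isom (EllTwo.mk _ h'), ?_, ?_⟩
  · rw [ev_isom]
    change ⇑(series (wcoef j (EllTwo.mk _ h'))) = u
    rw [ew] at hs ⊢
    exact (eq_series hp hc hs).symm
  · rw [LinearIsometryEquiv.norm_map, EllTwo.norm_sq]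
    simp only [EllTwo.mk_apply, e, tsum_mul_left]

/-- The evaluation map into bounded continuous functions, as a continuous linear map: Sobolev's
embedding. -/
noncomputable def evL : Sob j →L[ℂ] BC :=
  LinearMap.mkContinuous (ev (j := j)).toLinearMap (√(∑' n, ((sobWeight j n)⁻¹) ^ 2)) (by
    intro u
    obtain ⟨x, rfl⟩ := isom.surjective u
    rw [LinearIsometryEquiv.norm_map]
    change ‖series (wcoef j x)‖ ≤ _
    have h1 := summable_norm_wcoef j x
    have h2 : ‖series (wcoef j x)‖ ≤ ∑' n, ‖wcoef j x n‖ :=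
      (summable_series h1).hasSum.norm_le_of_bounded h1.hasSum
        fun n => norm_smul_characterBC_le _ n
    refine h2.trans (le_of_sq_le_sq ?_ (by positivity))
    rw [mul_pow, Real.sq_sqrt (tsum_nonneg fun n => sq_nonneg _), EllTwo.norm_sq]
    simp only [norm_wcoef]
    exact (tsum_mul_sq_le (fun n => inv_nonneg.2 (sobWeight_pos j n).le)
      (fun n => norm_nonneg _) (summable_sobWeight j) x.summable_sq).2)

theorem continuous_ev : Continuous (ev (j := j)) := (evL (j := j)).continuous

/-- Fourier coefficients as continuous functionals. -/
noncomputable def coefL (n : ℤ × ℤ) : Sob j →L[ℂ] ℂ := (fourierBC n).comp evL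

theorem coef_add (u v : Sob j) (n : ℤ × ℤ) : coef (u + v) n = coef u n + coef v n :=
  map_add (coefL n) u v

theorem coef_sub (u v : Sob j) (n : ℤ × ℤ) : coef (u - v) n = coef u n - coef v n :=
  map_sub (coefL n) u v

theorem coef_smul (c : ℂ) (u : Sob j) (n : ℤ × ℤ) : coef (c • u) n = c * coef u n :=
  map_smul (coefL n) c u

theorem coef_algebraMap (c : ℂ) (n : ℤ × ℤ) :
    coef (algebraMap ℂ (Sob j) c) n = if n = 0 then c else 0 := by
  have := fourierCoef_character 0 n
  simp only [fourierCoef, character_zero, mul_one] at this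
  have h2 : coef (algebraMap ℂ (Sob j) c) n = ∫ p, character (-n) p * c ∂cell := by
    rw [coef, fourierCoef]
    simp only [AlgHom.commutes]
    rfl
  rw [h2, integral_mul_const, this]
  by_cases h : n = 0
  · simp [h]
  · simp [h, Ne.symm h]

end Sob

/-- The diagonal operator on `ℓ²` with bounded entries. -/
noncomputable def diagonal (d : ℤ × ℤ → ℂ) (C : ℝ) (hC : 0 ≤ C) (hd : ∀ n, ‖d n‖ ≤ C) :
    EllTwo →L[ℂ] EllTwo :=
  have hle : ∀ (x : EllTwo) (n), ‖d n * x n‖ ^ 2 ≤ C ^ 2 * ‖x n‖ ^ 2 := fun x n => by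
    rw [← mul_pow, norm_mul]
    gcongr
    exact hd n
  have hs : ∀ x : EllTwo, Summable fun n => ‖d n * x n‖ ^ 2 := fun x =>
    Summable.of_nonneg_of_le (fun _ => sq_nonneg _) (hle x) (x.summable_sq.mul_left _)
  LinearMap.mkContinuous
    { toFun := fun x => EllTwo.mk (fun n => d n * x n) (hs x)
      map_add' := fun x y => by ext n; simp [mul_add]
      map_smul' := fun c x => by ext n; simp; ring } C (fun x => by
        refine le_of_sq_le_sq ?_ (by positivity)
        rw [mul_pow, EllTwo.norm_sq, EllTwo.norm_sq, ← tsum_mul_left]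
        exact (hs x).tsum_le_tsum (hle x) (x.summable_sq.mul_left _))

theorem diagonal_apply (d : ℤ × ℤ → ℂ) (C : ℝ) (hC : 0 ≤ C) (hd : ∀ n, ‖d n‖ ≤ C) (x : EllTwo)
    (n : ℤ × ℤ) : diagonal d C hC hd x n = d n * x n := rfl

namespace Sob

variable {j k : ℕ}

/-- The Fourier multiplier with symbol `m`, between Sobolev spaces. The bound `C` is on the symbol
relative to the weights of the two spaces. -/
noncomputable def multiplier (m : ℤ × ℤ → ℂ) (C : ℝ) (hC : 0 ≤ C)
    (hm : ∀ n, ‖(sobWeight k n : ℂ) * m n * ((sobWeight j n)⁻¹ : ℝ)‖ ≤ C) : Sob j →L[ℂ] Sob k :=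
  (isom (j := k)).toContinuousLinearEquiv.toContinuousLinearMap.comp
    ((diagonal (fun n => (sobWeight k n : ℂ) * m n * ((sobWeight j n)⁻¹ : ℝ)) C hC hm).comp
      (isom (j := j)).symm.toContinuousLinearEquiv.toContinuousLinearMap)

theorem coef_multiplier (m : ℤ × ℤ → ℂ) (C : ℝ) (hC : 0 ≤ C)
    (hm : ∀ n, ‖(sobWeight k n : ℂ) * m n * ((sobWeight j n)⁻¹ : ℝ)‖ ≤ C) (u : Sob j)
    (n : ℤ × ℤ) : coef (multiplier m C hC hm u) n = m n * coef u n := by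
  have hw : ((sobWeight j n : ℝ) : ℂ) ≠ 0 := by exact_mod_cast (sobWeight_pos j n).ne'
  have hw' : ((sobWeight k n : ℝ) : ℂ) ≠ 0 := by exact_mod_cast (sobWeight_pos k n).ne'
  have : multiplier m C hC hm u = isom (diagonal (fun n => (sobWeight k n : ℂ) * m n *
    ((sobWeight j n)⁻¹ : ℝ)) C hC hm (isom.symm u)) := rfl
  rw [this, coef_isom, diagonal_apply, isom_symm_apply]
  push_cast
  field_simp

theorem norm_two_pi_I : ‖(2 * Real.pi * Complex.I : ℂ)‖ = 2 * Real.pi := by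
  simp [abs_of_pos Real.pi_pos]

theorem symbol_bound {m : ℤ × ℤ → ℂ} {B : ℝ} (hB : ∀ n, ‖m n‖ ≤ B * wt n) (n : ℤ × ℤ) :
    ‖(sobWeight j n : ℂ) * m n * ((sobWeight (j + 1) n)⁻¹ : ℝ)‖ ≤
      B * (sobConst j / sobConst (j + 1)) := by
  have h1 := sobConst_pos j
  have h2 := sobConst_pos (j + 1)
  have h3 := wt_pos n
  rw [norm_mul, norm_mul, Complex.norm_real, Complex.norm_real,
    Real.norm_of_nonneg (sobWeight_pos j n).le,
    Real.norm_of_nonneg (inv_nonneg.2 (sobWeight_pos _ n).le)]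
  calc sobWeight j n * ‖m n‖ * (sobWeight (j + 1) n)⁻¹
      ≤ sobWeight j n * (B * wt n) * (sobWeight (j + 1) n)⁻¹ := by
        have := sobWeight_pos j n
        have := sobWeight_pos (j + 1) n
        gcongr
        exact hB n
    _ = _ := by
        rw [sobWeight, sobWeight, show j + 1 + 2 = j + 2 + 1 by ring, pow_succ (wt n) (j + 2)]
        field_simp

theorem norm_symbol₁_le (n : ℤ × ℤ) :
    ‖(2 * Real.pi * Complex.I * n.1 : ℂ)‖ ≤ 2 * Real.pi * wt n := by
  rw [norm_mul, norm_two_pi_I, Complex.norm_intCast]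
  have := abs_nonneg (n.2 : ℝ)
  gcongr
  unfold wt; linarith

theorem norm_symbol₂_le (n : ℤ × ℤ) :
    ‖(2 * Real.pi * Complex.I * n.2 : ℂ)‖ ≤ 2 * Real.pi * wt n := by
  rw [norm_mul, norm_two_pi_I, Complex.norm_intCast]
  have := abs_nonneg (n.1 : ℝ)
  gcongr
  unfold wt; linarith

/-- The first partial derivative. -/
noncomputable def D₁ : Sob (j + 1) →L[ℂ] Sob j :=
  multiplier (fun n => 2 * Real.pi * Complex.I * n.1)
    (2 * Real.pi * (sobConst j / sobConst (j + 1)))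
    (by have := sobConst_pos j; have := sobConst_pos (j + 1); positivity)
    (symbol_bound norm_symbol₁_le)

/-- The second partial derivative. -/
noncomputable def D₂ : Sob (j + 1) →L[ℂ] Sob j :=
  multiplier (fun n => 2 * Real.pi * Complex.I * n.2)
    (2 * Real.pi * (sobConst j / sobConst (j + 1)))
    (by have := sobConst_pos j; have := sobConst_pos (j + 1); positivity)
    (symbol_bound norm_symbol₂_le)

theorem coef_D₁ (u : Sob (j + 1)) (n : ℤ × ℤ) :
    coef (D₁ u) n = 2 * Real.pi * Complex.I * n.1 * coef u n :=
  coef_multiplier _ _ _ _ u n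

theorem coef_D₂ (u : Sob (j + 1)) (n : ℤ × ℤ) :
    coef (D₂ u) n = 2 * Real.pi * Complex.I * n.2 * coef u n :=
  coef_multiplier _ _ _ _ u n

/-- The real linear map `ℝ² → ℂ` with the given partial derivatives. -/
noncomputable def gradL (a b : ℂ) : ℝ × ℝ →L[ℝ] ℂ :=
  (ContinuousLinearMap.fst ℝ ℝ ℝ).smulRight a + (ContinuousLinearMap.snd ℝ ℝ ℝ).smulRight b

@[simp] theorem gradL_apply (a b : ℂ) (p : ℝ × ℝ) : gradL a b p = p.1 • a + p.2 • b := rfl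

/-- `gradL` as a continuous linear map. -/
noncomputable def gradLL : ℂ × ℂ →L[ℝ] (ℝ × ℝ →L[ℝ] ℂ) :=
  (ContinuousLinearMap.smulRightL ℝ (ℝ × ℝ) ℂ (ContinuousLinearMap.fst ℝ ℝ ℝ)).comp
      (ContinuousLinearMap.fst ℝ ℂ ℂ) +
    (ContinuousLinearMap.smulRightL ℝ (ℝ × ℝ) ℂ (ContinuousLinearMap.snd ℝ ℝ ℝ)).comp
      (ContinuousLinearMap.snd ℝ ℂ ℂ)

theorem gradLL_apply (q : ℂ × ℂ) : gradLL q = gradL q.1 q.2 := rfl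

/-- Termwise differentiation of the Fourier series. -/
theorem hasFDerivAt (u : Sob (j + 1)) (p : ℝ × ℝ) :
    HasFDerivAt (ev u) (gradL (ev (D₁ u) p) (ev (D₂ u) p)) p := by
  have hs : HasSum (fun n => gradL (coef (D₁ u) n * character n p) (coef (D₂ u) n * character n p))
      (gradL (ev (D₁ u) p) (ev (D₂ u) p)) := by
    have h0 := gradLL.hasSum ((hasSum_apply (D₁ u) p).prodMk (hasSum_apply (D₂ u) p))
    simpa only [gradLL_apply] using h0
  have he : (ev u : ℝ × ℝ → ℂ) = fun p => ∑' n, coef u n * character n p :=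
    funext fun p => (hasSum_apply u p).tsum_eq.symm
  rw [← hs.tsum_eq, he]
  refine hasFDerivAt_tsum (u := fun n => 2 * (2 * Real.pi) * (wt n ^ (j + 1) * ‖coef u n‖))
    (f' := fun n p => gradL (coef (D₁ u) n * character n p) (coef (D₂ u) n * character n p))
    ((summable_wt_coef u).mul_left _) (fun n p => ?_) (fun n p => ?_)
    (hasSum_apply u p).summable p
  · refine ((hasFDerivAt_character n p).const_mul (coef u n)).congr_fderiv ?_
    ext <;> simp [coef_D₁, coef_D₂] <;> ring
  · have hw := one_le_wt n
    have hwt : wt n ≤ wt n ^ (j + 1) := le_self_pow₀ hw (by omega)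
    refine ContinuousLinearMap.opNorm_le_bound _ (by positivity) fun q => ?_
    have h1 : ‖q.1‖ ≤ ‖q‖ := norm_fst_le q
    have h2 : ‖q.2‖ ≤ ‖q‖ := norm_snd_le q
    have e1 : ‖coef (D₁ u) n * character n p‖ ≤ 2 * Real.pi * wt n ^ (j + 1) * ‖coef u n‖ := by
      rw [norm_mul, norm_character, mul_one, coef_D₁, norm_mul]
      gcongr
      refine (norm_symbol₁_le n).trans ?_
      gcongr
    have e2 : ‖coef (D₂ u) n * character n p‖ ≤ 2 * Real.pi * wt n ^ (j + 1) * ‖coef u n‖ := by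
      rw [norm_mul, norm_character, mul_one, coef_D₂, norm_mul]
      gcongr
      refine (norm_symbol₂_le n).trans ?_
      gcongr
    rw [gradL_apply]
    refine (norm_add_le _ _).trans ?_
    rw [norm_smul, norm_smul]
    calc _ ≤ ‖q‖ * (2 * Real.pi * wt n ^ (j + 1) * ‖coef u n‖) +
          ‖q‖ * (2 * Real.pi * wt n ^ (j + 1) * ‖coef u n‖) := by gcongr
      _ = _ := by ring

theorem contDiff_ev : ∀ (j : ℕ) (u : Sob j), ContDiff ℝ j (ev u)
  | 0, u => contDiff_zero.2 (ev u).continuous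
  | j + 1, u => by
    rw [show ((j + 1 : ℕ) : WithTop ℕ∞) = (j : WithTop ℕ∞) + 1 by push_cast; rfl,
      contDiff_succ_iff_fderiv]
    refine ⟨fun p => (hasFDerivAt u p).differentiableAt, by simp, ?_⟩
    have : fderiv ℝ (ev u) = fun p => gradLL (ev (D₁ u) p, ev (D₂ u) p) :=
      funext fun p => (hasFDerivAt u p).fderiv
    rw [this]
    exact gradLL.contDiff.comp ((contDiff_ev j _).prodMk (contDiff_ev j _))

end Sob

theorem Periodic₂.pd₁_iterate {V : Type*} [NormedAddCommGroup V] [NormedSpace ℝ V]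
    {u : ℝ × ℝ → V} (hp : Periodic₂ u) (k : ℕ) :
    Periodic₂ (CWillmore.pd₁^[k] u) := by
  induction k with
  | zero => simpa using hp
  | succ k ih => rw [Function.iterate_succ_apply']; exact ih.pd₁

theorem Periodic₂.pd₂_iterate {V : Type*} [NormedAddCommGroup V] [NormedSpace ℝ V]
    {u : ℝ × ℝ → V} (hp : Periodic₂ u) (k : ℕ) :
    Periodic₂ (CWillmore.pd₂^[k] u) := by
  induction k with
  | zero => simpa using hp
  | succ k ih => rw [Function.iterate_succ_apply']; exact ih.pd₂

theorem contDiff_pd₁_iterate {V : Type*} [NormedAddCommGroup V] [NormedSpace ℝ V]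
    {u : ℝ × ℝ → V} (h : ContDiff ℝ (⊤ : ℕ∞) u) (k : ℕ) : ContDiff ℝ (⊤ : ℕ∞) (pd₁^[k] u) :=
  contDiff_pdiff (k, 0) h

theorem contDiff_pd₂_iterate {V : Type*} [NormedAddCommGroup V] [NormedSpace ℝ V]
    {u : ℝ × ℝ → V} (h : ContDiff ℝ (⊤ : ℕ∞) u) (k : ℕ) : ContDiff ℝ (⊤ : ℕ∞) (pd₂^[k] u) :=
  contDiff_pdiff (0, k) h

/-- The symbol `(2πi n)^α` of the operator `D^α`. -/
noncomputable def symbol (α : ℕ × ℕ) (n : ℤ × ℤ) : ℂ :=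
  (2 * Real.pi * Complex.I * n.1) ^ α.1 * (2 * Real.pi * Complex.I * n.2) ^ α.2

theorem fourierCoef_pdiff {u : ℝ × ℝ → ℂ} (hp : Periodic₂ u) (h : ContDiff ℝ (⊤ : ℕ∞) u)
    (α : ℕ × ℕ) (n : ℤ × ℤ) : fourierCoef (pdiff α u) n = symbol α n * fourierCoef u n := by
  have h2 : ∀ k : ℕ, fourierCoef (pd₂^[k] u) n =
      (2 * Real.pi * Complex.I * n.2) ^ k * fourierCoef u n := by
    intro k
    induction k with
    | zero => simp
    | succ k ih =>
      rw [Function.iterate_succ_apply', fourierCoef_pd₂ (hp.pd₂_iterate k)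
        ((contDiff_pd₂_iterate h k).of_le (by exact_mod_cast le_top)), ih]
      ring
  have h1 : ∀ k : ℕ, fourierCoef (pd₁^[k] (pd₂^[α.2] u)) n =
      (2 * Real.pi * Complex.I * n.1) ^ k * fourierCoef (pd₂^[α.2] u) n := by
    intro k
    induction k with
    | zero => simp
    | succ k ih =>
      rw [Function.iterate_succ_apply', fourierCoef_pd₁ ((hp.pd₂_iterate _).pd₁_iterate k)
        ((contDiff_pd₁_iterate (contDiff_pd₂_iterate h _) k).of_le (by exact_mod_cast le_top)), ih]
      ring
  rw [pdiff, h1, h2, symbol, ← mul_assoc]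

theorem norm_fourierCoef_le {u : ℝ × ℝ → ℂ} (n : ℤ × ℤ) :
    ‖fourierCoef u n‖ ≤ ∫ p, ‖u p‖ ∂cell := by
  refine (norm_integral_le_integral_norm _).trans_eq ?_
  simp only [norm_mul, norm_character, one_mul]

theorem wt_pow_le (n : ℤ × ℤ) (k : ℕ) :
    wt n ^ k ≤ 3 ^ k * (1 + |(n.1 : ℝ)| ^ k + |(n.2 : ℝ)| ^ k) := by
  have ha := abs_nonneg (n.1 : ℝ)
  have hb := abs_nonneg (n.2 : ℝ)
  have key : ∀ t : ℝ, 0 ≤ t → wt n ≤ 3 * t → t ^ k ≤ 1 + |(n.1 : ℝ)| ^ k + |(n.2 : ℝ)| ^ k →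
      wt n ^ k ≤ 3 ^ k * (1 + |(n.1 : ℝ)| ^ k + |(n.2 : ℝ)| ^ k) := by
    intro t ht h1 h2
    calc wt n ^ k ≤ (3 * t) ^ k := pow_le_pow_left₀ (wt_pos n).le h1 k
      _ = 3 ^ k * t ^ k := mul_pow _ _ _
      _ ≤ _ := by gcongr
  have pa : 0 ≤ |(n.1 : ℝ)| ^ k := by positivity
  have pb : 0 ≤ |(n.2 : ℝ)| ^ k := by positivity
  by_cases h1 : |(n.1 : ℝ)| ≤ 1 ∧ |(n.2 : ℝ)| ≤ 1
  · refine key 1 zero_le_one (by unfold wt; linarith [h1.1, h1.2]) ?_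
    rw [one_pow]; linarith
  · rcases le_total |(n.1 : ℝ)| |(n.2 : ℝ)| with h | h
    · have : 1 ≤ |(n.2 : ℝ)| := by
        by_contra hc; push Not at hc; exact h1 ⟨h.trans hc.le, hc.le⟩
      exact key _ hb (by unfold wt; linarith) (by linarith)
    · have : 1 ≤ |(n.1 : ℝ)| := by
        by_contra hc; push Not at hc; exact h1 ⟨hc.le, h.trans hc.le⟩
      exact key _ ha (by unfold wt; linarith) (by linarith)

/-- The weight of order `k` is controlled by the symbols of the pure derivatives of order `k`. -/
theorem wt_pow_mul_norm_le (n : ℤ × ℤ) (k : ℕ) (c : ℂ) :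
    wt n ^ k * ‖c‖ ≤ 3 ^ k * (‖c‖ + ‖symbol (k, 0) n * c‖ + ‖symbol (0, k) n * c‖) := by
  have h1 : (1 : ℝ) ≤ 2 * Real.pi := by linarith [Real.pi_gt_three]
  have e : ∀ m : ℤ, |(m : ℝ)| ^ k ≤ ‖(2 * Real.pi * Complex.I * m : ℂ)‖ ^ k := by
    intro m
    rw [norm_mul, Sob.norm_two_pi_I, Complex.norm_intCast]
    gcongr
    nlinarith [abs_nonneg (m : ℝ)]
  have e1 := e n.1
  have e2 := e n.2
  simp only [symbol, pow_zero, mul_one, one_mul, norm_mul _ c, norm_pow]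
  calc wt n ^ k * ‖c‖ ≤ 3 ^ k * (1 + |(n.1 : ℝ)| ^ k + |(n.2 : ℝ)| ^ k) * ‖c‖ := by
        gcongr
        exact wt_pow_le n k
    _ ≤ 3 ^ k * (1 + ‖(2 * Real.pi * Complex.I * n.1 : ℂ)‖ ^ k +
          ‖(2 * Real.pi * Complex.I * n.2 : ℂ)‖ ^ k) * ‖c‖ := by gcongr
    _ = _ := by ring

/-- Smooth functions on the torus belong to all Sobolev spaces. -/
theorem Sob.exists_of_contDiff (j : ℕ) {u : ℝ × ℝ → ℂ} (hp : Periodic₂ u)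
    (h : ContDiff ℝ (⊤ : ℕ∞) u) : ∃ v : Sob j, ⇑(ev v) = u := by
  set B : ℝ := 3 ^ (j + 4) * ((∫ p, ‖u p‖ ∂cell) + (∫ p, ‖pdiff (j + 4, 0) u p‖ ∂cell) +
    ∫ p, ‖pdiff (0, j + 4) u p‖ ∂cell) with hB
  have hle : ∀ n, wt n ^ (j + 4) * ‖fourierCoef u n‖ ≤ B := by
    intro n
    refine (wt_pow_mul_norm_le n (j + 4) _).trans ?_
    rw [← fourierCoef_pdiff hp h, ← fourierCoef_pdiff hp h, hB]
    gcongr <;> exact norm_fourierCoef_le n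
  -- two orders of decay more than the weight make the squares summable
  have hsum : Summable fun n => (wt n ^ (j + 2) * ‖fourierCoef u n‖) ^ 2 := by
    refine Summable.of_nonneg_of_le (fun n => sq_nonneg _) (fun n => ?_)
      ((summable_wt (k := 4) le_rfl).mul_left (B ^ 2))
    have hw := wt_pos n
    have e : (wt n ^ (j + 2) * ‖fourierCoef u n‖) ^ 2 =
        (wt n ^ (j + 4) * ‖fourierCoef u n‖) ^ 2 * (wt n ^ 4)⁻¹ := by
      rw [show j + 4 = j + 2 + 2 by ring, pow_add (wt n) (j + 2)]
      field_simp
    rw [e]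
    gcongr
    exact hle n
  obtain ⟨v, hv, -⟩ := Sob.exists_ev_eq hp h.continuous hsum
  exact ⟨v, hv⟩

end CWillmore

/-! ### The space `W42` in terms of Fourier coefficients -/

namespace CWillmore

theorem memLp_cell_of_continuous {u : ℝ × ℝ → ℂ} (h : Continuous u) : MemLp u 2 cell := by
  have hK : IsCompact (Icc (0 : ℝ) 1 ×ˢ Icc (0 : ℝ) 1) := isCompact_Icc.prod isCompact_Icc
  obtain ⟨C, hC⟩ := hK.exists_bound_of_continuousOn h.continuousOn
  refine MemLp.of_bound h.aestronglyMeasurable C ?_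
  refine (ae_restrict_iff' (measurableSet_Ioc.prod measurableSet_Ioc)).2 (ae_of_all _ ?_)
  intro p hp
  exact hC p (prod_mono Ioc_subset_Icc_self Ioc_subset_Icc_self hp)

/-- The characters in `L²` of the torus. -/
noncomputable def characterLp (n : ℤ × ℤ) : Lp ℂ 2 cell :=
  (memLp_cell_of_continuous (contDiff_character n).continuous).toLp

theorem coeFn_characterLp (n : ℤ × ℤ) : characterLp n =ᵐ[cell] character n := MemLp.coeFn_toLp _

theorem inner_toLp {u : ℝ × ℝ → ℂ} (h : Continuous u) (g : Lp ℂ 2 cell) :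
    inner ℂ (memLp_cell_of_continuous h).toLp g = ∫ p, (starRingEnd ℂ) (u p) * g p ∂cell := by
  rw [L2.inner_def]
  refine integral_congr_ae ?_
  filter_upwards [MemLp.coeFn_toLp (memLp_cell_of_continuous h)] with p hp
  rw [hp, RCLike.inner_apply, mul_comm]

theorem inner_characterLp (n : ℤ × ℤ) (g : Lp ℂ 2 cell) :
    inner ℂ (characterLp n) g = fourierCoef g n := by
  rw [characterLp, inner_toLp (contDiff_character n).continuous]
  simp only [conj_character, fourierCoef]

theorem fourierCoef_congr_ae {u v : ℝ × ℝ → ℂ} (h : u =ᵐ[cell] v) (n : ℤ × ℤ) :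
    fourierCoef u n = fourierCoef v n := by
  refine integral_congr_ae ?_
  filter_upwards [h] with p hp
  rw [hp]

theorem orthonormal_characterLp : Orthonormal ℂ characterLp := by
  rw [orthonormal_iff_ite]
  intro m n
  rw [inner_characterLp, fourierCoef_congr_ae (coeFn_characterLp n), fourierCoef_character]
  simp only [eq_comm]

/-- Bessel's inequality on the torus. -/
theorem bessel (g : Lp ℂ 2 cell) :
    Summable (fun n => ‖fourierCoef g n‖ ^ 2) ∧ ∑' n, ‖fourierCoef g n‖ ^ 2 ≤ ‖g‖ ^ 2 := by
  simp only [← inner_characterLp]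
  exact ⟨orthonormal_characterLp.inner_products_summable g,
    orthonormal_characterLp.tsum_inner_products_le g⟩

/-- The element of `L²` of the torus with the given Fourier coefficients. -/
noncomputable def synth (y : EllTwo) : Lp ℂ 2 cell :=
  orthonormal_characterLp.orthogonalFamily.linearIsometry y

theorem norm_synth (y : EllTwo) : ‖synth y‖ = ‖y‖ := LinearIsometry.norm_map _ y

theorem hasSum_synth (y : EllTwo) : HasSum (fun n => y n • characterLp n) (synth y) :=
  orthonormal_characterLp.orthogonalFamily.hasSum_linearIsometry y

/-- Parseval's identity. -/
theorem hasSum_integral_synth {h : ℝ × ℝ → ℂ} (hc : Continuous h) (y : EllTwo) :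
    HasSum (fun n => y n * fourierCoef h (-n)) (∫ p, h p * synth y p ∂cell) := by
  have hc' : Continuous fun p => (starRingEnd ℂ) (h p) := Complex.continuous_conj.comp hc
  have h1 := (innerSL ℂ (memLp_cell_of_continuous hc').toLp).hasSum (hasSum_synth y)
  have e : ∀ n, innerSL ℂ (memLp_cell_of_continuous hc').toLp (y n • characterLp n) =
      y n * fourierCoef h (-n) := by
    intro n
    rw [innerSL_apply_apply, inner_smul_right, inner_toLp hc', fourierCoef]
    congr 1
    refine integral_congr_ae ?_
    filter_upwards [coeFn_characterLp n] with p hp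
    rw [hp, neg_neg, mul_comm, Complex.conj_conj]
  simp only [e] at h1
  rw [innerSL_apply_apply, inner_toLp hc'] at h1
  simpa only [Complex.conj_conj] using h1

theorem Sob.summable_symbol {j : ℕ} (x : Sob j) {α : ℕ × ℕ} (hα : α.1 + α.2 ≤ j + 2) :
    Summable fun n => ‖symbol α n * coef x n‖ ^ 2 := by
  refine Summable.of_nonneg_of_le (fun n => sq_nonneg _) (fun n => ?_)
    ((summable_sq_coef x).mul_left (((2 * Real.pi) ^ (α.1 + α.2) * (sobConst j)⁻¹) ^ 2))
  have hw := one_le_wt n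
  have hC := sobConst_pos j
  have hs : ‖symbol α n‖ ≤ (2 * Real.pi) ^ (α.1 + α.2) * wt n ^ (j + 2) := by
    rw [symbol, norm_mul, norm_pow, norm_pow]
    calc _ ≤ (2 * Real.pi * wt n) ^ α.1 * (2 * Real.pi * wt n) ^ α.2 := by
          gcongr
          · exact norm_symbol₁_le n
          · exact norm_symbol₂_le n
      _ = (2 * Real.pi) ^ (α.1 + α.2) * wt n ^ (α.1 + α.2) := by
          rw [← pow_add, mul_pow]
      _ ≤ _ := by gcongr
  rw [← mul_pow, norm_mul]
  refine pow_le_pow_left₀ (by positivity) ?_ 2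
  calc ‖symbol α n‖ * ‖coef x n‖ ≤
      (2 * Real.pi) ^ (α.1 + α.2) * wt n ^ (j + 2) * ‖coef x n‖ := by gcongr
    _ = _ := by rw [sobWeight]; field_simp

/-- A function of Sobolev class is the sum of its Fourier series in `L²`. -/
theorem synth_coef {j : ℕ} (x : Sob j) (h : Summable fun n => ‖Sob.coef x n‖ ^ 2) :
    synth (EllTwo.mk _ h) =ᵐ[cell] Sob.ev x := by
  let Λ : BC →L[ℂ] Lp ℂ 2 cell := BoundedContinuousFunction.toLp 2 cell ℂ
  have hΛ : ∀ n, Λ (characterBC n) = characterLp n := fun n => by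
    refine Lp.ext ?_
    exact (BoundedContinuousFunction.coeFn_toLp 2 cell ℂ (characterBC n)).trans
      (coeFn_characterLp n).symm
  have h1 := Λ.hasSum (summable_series (Sob.summable_coef x)).hasSum
  have e : series (Sob.coef x) = Sob.ev x :=
    DFunLike.coe_injective (eq_series x.periodic (Sob.ev x).continuous (Sob.summable_coef x)).symm
  simp only [map_smul, hΛ] at h1
  have h2 := (hasSum_synth (EllTwo.mk _ h)).unique h1
  rw [h2]
  change Λ (series (Sob.coef x)) =ᵐ[cell] _
  rw [e]
  exact BoundedContinuousFunction.coeFn_toLp 2 cell ℂ (Sob.ev x)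

theorem symbol_neg (α : ℕ × ℕ) (n : ℤ × ℤ) :
    symbol α (-n) = (-1) ^ (α.1 + α.2) * symbol α n := by
  simp only [symbol, Prod.fst_neg, Prod.snd_neg, Int.cast_neg, mul_neg]
  rw [neg_pow, neg_pow (2 * Real.pi * Complex.I * n.2 : ℂ), pow_add]
  ring

theorem pdiff_comp_clm {V W : Type*} [NormedAddCommGroup V] [NormedSpace ℝ V]
    [NormedAddCommGroup W] [NormedSpace ℝ W] (L : V →L[ℝ] W) {u : ℝ × ℝ → V}
    (h : ContDiff ℝ (⊤ : ℕ∞) u) (α : ℕ × ℕ) :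
    pdiff α (fun p => L (u p)) = fun p => L (pdiff α u p) := by
  have a1 : ∀ {v : ℝ × ℝ → V}, ContDiff ℝ (⊤ : ℕ∞) v →
      pd₁ (fun p => L (v p)) = fun p => L (pd₁ v p) := by
    intro v hv
    funext p
    have := L.hasFDerivAt.comp p ((hv.differentiable (by simp)) p).hasFDerivAt
    simp only [pd₁]
    rw [show (fun p => L (v p)) = L ∘ v from rfl, this.fderiv]
    rfl
  have a2 : ∀ {v : ℝ × ℝ → V}, ContDiff ℝ (⊤ : ℕ∞) v →
      pd₂ (fun p => L (v p)) = fun p => L (pd₂ v p) := by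
    intro v hv
    funext p
    have := L.hasFDerivAt.comp p ((hv.differentiable (by simp)) p).hasFDerivAt
    simp only [pd₂]
    rw [show (fun p => L (v p)) = L ∘ v from rfl, this.fderiv]
    rfl
  have b2 : ∀ k : ℕ, pd₂^[k] (fun p => L (u p)) = fun p => L (pd₂^[k] u p) := by
    intro k
    induction k with
    | zero => rfl
    | succ k ih =>
      rw [Function.iterate_succ_apply', ih, a2 (contDiff_pd₂_iterate h k),
        Function.iterate_succ_apply']
  have b1 : ∀ k : ℕ, pd₁^[k] (fun p => L (pd₂^[α.2] u p)) =
      fun p => L (pd₁^[k] (pd₂^[α.2] u) p) := by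
    intro k
    induction k with
    | zero => rfl
    | succ k ih =>
      rw [Function.iterate_succ_apply', ih,
        a1 (contDiff_pd₁_iterate (contDiff_pd₂_iterate h _) k), Function.iterate_succ_apply']
  rw [pdiff, b2, b1]
  rfl

theorem pdiff_character (α : ℕ × ℕ) (n : ℤ × ℤ) :
    pdiff α (character n) = fun p => symbol α n * character n p := by
  have a1 : ∀ c : ℂ, pd₁ (fun p => c * character n p) =
      fun p => c * (2 * Real.pi * Complex.I * n.1) * character n p := by
    intro c; funext p
    rw [pd₁, ((hasFDerivAt_character n p).const_mul c).fderiv]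
    simp; ring
  have a2 : ∀ c : ℂ, pd₂ (fun p => c * character n p) =
      fun p => c * (2 * Real.pi * Complex.I * n.2) * character n p := by
    intro c; funext p
    rw [pd₂, ((hasFDerivAt_character n p).const_mul c).fderiv]
    simp; ring
  have b2 : ∀ k : ℕ, pd₂^[k] (character n) =
      fun p => (2 * Real.pi * Complex.I * n.2) ^ k * character n p := by
    intro k
    induction k with
    | zero => funext p; simp
    | succ k ih => rw [Function.iterate_succ_apply', ih, a2, pow_succ]
  have b1 : ∀ (c : ℂ) (k : ℕ), pd₁^[k] (fun p => c * character n p) =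
      fun p => c * (2 * Real.pi * Complex.I * n.1) ^ k * character n p := by
    intro c k
    induction k with
    | zero => funext p; simp
    | succ k ih => rw [Function.iterate_succ_apply', ih, a1, pow_succ]; simp only [mul_assoc]
  rw [pdiff, b2, b1]
  funext p
  rw [symbol]; ring

section

variable {V : Type*} [NormedAddCommGroup V] [NormedSpace ℝ V]

theorem W42.periodic (u : W42 V) : Periodic₂ u := u.2.1

theorem W42.contDiff (u : W42 V) : ContDiff ℝ 2 u := u.2.2.1

theorem W42.isWeakDeriv (u : W42 V) (α : MultiIndex) : IsWeakDeriv α.1 u (W42.jet u α) :=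
  u.2.2.2.2 α

theorem W42.norm_jet_le (u : W42 V) (α : MultiIndex) : ‖W42.jet u α‖ ≤ ‖u‖ :=
  PiLp.norm_apply_le (W42.jet u) α

theorem W42.add_apply (u v : W42 V) (p : ℝ × ℝ) : (u + v) p = u p + v p := rfl

theorem W42.sub_apply (u v : W42 V) (p : ℝ × ℝ) : (u - v) p = u p - v p := rfl

theorem W42.smul_apply (c : ℝ) (u : W42 V) (p : ℝ × ℝ) : (c • u) p = c • u p := rfl

variable [CompleteSpace V]

/-- The Fourier coefficients of a weak derivative. -/
theorem fourierCoef_weakDeriv (ℓ : V →L[ℝ] ℂ) (u : W42 V) (α : MultiIndex) (n : ℤ × ℤ) :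
    fourierCoef (fun p => ℓ (W42.jet u α p)) n =
      symbol α.1 n * fourierCoef (fun p => ℓ (u p)) n := by
  set w := W42.jet u α with hw
  have hc := contDiff_character (-n)
  -- test functions are real, so the real and imaginary parts of the character are used separately
  have key : ∀ L : ℂ →L[ℝ] ℝ, ∫ p, (L (character (-n) p) : ℂ) * ℓ (w p) ∂cell =
      (-1) ^ (α.1.1 + α.1.2) * ∫ p, (L (pdiff α.1 (character (-n)) p) : ℂ) * ℓ (u p) ∂cell := by
    intro L
    have hψ : ContDiff ℝ (⊤ : ℕ∞) fun p => L (character (-n) p) := L.contDiff.comp hc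
    have h1 := W42.isWeakDeriv u α (fun p => L (character (-n) p)) hψ (fun x y => by
      simp only [(periodic₂_character (-n) x y).1, (periodic₂_character (-n) x y).2, and_self])
    rw [pdiff_comp_clm L hc, ← hw] at h1
    have h2 := congrArg ℓ h1
    have hcont : Continuous fun p => L (pdiff α.1 (character (-n)) p) • u p :=
      (L.continuous.comp (contDiff_pdiff _ hc).continuous).smul (W42.contDiff u).continuous
    rw [map_smul, ← ℓ.integral_comp_comm (integrable_smul_cell hψ.continuous w),
      ← ℓ.integral_comp_comm (integrable_cell_of_continuous hcont)] at h2
    simp only [map_smul, Complex.real_smul] at h2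
    rw [h2]
    push_cast
    rfl
  have hre := key Complex.reCLM
  have him := key Complex.imCLM
  simp only [Complex.reCLM_apply, Complex.imCLM_apply] at hre him
  have split : ∀ (a : ℝ × ℝ → ℂ) (g : ℝ × ℝ → ℂ), Continuous a → Integrable g cell →
      ∫ p, a p * g p ∂cell = ∫ p, ((a p).re : ℂ) * g p ∂cell +
        Complex.I * ∫ p, ((a p).im : ℂ) * g p ∂cell := by
    intro a g ha hg
    have hb : ∀ r : ℝ × ℝ → ℝ, Continuous r → Integrable (fun p => (r p : ℂ) * g p) cell := by
      intro r hr
      have hK : IsCompact (Icc (0 : ℝ) 1 ×ˢ Icc (0 : ℝ) 1) := isCompact_Icc.prod isCompact_Icc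
      obtain ⟨C, hC⟩ := hK.exists_bound_of_continuousOn hr.continuousOn
      refine hg.bdd_mul (c := C) (Complex.continuous_ofReal.comp hr).aestronglyMeasurable ?_
      refine (ae_restrict_iff' (measurableSet_Ioc.prod measurableSet_Ioc)).2 (ae_of_all _ ?_)
      intro p hp
      simpa using hC p (prod_mono Ioc_subset_Icc_self Ioc_subset_Icc_self hp)
    rw [← integral_const_mul,
      ← integral_add (hb (fun p => (a p).re) (Complex.continuous_re.comp ha))
      ((hb (fun p => (a p).im) (Complex.continuous_im.comp ha)).const_mul _)]
    refine integral_congr_ae (ae_of_all _ fun p => ?_)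
    simp only
    rw [← mul_assoc, ← add_mul, mul_comm Complex.I, Complex.re_add_im]
  have hgw : Integrable (fun p => ℓ (w p)) cell :=
    ℓ.integrable_comp ((Lp.memLp w).integrable (by norm_num))
  have hgu : Integrable (fun p => ℓ (u p)) cell :=
    integrable_cell_of_continuous (ℓ.continuous.comp (W42.contDiff u).continuous)
  rw [fourierCoef, split _ _ hc.continuous hgw, hre, him]
  have h3 := split (pdiff α.1 (character (-n))) _ (contDiff_pdiff α.1 hc).continuous hgu
  have h4 : ∫ p, pdiff α.1 (character (-n)) p * ℓ (u p) ∂cell =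
      symbol α.1 (-n) * fourierCoef (fun p => ℓ (u p)) n := by
    rw [pdiff_character, fourierCoef, ← integral_const_mul]
    simp only [mul_assoc]
  rw [h4, symbol_neg] at h3
  have hsq : ((-1 : ℂ) ^ (α.1.1 + α.1.2)) * (-1) ^ (α.1.1 + α.1.2) = 1 := by
    rw [← mul_pow]; simp
  calc _ = (-1) ^ (α.1.1 + α.1.2) *
        (∫ p, ((pdiff α.1 (character (-n)) p).re : ℂ) * ℓ (u p) ∂cell +
          Complex.I * ∫ p, ((pdiff α.1 (character (-n)) p).im : ℂ) * ℓ (u p) ∂cell) := by ring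
    _ = _ := by
        rw [← h3]
        linear_combination (symbol α.1 n * fourierCoef (fun p => ℓ (u p)) n) * hsq

/-- Bessel's inequality for the weak derivatives. -/
theorem bessel_jet (ℓ : V →L[ℝ] ℂ) (u : W42 V) (α : MultiIndex) :
    Summable (fun n => ‖symbol α.1 n * fourierCoef (fun p => ℓ (u p)) n‖ ^ 2) ∧
      ∑' n, ‖symbol α.1 n * fourierCoef (fun p => ℓ (u p)) n‖ ^ 2 ≤ (‖ℓ‖ * ‖u‖) ^ 2 := by
  simp only [← fourierCoef_weakDeriv]
  obtain ⟨h1, h2⟩ := bessel (ℓ.compLp (W42.jet u α))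
  have e : ∀ n, fourierCoef (ℓ.compLp (W42.jet u α)) n =
      fourierCoef (fun p => ℓ (W42.jet u α p)) n :=
    fun n => fourierCoef_congr_ae (ℓ.coeFn_compLp' _) n
  simp only [e] at h1 h2
  refine ⟨h1, h2.trans ?_⟩
  gcongr
  refine (ℓ.norm_compLp_le _).trans ?_
  gcongr
  exact W42.norm_jet_le u α

/-- The weight of order four is controlled by the weak derivatives `∂₁⁴` and `∂₂⁴`, so the
components of elements of `W42` belong to the Sobolev algebra. -/
theorem exists_sob_of_W42 (ℓ : V →L[ℝ] ℂ) (u : W42 V) :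
    ∃ v : Sob 2, (∀ p, Sob.ev v p = ℓ (u p)) ∧ ‖v‖ ≤ sobConst 2 * 3 ^ 5 * (‖ℓ‖ * ‖u‖) := by
  set c := fourierCoef (fun p => ℓ (u p)) with hc
  obtain ⟨s0, t0⟩ := bessel_jet ℓ u ⟨(0, 0), by simp⟩
  obtain ⟨s1, t1⟩ := bessel_jet ℓ u ⟨(4, 0), by simp⟩
  obtain ⟨s2, t2⟩ := bessel_jet ℓ u ⟨(0, 4), by simp⟩
  simp only [← hc] at s0 t0 s1 t1 s2 t2
  have hle : ∀ n, (wt n ^ (2 + 2) * ‖c n‖) ^ 2 ≤ 3 ^ 9 * (‖symbol (0, 0) n * c n‖ ^ 2 +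
      ‖symbol (4, 0) n * c n‖ ^ 2 + ‖symbol (0, 4) n * c n‖ ^ 2) := by
    intro n
    have h := wt_pow_mul_norm_le n 4 (c n)
    have e0 : symbol (0, 0) n * c n = c n := by simp [symbol]
    rw [e0]
    have hw := wt_pos n
    calc _ ≤ (3 ^ 4 * (‖c n‖ + ‖symbol (4, 0) n * c n‖ + ‖symbol (0, 4) n * c n‖)) ^ 2 := by
          gcongr
      _ = 3 ^ 8 * (‖c n‖ + ‖symbol (4, 0) n * c n‖ + ‖symbol (0, 4) n * c n‖) ^ 2 := by ring
      _ ≤ 3 ^ 8 * (3 * (‖c n‖ ^ 2 + ‖symbol (4, 0) n * c n‖ ^ 2 +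
          ‖symbol (0, 4) n * c n‖ ^ 2)) := by
          gcongr
          nlinarith [sq_nonneg (‖c n‖ - ‖symbol (4, 0) n * c n‖),
            sq_nonneg (‖c n‖ - ‖symbol (0, 4) n * c n‖),
            sq_nonneg (‖symbol (4, 0) n * c n‖ - ‖symbol (0, 4) n * c n‖)]
      _ = _ := by ring
  have hs := ((s0.add s1).add s2).mul_left ((3 : ℝ) ^ 9)
  have hsum := Summable.of_nonneg_of_le (fun n => sq_nonneg _) hle hs
  have hper : Periodic₂ fun p => ℓ (u p) := fun x y => by
    simp only [(W42.periodic u x y).1, (W42.periodic u x y).2, and_self]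
  obtain ⟨v, hv, hn⟩ := Sob.exists_ev_eq (j := 2) hper
    (ℓ.continuous.comp (W42.contDiff u).continuous) hsum
  refine ⟨v, fun p => congrFun hv p, le_of_sq_le_sq ?_ (by have := sobConst_pos 2; positivity)⟩
  rw [hn]
  have := hsum.tsum_le_tsum hle hs
  rw [tsum_mul_left, (s0.add s1).tsum_add s2, s0.tsum_add s1] at this
  calc _ ≤ sobConst 2 ^ 2 * (3 ^ 9 * ((‖ℓ‖ * ‖u‖) ^ 2 + (‖ℓ‖ * ‖u‖) ^ 2 + (‖ℓ‖ * ‖u‖) ^ 2)) := by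
        gcongr
        exact this.trans (by gcongr)
    _ = _ := by ring

/-- Elements of `W42`, composed with a continuous functional, as elements of the Sobolev
algebra. -/
noncomputable def toSob (ℓ : V →L[ℝ] ℂ) : W42 V →L[ℝ] Sob 2 :=
  LinearMap.mkContinuous
    { toFun := fun u => (exists_sob_of_W42 ℓ u).choose
      map_add' := fun u v => Sob.ev_injective (by
        ext p
        rw [map_add, BoundedContinuousFunction.add_apply,
          (exists_sob_of_W42 ℓ _).choose_spec.1, (exists_sob_of_W42 ℓ _).choose_spec.1,
          (exists_sob_of_W42 ℓ _).choose_spec.1, W42.add_apply, map_add])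
      map_smul' := fun c u => Sob.ev_injective (by
        ext p
        have e : ∀ v : Sob 2, Sob.ev (c • v) p = c • Sob.ev v p := fun v => by
          rw [show c • v = (c : ℂ) • v from rfl, map_smul]; rfl
        rw [RingHom.id_apply, e, (exists_sob_of_W42 ℓ _).choose_spec.1,
          (exists_sob_of_W42 ℓ _).choose_spec.1, W42.smul_apply, map_smul]) }
    (sobConst 2 * 3 ^ 5 * ‖ℓ‖) fun u => by
      rw [mul_assoc]
      exact (exists_sob_of_W42 ℓ u).choose_spec.2

theorem ev_toSob (ℓ : V →L[ℝ] ℂ) (u : W42 V) (p : ℝ × ℝ) : Sob.ev (toSob ℓ u) p = ℓ (u p) :=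
  (exists_sob_of_W42 ℓ u).choose_spec.1 p

/-- Functions in the Sobolev algebra of order four define elements of `W42`. -/
theorem exists_W42_of_sob (L : ℂ →L[ℝ] V) (x : Sob 2) : ∃ v : W42 V, ∀ p, v p = L (Sob.ev x p) := by
  have hα : ∀ α : MultiIndex, α.1.1 + α.1.2 ≤ 2 + 2 := fun α => (Finset.mem_filter.1 α.2).2
  let y : MultiIndex → EllTwo := fun α => EllTwo.mk _ (x.summable_symbol (hα α))
  have hx : Summable fun n => ‖Sob.coef x n‖ ^ 2 := by
    simpa [symbol] using x.summable_symbol (α := (0, 0)) (by simp)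
  -- the weak derivatives are the sums in `L²` of the Fourier series with the symbols as factors
  refine ⟨⟨(fun p => L (Sob.ev x p), WithLp.toLp 2 fun α => L.compLp (synth (y α))),
    ?_, ?_, ?_, ?_⟩, fun p => rfl⟩
  · intro a b
    simp only [(x.periodic a b).1, (x.periodic a b).2, and_self]
  · exact L.contDiff.comp (Sob.contDiff_ev 2 x)
  · rintro ⟨α, hα'⟩ (rfl : α = (0, 0))
    have e : y ⟨(0, 0), hα'⟩ = EllTwo.mk _ hx := by
      ext n; simp [y, symbol]
    change L.compLp (synth (y ⟨(0, 0), hα'⟩)) =ᵐ[cell] _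
    rw [e]
    filter_upwards [L.coeFn_compLp (synth (EllTwo.mk _ hx)), synth_coef x hx] with p h1 h2
    rw [h1, h2]
  · intro α ψ hψ hp
    change ∫ p, ψ p • L.compLp (synth (y α)) p ∂cell =
      (-1 : ℝ) ^ (α.1.1 + α.1.2) • ∫ p, pdiff α.1 ψ p • L (Sob.ev x p) ∂cell
    have hψc : ContDiff ℝ (⊤ : ℕ∞) fun p => (ψ p : ℂ) := Complex.ofRealCLM.contDiff.comp hψ
    have hd : pdiff α.1 (fun p => (ψ p : ℂ)) = fun p => ((pdiff α.1 ψ p : ℝ) : ℂ) :=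
      pdiff_comp_clm Complex.ofRealCLM hψ α.1
    have hdc : Continuous (pdiff α.1 ψ) := (contDiff_pdiff α.1 hψ).continuous
    have e1 : ∫ p, ψ p • L.compLp (synth (y α)) p ∂cell =
        L (∫ p, (ψ p : ℂ) * synth (y α) p ∂cell) := by
      rw [← L.integral_comp_comm]
      · refine integral_congr_ae ?_
        filter_upwards [L.coeFn_compLp (synth (y α))] with p hp
        rw [hp, ← map_smul, Complex.real_smul]
      · simpa only [Complex.real_smul] using integrable_smul_cell hψ.continuous (synth (y α))
    have e2 : ∫ p, pdiff α.1 ψ p • L (Sob.ev x p) ∂cell =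
        L (∫ p, ((pdiff α.1 ψ p : ℝ) : ℂ) * Sob.ev x p ∂cell) := by
      rw [← L.integral_comp_comm]
      · simp only [← Complex.real_smul, map_smul]
      · exact integrable_cell_of_continuous
          ((Complex.continuous_ofReal.comp hdc).mul (Sob.ev x).continuous)
    rw [e1, e2, ← map_smul]
    congr 1
    -- by Parseval's identity, integration by parts is an identity of Fourier coefficients
    have s1 := hasSum_integral_synth hψc.continuous (y α)
    have s2 := hasSum_integral_synth (Complex.continuous_ofReal.comp hdc) (EllTwo.mk _ hx)
    have e3 : ∫ p, ((pdiff α.1 ψ p : ℝ) : ℂ) * Sob.ev x p ∂cell =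
        ∫ p, (Complex.ofReal ∘ pdiff α.1 ψ) p * synth (EllTwo.mk _ hx) p ∂cell := by
      refine integral_congr_ae ?_
      filter_upwards [synth_coef x hx] with p hp
      rw [hp]; rfl
    rw [e3]
    refine s1.unique ?_
    rw [Complex.real_smul]
    refine (s2.mul_left _).congr_fun fun n => ?_
    have hpc : Periodic₂ fun p => (ψ p : ℂ) := fun a b => by
      simp only [(hp a b).1, (hp a b).2, and_self]
    have e4 : fourierCoef (Complex.ofReal ∘ pdiff α.1 ψ) (-n) =
        symbol α.1 (-n) * fourierCoef (fun p => (ψ p : ℂ)) (-n) := by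
      rw [← fourierCoef_pdiff hpc hψc, hd]; rfl
    have hsq : ((-1 : ℂ) ^ (α.1.1 + α.1.2)) * (-1) ^ (α.1.1 + α.1.2) = 1 := by
      rw [← mul_pow]; simp
    rw [e4, symbol_neg]
    simp only [y, EllTwo.mk_apply]
    push_cast
    linear_combination -(symbol α.1 n * Sob.coef x n * fourierCoef (fun p => (ψ p : ℂ)) (-n)) * hsq

end

end CWillmore

/-! ### Square roots in Banach algebras, and a Neumann series -/

namespace CWillmore

section Sqrt

variable {A : Type*} [NormedCommRing A] [NormedAlgebra ℝ A] [CompleteSpace A]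

/-- Multiplication by a unit as a continuous linear equivalence. -/
noncomputable def unitMulEquiv (u : Aˣ) : A ≃L[ℝ] A :=
  ContinuousLinearEquiv.equivOfInverse (ContinuousLinearMap.mul ℝ A u)
    (ContinuousLinearMap.mul ℝ A ↑u⁻¹) (fun x => by simp) (fun x => by simp)

/-- In a commutative Banach algebra, the square root near the square of a unit is smooth, by the
inverse function theorem. -/
theorem exists_local_sqrt (s : Aˣ) : ∃ r : A → A, ContDiffAt ℝ 2 r (s * s) ∧ r (s * s) = s ∧
    ∀ᶠ x in 𝓝 (s * s : A), r x * r x = x := by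
  -- the derivative of squaring at `s` is multiplication by the unit `u = 2 s`
  let u : Aˣ := Units.map (algebraMap ℝ A : ℝ →* A) (Units.mk0 2 two_ne_zero) * s
  have hu : (u : A) = s + s := by
    simp [u, ← two_mul, map_ofNat (algebraMap ℝ A) 2]
  have hf : ContDiffAt ℝ 2 (fun x : A => x * x) s := contDiffAt_id.mul contDiffAt_id
  have hf' : HasFDerivAt (fun x : A => x * x) (unitMulEquiv u : A →L[ℝ] A) (s : A) := by
    refine ((hasFDerivAt_id (𝕜 := ℝ) (s : A)).mul (hasFDerivAt_id (s : A))).congr_fderiv ?_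
    ext x
    change (s : A) * x + s * x = u * x
    rw [hu]; ring
  have h2 : (2 : WithTop ℕ∞) ≠ 0 := two_ne_zero
  refine ⟨hf.localInverse hf' h2, hf.to_localInverse hf' h2, hf.localInverse_apply_image hf' h2, ?_⟩
  exact (hf.hasStrictFDerivAt' hf' h2).eventually_right_inverse

end Sqrt

/-- Multiplication by a function with `|s| ≤ q` on `L²`, in terms of Fourier coefficients:
convolution with the coefficients of `s` has norm at most `q` on `ℓ²`. -/
theorem norm_mul_synth_le (s : BC) {q : ℝ} (hq : ∀ p, ‖s p‖ ≤ q) (y : EllTwo) :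
    ∃ a : EllTwo, ‖a‖ ≤ q * ‖y‖ ∧
      ∀ n, HasSum (fun m => y m * fourierCoef s (n - m)) (a n) := by
  have hm : MemLp (fun p => s p * synth y p) 2 cell := by
    refine MemLp.of_le_mul (c := q) (Lp.memLp (synth y))
      (s.continuous.aestronglyMeasurable.mul (Lp.memLp (synth y)).aestronglyMeasurable)
      (ae_of_all _ fun p => ?_)
    rw [norm_mul]
    gcongr
    exact hq p
  have hn : ‖hm.toLp‖ ≤ q * ‖synth y‖ := by
    refine Lp.norm_le_mul_norm_of_ae_le_mul ?_
    filter_upwards [hm.coeFn_toLp] with p hp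
    rw [hp, norm_mul]
    gcongr
    exact hq p
  obtain ⟨h1, h2⟩ := bessel hm.toLp
  refine ⟨EllTwo.mk _ h1, ?_, fun n => ?_⟩
  · have hq0 : 0 ≤ q := (norm_nonneg _).trans (hq 0)
    refine le_of_sq_le_sq ?_ (by positivity)
    rw [EllTwo.norm_sq]
    refine h2.trans ?_
    rw [norm_synth] at hn
    gcongr
  · have hc : Continuous fun p => character (-n) p * s p :=
      (contDiff_character _).continuous.mul s.continuous
    have h3 := hasSum_integral_synth hc y
    rw [EllTwo.mk_apply, fourierCoef_congr_ae hm.coeFn_toLp, fourierCoef]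
    simp only [fourierCoef_character_mul, mul_assoc, sub_neg_eq_add, neg_add_eq_sub] at h3
    exact h3

/-- Young's inequality `ℓ² * ℓ¹ ⊆ ℓ²`. -/
theorem young (y : EllTwo) {K : ℤ × ℤ → ℝ} (hK0 : ∀ n, 0 ≤ K n) (hK : Summable K) :
    (∀ n, Summable fun m => ‖y m‖ * K (n - m)) ∧
    Summable (fun n => (∑' m, ‖y m‖ * K (n - m)) ^ 2) ∧
    ∑' n, (∑' m, ‖y m‖ * K (n - m)) ^ 2 ≤ ((∑' n, K n) * ‖y‖) ^ 2 := by
  obtain ⟨h1, h2, h3⟩ := summable_conv (F := fun n => ‖y n‖ ^ 2) (fun n => sq_nonneg _) hK0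
    y.summable_sq hK
  have hKn : ∀ n, Summable fun m => K (n - m) := fun n => (Equiv.subLeft n).summable_iff.2 hK
  have key : ∀ n, (Summable fun m => ‖y m‖ * K (n - m)) ∧
      (∑' m, ‖y m‖ * K (n - m)) ^ 2 ≤ (∑' n, K n) * ∑' m, ‖y m‖ ^ 2 * K (n - m) := by
    intro n
    have h := tsum_mul_sq_le (f := fun m => √(K (n - m))) (g := fun m => ‖y m‖ * √(K (n - m)))
      (fun m => Real.sqrt_nonneg _) (fun m => by positivity)
      (by simpa only [Real.sq_sqrt (hK0 _)] using hKn n)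
      (by simpa only [mul_pow, Real.sq_sqrt (hK0 _)] using h1 n)
    have e : ∀ m, √(K (n - m)) * (‖y m‖ * √(K (n - m))) = ‖y m‖ * K (n - m) := fun m => by
      rw [mul_left_comm, Real.mul_self_sqrt (hK0 _)]
    simp only [e, mul_pow, Real.sq_sqrt (hK0 _)] at h
    have e2 : ∑' m, K (n - m) = ∑' m, K m := (Equiv.subLeft n).tsum_eq K
    rwa [e2] at h
  have hs := Summable.of_nonneg_of_le (fun n => sq_nonneg _) (fun n => (key n).2)
    (h2.mul_left (∑' n, K n))
  refine ⟨fun n => (key n).1, hs,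
    (hs.tsum_le_tsum (fun n => (key n).2) (h2.mul_left _)).trans_eq ?_⟩
  rw [tsum_mul_left, h3, mul_pow, EllTwo.norm_sq]
  ring

/-- The weight `(1 + ε |n|)³`, which defines for every `ε > 0` an equivalent norm on `W^{3,2}`. -/
noncomputable def epsWeight (ε : ℝ) (n : ℤ × ℤ) : ℝ := (1 + ε * (wt n - 1)) ^ 3

theorem epsBase_bounds {ε : ℝ} (h0 : 0 < ε) (h1 : ε ≤ 1) (n : ℤ × ℤ) :
    1 ≤ 1 + ε * (wt n - 1) ∧ 1 + ε * (wt n - 1) ≤ wt n ∧ ε * wt n ≤ 1 + ε * (wt n - 1) := by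
  have := one_le_wt n
  refine ⟨?_, ?_, ?_⟩ <;> nlinarith

theorem epsWeight_pos {ε : ℝ} (h0 : 0 < ε) (h1 : ε ≤ 1) (n : ℤ × ℤ) : 0 < epsWeight ε n :=
  pow_pos (one_pos.trans_le (epsBase_bounds h0 h1 n).1) 3

/-- For small `ε` the weight is nearly constant at any given scale: `1 + ε |n|` is
submultiplicative. -/
theorem abs_epsWeight_div_sub_one_le {ε : ℝ} (h0 : 0 < ε) (h1 : ε ≤ 1) (n m : ℤ × ℤ) :
    |epsWeight ε n / epsWeight ε m - 1| ≤ 7 * ε * wt (n - m) ^ 3 := by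
  have key : ∀ a b : ℤ × ℤ, 1 + ε * (wt a - 1) ≤
      (1 + ε * (wt (a - b) - 1)) * (1 + ε * (wt b - 1)) := by
    intro a b
    have h := wt_add_le (a - b) b
    have e : wt a ≤ wt (a - b) + wt b - 1 := by
      have h1 := abs_add_le ((a.1 : ℝ) - b.1) b.1
      have h2 := abs_add_le ((a.2 : ℝ) - b.2) b.2
      simp only [sub_add_cancel] at h1 h2
      simp only [wt, Prod.fst_sub, Prod.snd_sub, Int.cast_sub]
      linarith
    have h2 := one_le_wt (a - b)
    have h3 := one_le_wt b
    nlinarith [mul_nonneg (mul_nonneg h0.le (sub_nonneg.2 h2)) (mul_nonneg h0.le (sub_nonneg.2 h3))]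
  set x := 1 + ε * (wt n - 1) with hx
  set y := 1 + ε * (wt m - 1) with hy
  set z := 1 + ε * (wt (n - m) - 1) with hz
  obtain ⟨hx1, -, -⟩ := epsBase_bounds h0 h1 n
  obtain ⟨hy1, -, -⟩ := epsBase_bounds h0 h1 m
  obtain ⟨hz1, hz2, -⟩ := epsBase_bounds h0 h1 (n - m)
  rw [← hx] at hx1; rw [← hy] at hy1; rw [← hz] at hz1 hz2
  have k1 : x ≤ z * y := key n m
  have k2 : y ≤ z * x := by
    have := key m n
    rwa [show wt (m - n) = wt (n - m) by rw [← wt_neg, neg_sub]] at this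
  have hz3 : z ^ 3 - 1 ≤ 7 * ε * wt (n - m) ^ 3 := by
    have e : z ^ 3 - 1 = (z - 1) * (z ^ 2 + z + 1) := by ring
    have e1 : z - 1 ≤ ε * wt (n - m) := by rw [hz]; linarith
    have hW := one_le_wt (n - m)
    have e2 : z ^ 2 + z + 1 ≤ 3 * wt (n - m) ^ 2 := by nlinarith
    rw [e]
    calc (z - 1) * (z ^ 2 + z + 1) ≤ (ε * wt (n - m)) * (3 * wt (n - m) ^ 2) := by
          gcongr
      _ ≤ _ := by
        have : 0 ≤ ε * wt (n - m) ^ 3 := by positivity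
        linarith [show (ε * wt (n - m)) * (3 * wt (n - m) ^ 2) = 3 * (ε * wt (n - m) ^ 3) by ring]
  have hy3 : 0 < y ^ 3 := by positivity
  have hz3' : 1 ≤ z ^ 3 := one_le_pow₀ hz1
  have p1 : x ^ 3 ≤ z ^ 3 * y ^ 3 := by
    rw [← mul_pow]; gcongr
  have p2 : y ^ 3 ≤ z ^ 3 * x ^ 3 := by
    rw [← mul_pow]; gcongr
  have hx3 : 0 < x ^ 3 := by positivity
  have hdef : epsWeight ε n / epsWeight ε m = x ^ 3 / y ^ 3 := rfl
  rw [hdef, abs_le]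
  have d1 : x ^ 3 / y ^ 3 ≤ z ^ 3 := (div_le_iff₀ hy3).2 p1
  have d2 : 1 ≤ z ^ 3 * (x ^ 3 / y ^ 3) := by
    rw [← mul_div_assoc, le_div_iff₀ hy3]; linarith
  have d0 : 0 < x ^ 3 / y ^ 3 := by positivity
  constructor
  · nlinarith [mul_nonneg (sub_nonneg.2 hz3') (sub_nonneg.2 d2)]
  · linarith

namespace Sob

/-- `W^{3,2}` as the space of square summable families, with the weight `epsWeight`. -/
noncomputable def epsEquiv {ε : ℝ} (h0 : 0 < ε) (h1 : ε ≤ 1) : Sob 1 ≃L[ℂ] EllTwo :=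
  have b1 : ∀ n, ‖((epsWeight ε n / sobWeight 1 n : ℝ) : ℂ)‖ ≤ (sobConst 1)⁻¹ := fun n => by
    have hC := sobConst_pos 1
    have hw := wt_pos n
    have hx := epsBase_bounds h0 h1 n
    rw [Complex.norm_real, Real.norm_of_nonneg
      (div_nonneg (epsWeight_pos h0 h1 n).le (sobWeight_pos 1 n).le), sobWeight, epsWeight,
      div_le_iff₀ (by positivity)]
    calc _ ≤ wt n ^ 3 := by
          refine pow_le_pow_left₀ (by linarith [hx.1]) hx.2.1 3
      _ = _ := by field_simp
  have b2 : ∀ n, ‖((sobWeight 1 n / epsWeight ε n : ℝ) : ℂ)‖ ≤ sobConst 1 * (ε ^ 3)⁻¹ := fun n => by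
    have hC := sobConst_pos 1
    have hw := wt_pos n
    have hx := epsBase_bounds h0 h1 n
    rw [Complex.norm_real, Real.norm_of_nonneg
      (div_nonneg (sobWeight_pos 1 n).le (epsWeight_pos h0 h1 n).le),
      div_le_iff₀ (epsWeight_pos h0 h1 n), sobWeight, epsWeight]
    have : (ε * wt n) ^ 3 ≤ (1 + ε * (wt n - 1)) ^ 3 :=
      pow_le_pow_left₀ (by positivity) hx.2.2 3
    calc sobConst 1 * wt n ^ (1 + 2) = sobConst 1 * (ε ^ 3)⁻¹ * (ε * wt n) ^ 3 := by
          field_simp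
      _ ≤ _ := by gcongr
  have ne1 : ∀ n, ((epsWeight ε n : ℝ) : ℂ) ≠ 0 := fun n => by
    exact_mod_cast (epsWeight_pos h0 h1 n).ne'
  have ne2 : ∀ n, ((sobWeight 1 n : ℝ) : ℂ) ≠ 0 := fun n => by
    exact_mod_cast (sobWeight_pos 1 n).ne'
  (isom (j := 1)).symm.toContinuousLinearEquiv.trans
    (ContinuousLinearEquiv.equivOfInverse
      (diagonal (fun n => ((epsWeight ε n / sobWeight 1 n : ℝ) : ℂ)) _
        (inv_nonneg.2 (sobConst_pos 1).le) b1)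
      (diagonal (fun n => ((sobWeight 1 n / epsWeight ε n : ℝ) : ℂ)) _
        (by have := sobConst_pos 1; positivity) b2)
      (fun x => by
        ext n
        rw [diagonal_apply, diagonal_apply, ← mul_assoc]
        push_cast
        have := ne1 n; have := ne2 n
        field_simp)
      (fun x => by
        ext n
        rw [diagonal_apply, diagonal_apply, ← mul_assoc]
        push_cast
        have := ne1 n; have := ne2 n
        field_simp))

theorem epsEquiv_apply {ε : ℝ} (h0 : 0 < ε) (h1 : ε ≤ 1) (u : Sob 1) (n : ℤ × ℤ) :
    epsEquiv h0 h1 u n = epsWeight ε n * coef u n := by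
  have ne2 : ((sobWeight 1 n : ℝ) : ℂ) ≠ 0 := by exact_mod_cast (sobWeight_pos 1 n).ne'
  change ((epsWeight ε n / sobWeight 1 n : ℝ) : ℂ) * isom.symm u n = _
  rw [isom_symm_apply]
  push_cast
  field_simp

/-- With respect to the norms with weight `(1 + ε |n|)³`, multiplication by a smooth function is
bounded by its supremum norm, up to an error of order `ε`. -/
theorem norm_epsEquiv_mul_le {ε : ℝ} (h0 : 0 < ε) (h1 : ε ≤ 1) (s : Sob 1) {q B : ℝ}
    (hq : ∀ p, ‖ev s p‖ ≤ q) (hs : Summable fun n => wt n ^ 3 * ‖coef s n‖)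
    (hB : ∑' n, wt n ^ 3 * ‖coef s n‖ ≤ B) (w : Sob 1) :
    ‖epsEquiv h0 h1 (s * w)‖ ≤ (q + 7 * ε * B) * ‖epsEquiv h0 h1 w‖ := by
  set y := epsEquiv h0 h1 w with hy
  obtain ⟨a, ha, has⟩ := norm_mul_synth_le (ev s) hq y
  set K : ℤ × ℤ → ℝ := fun k => 7 * ε * (wt k ^ 3 * ‖coef s k‖) with hK
  have hK0 : ∀ n, 0 ≤ K n := fun n => by have := wt_pos n; positivity
  have hKs : Summable K := hs.mul_left _
  obtain ⟨y1, y2, y3⟩ := young y hK0 hKs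
  -- `a` is obtained by applying the weight before the multiplication by `s`; the difference is the
  -- commutator of the two, a convolution with a kernel of order `ε`
  have hb : ∀ n, ‖epsEquiv h0 h1 (s * w) n - a n‖ ≤ ∑' m, ‖y m‖ * K (n - m) := by
    intro n
    have hv := epsWeight_pos h0 h1 n
    have c1 : HasSum (fun m => coef w m * coef s (n - m)) (coef (s * w) n) := by
      have h := fourierCoef_series_mul (summable_coef w) (ev s) n
      have e : series (coef w) = ev w := DFunLike.coe_injective
        (eq_series w.periodic (ev w).continuous (summable_coef w)).symm
      rw [e] at h
      rw [mul_comm s w, coef, map_mul]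
      exact h
    have c2 := (c1.mul_left (epsWeight ε n : ℂ)).sub (has n)
    rw [← epsEquiv_apply h0 h1] at c2
    refine c2.norm_le_of_bounded (y1 n).hasSum fun m => ?_
    have hvm := epsWeight_pos h0 h1 m
    have hvm' : ((epsWeight ε m : ℝ) : ℂ) ≠ 0 := by exact_mod_cast hvm.ne'
    have e : (epsWeight ε n : ℂ) * (coef w m * coef s (n - m)) - y m * fourierCoef (ev s) (n - m) =
        ((epsWeight ε n / epsWeight ε m - 1 : ℝ) : ℂ) * y m * coef s (n - m) := by
      rw [hy, epsEquiv_apply]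
      change _ - _ * coef s (n - m) = _
      push_cast
      field_simp
    rw [e, norm_mul, norm_mul, Complex.norm_real, Real.norm_eq_abs, hK]
    calc _ ≤ 7 * ε * wt (n - m) ^ 3 * ‖y m‖ * ‖coef s (n - m)‖ := by
          gcongr
          exact abs_epsWeight_div_sub_one_le h0 h1 n m
      _ = _ := by ring
  have hn : ‖epsEquiv h0 h1 (s * w) - a‖ ≤ (∑' n, K n) * ‖y‖ := by
    refine le_of_sq_le_sq ?_ (mul_nonneg (tsum_nonneg hK0) (norm_nonneg _))
    rw [EllTwo.norm_sq]
    have hle : ∀ n, ‖(epsEquiv h0 h1 (s * w) - a) n‖ ^ 2 ≤ (∑' m, ‖y m‖ * K (n - m)) ^ 2 :=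
      fun n => pow_le_pow_left₀ (norm_nonneg _) (hb n) 2
    exact ((EllTwo.summable_sq _).tsum_le_tsum hle y2).trans y3
  have hKB : ∑' n, K n ≤ 7 * ε * B := by
    rw [hK, tsum_mul_left]
    gcongr
  calc ‖epsEquiv h0 h1 (s * w)‖ = ‖a + (epsEquiv h0 h1 (s * w) - a)‖ := by rw [add_sub_cancel]
    _ ≤ ‖a‖ + ‖epsEquiv h0 h1 (s * w) - a‖ := norm_add_le _ _
    _ ≤ q * ‖y‖ + 7 * ε * B * ‖y‖ := by
        gcongr
        exact hn.trans (by gcongr)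
    _ = _ := by ring

/-- If the supremum of the smooth function `s` times the supremum of the symbol of the Fourier
multiplier `R` is less than one, then `1 - s R` is invertible on `W^{3,2}`: it is a Neumann series
for one of the norms with weight `(1 + ε |n|)³`. -/
theorem isUnit_one_sub_mul_multiplier (s : Sob 1) {q μ : ℝ}
    (hq : ∀ p, ‖ev s p‖ ≤ q) (hs : Summable fun n => wt n ^ 3 * ‖coef s n‖)
    (R : Sob 1 →L[ℝ] Sob 1) (m : ℤ × ℤ → ℂ) (hR : ∀ u n, coef (R u) n = m n * coef u n)
    (hm : ∀ n, ‖m n‖ ≤ μ) (hqμ : q * μ < 1) :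
    IsUnit (1 - (ContinuousLinearMap.mul ℝ (Sob 1) s).comp R) := by
  have hμ0 : 0 ≤ μ := (norm_nonneg _).trans (hm 0)
  set B := ∑' n, wt n ^ 3 * ‖coef s n‖ with hB
  have hB0 : 0 ≤ B := tsum_nonneg fun n => by have := wt_pos n; positivity
  obtain ⟨ε, h0, h1, hε⟩ : ∃ ε : ℝ, 0 < ε ∧ ε ≤ 1 ∧ (q + 7 * ε * B) * μ < 1 := by
    have hD : 0 < 7 * B * μ + 1 := by positivity
    have hd : 0 < 1 - q * μ := sub_pos.2 hqμ
    refine ⟨min 1 ((1 - q * μ) / (2 * (7 * B * μ + 1))), lt_min one_pos (by positivity),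
      min_le_left _ _, ?_⟩
    set e := min 1 ((1 - q * μ) / (2 * (7 * B * μ + 1)))
    have he : e * (7 * B * μ + 1) ≤ (1 - q * μ) / 2 := by
      have : e ≤ (1 - q * μ) / (2 * (7 * B * μ + 1)) := min_le_right _ _
      calc e * (7 * B * μ + 1) ≤ (1 - q * μ) / (2 * (7 * B * μ + 1)) * (7 * B * μ + 1) := by gcongr
        _ = _ := by field_simp
    have he0 : 0 < e := lt_min one_pos (by positivity)
    nlinarith
  let A : Sob 1 ≃L[ℝ] EllTwo :=
    { (epsEquiv h0 h1).toLinearEquiv.restrictScalars ℝ with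
      continuous_toFun := (epsEquiv h0 h1).continuous
      continuous_invFun := (epsEquiv h0 h1).symm.continuous }
  have hA : ∀ u n, A u n = epsWeight ε n * coef u n := epsEquiv_apply h0 h1
  set T := (ContinuousLinearMap.mul ℝ (Sob 1) s).comp R with hT
  have hTu : ∀ u, ‖A (T u)‖ ≤ ((q + 7 * ε * B) * μ) * ‖A u‖ := by
    intro u
    have h2 : ‖A (T u)‖ ≤ (q + 7 * ε * B) * ‖A (R u)‖ :=
      norm_epsEquiv_mul_le h0 h1 s hq hs le_rfl (R u)
    have h3 : ‖A (R u)‖ ≤ μ * ‖A u‖ := by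
      refine le_of_sq_le_sq ?_ (by positivity)
      rw [mul_pow, EllTwo.norm_sq, EllTwo.norm_sq, ← tsum_mul_left]
      refine (EllTwo.summable_sq _).tsum_le_tsum (fun n => ?_)
        ((EllTwo.summable_sq _).mul_left _)
      rw [← mul_pow]
      refine pow_le_pow_left₀ (norm_nonneg _) ?_ 2
      rw [hA, hA, hR, mul_left_comm, norm_mul]
      gcongr
      exact hm n
    have hq0 : 0 ≤ q := (norm_nonneg _).trans (hq 0)
    calc _ ≤ (q + 7 * ε * B) * (μ * ‖A u‖) := h2.trans (by gcongr)
      _ = _ := by ring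
  -- in the norm of `ℓ²`, the operator conjugate to `s R` has norm less than one
  let T' : EllTwo →L[ℝ] EllTwo :=
    (A : Sob 1 →L[ℝ] EllTwo).comp (T.comp (A.symm : EllTwo →L[ℝ] Sob 1))
  have hT' : ‖T'‖ < 1 := by
    have hq0 : 0 ≤ q := (norm_nonneg _).trans (hq 0)
    refine lt_of_le_of_lt (ContinuousLinearMap.opNorm_le_bound _ (by positivity) fun x => ?_) hε
    have := hTu (A.symm x)
    rwa [A.apply_symm_apply] at this
  obtain ⟨U, hU⟩ := isUnit_one_sub_of_norm_lt_one hT'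
  have hU1 : ∀ x, (↑U⁻¹ : EllTwo →L[ℝ] EllTwo) ((1 - T') x) = x := fun x => by
    rw [← hU]
    exact DFunLike.congr_fun U.inv_mul x
  have hU2 : ∀ x, (1 - T') ((↑U⁻¹ : EllTwo →L[ℝ] EllTwo) x) = x := fun x => by
    rw [← hU]
    exact DFunLike.congr_fun U.mul_inv x
  have hc : ∀ u, (1 - T) u = A.symm ((1 - T') (A u)) := fun u => by
    simp [T']
  refine ⟨⟨1 - T, (A.symm : EllTwo →L[ℝ] Sob 1).comp
    ((↑U⁻¹ : EllTwo →L[ℝ] EllTwo).comp (A : Sob 1 →L[ℝ] EllTwo)), ?_, ?_⟩, rfl⟩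
  · ext1 u
    change (1 - T) (A.symm ((↑U⁻¹ : EllTwo →L[ℝ] EllTwo) (A u))) = u
    rw [hc, A.apply_symm_apply, hU2, A.symm_apply_apply]
  · ext1 u
    change A.symm ((↑U⁻¹ : EllTwo →L[ℝ] EllTwo) (A ((1 - T) u))) = u
    rw [hc, A.apply_symm_apply, hU1, A.symm_apply_apply]

end Sob

end CWillmore

/-! ### Immersions near a smooth immersion -/

namespace CWillmore

namespace Sob

variable {j : ℕ}

/-- Evaluation at a point, as a ring homomorphism. -/
noncomputable def evAt (p : ℝ × ℝ) : Sob j →+* ℂ where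
  toFun u := ev u p
  map_one' := by rw [map_one]; rfl
  map_mul' u v := by rw [map_mul]; rfl
  map_zero' := by rw [map_zero]; rfl
  map_add' u v := by rw [map_add]; rfl

theorem evAt_apply (p : ℝ × ℝ) (u : Sob j) : evAt p u = ev u p := rfl

theorem ext_evAt {u v : Sob j} (h : ∀ p, evAt p u = evAt p v) : u = v :=
  ev_injective (BoundedContinuousFunction.ext h)

/-- Convergence in the Sobolev algebra is uniform. -/
theorem evAt_sub_lt (u₀ : Sob j) {δ : ℝ} (hδ : 0 < δ) :
    ∀ᶠ u in 𝓝 u₀, ∀ p, ‖evAt p u - evAt p u₀‖ < δ := by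
  have h : Tendsto (fun u : Sob j => ev u) (𝓝 u₀) (𝓝 (ev u₀)) := continuous_ev.continuousAt
  filter_upwards [h (Metric.ball_mem_nhds _ hδ)] with u hu p
  rw [mem_preimage, mem_ball_iff_norm] at hu
  exact ((ev u - ev u₀).norm_coe_le_norm p).trans_lt hu

theorem evAt_inverse {u : Sob j} (h : IsUnit u) (p : ℝ × ℝ) :
    evAt p (Ring.inverse u) = (evAt p u)⁻¹ := by
  refine eq_inv_of_mul_eq_one_left ?_
  rw [← map_mul, Ring.inverse_mul_cancel u h, map_one]

/-- A smooth function on the torus without zeros is a unit in the Sobolev algebras. -/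
theorem exists_unit (j : ℕ) {u : ℝ × ℝ → ℂ} (hp : Periodic₂ u) (h : ContDiff ℝ (⊤ : ℕ∞) u)
    (h0 : ∀ p, u p ≠ 0) : ∃ v : (Sob j)ˣ, ∀ p, evAt p (v : Sob j) = u p := by
  obtain ⟨v, hv⟩ := exists_of_contDiff j hp h
  obtain ⟨w, hw⟩ := exists_of_contDiff j (u := fun p => (u p)⁻¹)
    (fun x y => by simp only [(hp x y).1, (hp x y).2, and_self]) (h.inv h0)
  have e : v * w = 1 := ext_evAt fun p => by
    rw [map_mul, map_one, evAt_apply, evAt_apply, hv, hw]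
    exact mul_inv_cancel₀ (h0 p)
  exact ⟨Units.mkOfMulEqOne v w e, fun p => congrFun hv p⟩

/-- The values of a unit are bounded away from zero. -/
theorem exists_lower_bound (v : (Sob j)ˣ) : ∃ c > 0, ∀ p, c ≤ ‖evAt p (v : Sob j)‖ := by
  set K := ‖ev (↑v⁻¹ : Sob j)‖
  refine ⟨(K + 1)⁻¹, by positivity, fun p => ?_⟩
  have h1 : ‖evAt p (↑v⁻¹ : Sob j)‖ ≤ K := (ev (↑v⁻¹ : Sob j)).norm_coe_le_norm p
  have h2 : evAt p (v : Sob j) * evAt p (↑v⁻¹ : Sob j) = 1 := by rw [← map_mul, v.mul_inv, map_one]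
  have h3 : ‖evAt p (v : Sob j)‖ * ‖evAt p (↑v⁻¹ : Sob j)‖ = 1 := by rw [← norm_mul, h2, norm_one]
  rw [inv_le_iff_one_le_mul₀ (by positivity)]
  calc (1 : ℝ) = ‖evAt p (v : Sob j)‖ * ‖evAt p (↑v⁻¹ : Sob j)‖ := h3.symm
    _ ≤ ‖evAt p (v : Sob j)‖ * (K + 1) := by gcongr; linarith

end Sob

theorem eq_ofReal_sqrt {z : ℂ} {x : ℝ} (hx : 0 ≤ x) (h : z * z = x) (hz : 0 < z.re) : z = √x := by
  have h1 : z * z = (√x : ℂ) * (√x : ℂ) := by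
    rw [h, ← Complex.ofReal_mul, Real.mul_self_sqrt hx]
  rcases mul_self_eq_mul_self_iff.1 h1 with h2 | h2
  · exact h2
  · rw [h2] at hz
    simp only [Complex.neg_re, Complex.ofReal_re] at hz
    linarith [Real.sqrt_nonneg x]

/-- Near the square of a unit with positive values there is a smooth square root, which has the
expected values on positive functions. -/
theorem Sob.exists_sqrt {j : ℕ} (s : (Sob j)ˣ) (hs : ∀ p, 0 < (evAt p (s : Sob j)).re ∧
    (evAt p (s : Sob j)).im = 0) :
    ∃ r : Sob j → Sob j, ContDiffAt ℝ 2 r (s * s) ∧ ∀ᶠ x in 𝓝 (s * s : Sob j), IsUnit (r x) ∧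
      ∀ p (t : ℝ), 0 ≤ t → evAt p x = t → 0 < t ∧ evAt p (r x) = (√t : ℝ) := by
  obtain ⟨r, hr, hrs, hsq⟩ := exists_local_sqrt s
  refine ⟨r, hr, ?_⟩
  obtain ⟨c, hc, hcs⟩ := exists_lower_bound s
  have hcont : Tendsto r (𝓝 (s * s)) (𝓝 s) := by
    have := hr.continuousAt.tendsto
    rwa [hrs] at this
  filter_upwards [hsq, hcont.eventually (evAt_sub_lt (s : Sob j) hc),
    hcont.eventually (Units.nhds s)] with x h1 h2 h3
  refine ⟨h3, fun p t ht hx => ?_⟩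
  -- `r x` is uniformly close to `s`, which singles out the positive square root
  have hre : 0 < (evAt p (r x)).re := by
    have h4 := hcs p
    have h5 : ‖evAt p (s : Sob j)‖ = (evAt p (s : Sob j)).re := by
      have : evAt p (s : Sob j) = ((evAt p (s : Sob j)).re : ℂ) :=
        Complex.ext rfl (by simp [(hs p).2])
      rw [this, Complex.norm_real, Real.norm_of_nonneg (hs p).1.le, Complex.ofReal_re]
    have h6 := (Complex.abs_re_le_norm _).trans_lt (h2 p)
    rw [Complex.sub_re, abs_lt] at h6
    linarith [h6.1]
  have h7 : evAt p (r x) * evAt p (r x) = t := by rw [← map_mul, h1, hx]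
  have h8 := eq_ofReal_sqrt ht h7 hre
  refine ⟨?_, h8⟩
  rw [h8, Complex.ofReal_re] at hre
  exact Real.sqrt_pos.1 hre

/-- The `i`-th coordinate of `ℝ⁴`, with values in `ℂ`. -/
noncomputable def coordC (i : Fin 4) : E4 →L[ℝ] ℂ :=
  Complex.ofRealCLM.comp (EuclideanSpace.proj i : E4 →L[ℝ] ℝ)

/-- The coordinates of `F : T² → ℝ⁴` are the functions `X i` of Sobolev class. -/
def Represents {j : ℕ} (X : Fin 4 → Sob j) (F : ℝ × ℝ → E4) : Prop :=
  ∀ p i, Sob.evAt p (X i) = (F p i : ℂ)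

theorem represents_toSob (u : W42 E4) : Represents (fun i => toSob (coordC i) u) u :=
  fun p i => ev_toSob (coordC i) u p

/-- The derivative of a map is represented by the derivatives of its coordinates. -/
theorem Represents.hasFDerivAt {j : ℕ} {X : Fin 4 → Sob (j + 1)} {F : ℝ × ℝ → E4}
    (h : Represents X F) (p : ℝ × ℝ) : ∃ F' : ℝ × ℝ →L[ℝ] E4, HasFDerivAt F F' p ∧
      ∀ q i, ((F' q) i : ℂ) =
        Sob.gradL (Sob.evAt p (Sob.D₁ (X i))) (Sob.evAt p (Sob.D₂ (X i))) q := by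
  have hc : ∀ i, (fun q => F q i) = fun q => (Sob.ev (X i) q).re := fun i => by
    funext q
    have := h q i
    rw [Sob.evAt_apply] at this
    rw [this, Complex.ofReal_re]
  have hd : ∀ i, HasFDerivAt (fun q => F q i)
      (Complex.reCLM.comp
        (Sob.gradL (Sob.evAt p (Sob.D₁ (X i))) (Sob.evAt p (Sob.D₂ (X i))))) p := by
    intro i
    rw [hc]
    exact Complex.reCLM.hasFDerivAt.comp p (Sob.hasFDerivAt (X i) p)
  have hF : HasFDerivAt F
      ((PiLp.continuousLinearEquiv 2 ℝ (fun _ : Fin 4 => ℝ)).symm.toContinuousLinearMap.comp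
      (ContinuousLinearMap.pi fun i => Complex.reCLM.comp
        (Sob.gradL (Sob.evAt p (Sob.D₁ (X i))) (Sob.evAt p (Sob.D₂ (X i)))))) p := by
    rw [← hasFDerivWithinAt_univ, hasFDerivWithinAt_euclidean]
    simp only [hasFDerivWithinAt_univ]
    exact hd
  refine ⟨_, hF, fun q i => ?_⟩
  have hcc : HasFDerivAt (fun q => ((F q i : ℝ) : ℂ))
      (Complex.ofRealCLM.comp (Complex.reCLM.comp
        (Sob.gradL (Sob.evAt p (Sob.D₁ (X i))) (Sob.evAt p (Sob.D₂ (X i)))))) p :=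
    Complex.ofRealCLM.hasFDerivAt.comp p (hd i)
  have he : (fun q => ((F q i : ℝ) : ℂ)) = Sob.ev (X i) := funext fun q => (h q i).symm
  rw [he] at hcc
  exact DFunLike.congr_fun (hcc.unique (Sob.hasFDerivAt (X i) p)) q

theorem Represents.pd₁ {j : ℕ} {X : Fin 4 → Sob (j + 1)} {F : ℝ × ℝ → E4}
    (h : Represents X F) : Represents (fun i => Sob.D₁ (X i)) (pd₁ F) := by
  intro p i
  obtain ⟨F', hF, hF'⟩ := h.hasFDerivAt p
  rw [CWillmore.pd₁, hF.fderiv, hF']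
  simp

theorem Represents.pd₂ {j : ℕ} {X : Fin 4 → Sob (j + 1)} {F : ℝ × ℝ → E4}
    (h : Represents X F) : Represents (fun i => Sob.D₂ (X i)) (pd₂ F) := by
  intro p i
  obtain ⟨F', hF, hF'⟩ := h.hasFDerivAt p
  rw [CWillmore.pd₂, hF.fderiv, hF']
  simp

section Polynomials

variable {R S : Type*} [CommRing R] [CommRing S]

/-- The bilinear dot product on `R⁴`. -/
def dot (x y : Fin 4 → R) : R := ∑ i, x i * y i

theorem map_dot (φ : R →+* S) (x y : Fin 4 → R) :
    φ (dot x y) = dot (fun i => φ (x i)) (fun i => φ (y i)) := by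
  simp [dot]

/-- The product of the triple vector product of `a`, `b`, `c` with `z`. -/
def tripleDot (a b c z : Fin 4 → R) : R :=
  ∑ k, (Matrix.of ![a, b, c, Pi.single k 1]).det * z k

theorem map_tripleDot (φ : R →+* S) (a b c z : Fin 4 → R) :
    φ (tripleDot a b c z) = tripleDot (fun i => φ (a i)) (fun i => φ (b i)) (fun i => φ (c i))
      (fun i => φ (z i)) := by
  simp only [tripleDot, map_sum, map_mul, RingHom.map_det]
  refine Finset.sum_congr rfl fun k _ => ?_
  congr 2
  ext i l
  fin_cases i <;> simp [Pi.single_apply, apply_ite φ]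

/-- The determinant of the Gram matrix. -/
def gram (x y : Fin 4 → R) : R := dot x x * dot y y - dot x y ^ 2

theorem map_gram (φ : R →+* S) (x y : Fin 4 → R) :
    φ (gram x y) = gram (fun i => φ (x i)) (fun i => φ (y i)) := by
  simp [gram, map_dot]

/-- The numerator of the mean curvature. -/
def curvatureNumerator (a x y xx xy yy : Fin 4 → R) : R :=
  dot y y * tripleDot a x y xx - 2 * dot x y * tripleDot a x y xy + dot x x * tripleDot a x y yy

theorem map_curvatureNumerator (φ : R →+* S) (a x y xx xy yy : Fin 4 → R) :
    φ (curvatureNumerator a x y xx xy yy) = curvatureNumerator (fun i => φ (a i))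
      (fun i => φ (x i)) (fun i => φ (y i)) (fun i => φ (xx i)) (fun i => φ (xy i))
      (fun i => φ (yy i)) := by
  simp [curvatureNumerator, map_dot, map_tripleDot, map_ofNat φ 2]

end Polynomials

section Smooth

variable {E A : Type*} [NormedAddCommGroup E] [NormedSpace ℝ E] [NormedCommRing A]
  [NormedAlgebra ℝ A] {e : E} {n : WithTop ℕ∞}

theorem ContDiffAt.dot {x y : E → Fin 4 → A} (hx : ∀ i, ContDiffAt ℝ n (fun u => x u i) e)
    (hy : ∀ i, ContDiffAt ℝ n (fun u => y u i) e) :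
    ContDiffAt ℝ n (fun u => dot (x u) (y u)) e :=
  ContDiffAt.sum fun i _ => (hx i).mul (hy i)

theorem ContDiffAt.gram {x y : E → Fin 4 → A} (hx : ∀ i, ContDiffAt ℝ n (fun u => x u i) e)
    (hy : ∀ i, ContDiffAt ℝ n (fun u => y u i) e) :
    ContDiffAt ℝ n (fun u => gram (x u) (y u)) e :=
  ((ContDiffAt.dot hx hx).mul (ContDiffAt.dot hy hy)).sub ((ContDiffAt.dot hx hy).pow 2)

theorem ContDiffAt.tripleDot {a b c z : E → Fin 4 → A}
    (ha : ∀ i, ContDiffAt ℝ n (fun u => a u i) e) (hb : ∀ i, ContDiffAt ℝ n (fun u => b u i) e)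
    (hc : ∀ i, ContDiffAt ℝ n (fun u => c u i) e) (hz : ∀ i, ContDiffAt ℝ n (fun u => z u i) e) :
    ContDiffAt ℝ n (fun u => tripleDot (a u) (b u) (c u) (z u)) e := by
  refine ContDiffAt.sum fun k _ => ContDiffAt.mul ?_ (hz k)
  simp only [Matrix.det_apply]
  refine ContDiffAt.sum fun σ _ => ?_
  refine ContDiffAt.const_smul _ (contDiffAt_prod fun l _ => ?_)
  generalize σ l = i
  fin_cases i
  · exact ha l
  · exact hb l
  · exact hc l
  · exact contDiffAt_const

theorem ContDiffAt.curvatureNumerator {a x y xx xy yy : E → Fin 4 → A}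
    (ha : ∀ i, ContDiffAt ℝ n (fun u => a u i) e) (hx : ∀ i, ContDiffAt ℝ n (fun u => x u i) e)
    (hy : ∀ i, ContDiffAt ℝ n (fun u => y u i) e) (hxx : ∀ i, ContDiffAt ℝ n (fun u => xx u i) e)
    (hxy : ∀ i, ContDiffAt ℝ n (fun u => xy u i) e)
    (hyy : ∀ i, ContDiffAt ℝ n (fun u => yy u i) e) :
    ContDiffAt ℝ n
      (fun u => curvatureNumerator (a u) (x u) (y u) (xx u) (xy u) (yy u)) e :=
  (((ContDiffAt.dot hy hy).mul (ContDiffAt.tripleDot ha hx hy hxx)).sub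
    ((contDiffAt_const.mul (ContDiffAt.dot hx hy)).mul (ContDiffAt.tripleDot ha hx hy hxy))).add
    ((ContDiffAt.dot hx hx).mul (ContDiffAt.tripleDot ha hx hy hyy))

end Smooth

theorem inner_eq_dot (x y : E4) : ⟪x, y⟫ = dot (fun i => x i) (fun i => y i) := by
  rw [PiLp.inner_apply, dot]
  refine Finset.sum_congr rfl fun i _ => ?_
  simp [mul_comm]

/-- The radial projection of `u` to the sphere. -/
noncomputable def radial (u : ℝ × ℝ → E4) (p : ℝ × ℝ) : E4 := ‖u p‖⁻¹ • u p

theorem radial_of_norm_eq_one {u : ℝ × ℝ → E4} (h : ∀ p, ‖u p‖ = 1) : radial u = u := by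
  funext p
  rw [radial, h, inv_one, one_smul]

/-- The radial projection to the sphere is smooth in `W42`: `|u|` is the square root of `⟨u, u⟩` in
the Sobolev algebra, near the square root `1` at `f`. -/
theorem exists_radial {f : W42 E4} (hf : ∀ p, ‖f p‖ = 1) :
    ∃ N : W42 E4 → Fin 4 → Sob 2, (∀ i, ContDiffAt ℝ 2 (fun u => N u i) f) ∧
      ∀ᶠ u in 𝓝 f, Represents (N u) (radial u) := by
  let Q : W42 E4 → Sob 2 := fun u =>
    dot (fun i => toSob (coordC i) u) (fun i => toSob (coordC i) u)
  have hJ : ∀ i, ContDiffAt ℝ 2 (fun u : W42 E4 => toSob (coordC i) u) f := fun i =>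
    (toSob (coordC i)).contDiff.contDiffAt
  have hQ : ContDiffAt ℝ 2 Q f := ContDiffAt.dot hJ hJ
  have hQp : ∀ u p, Sob.evAt p (Q u) = ((‖u p‖ ^ 2 : ℝ) : ℂ) := by
    intro u p
    rw [← real_inner_self_eq_norm_sq, inner_eq_dot]
    change Sob.evAt p (dot _ _) = Complex.ofRealHom (dot _ _)
    rw [map_dot, map_dot]
    simp only [represents_toSob u p]
    rfl
  have hQf : Q f = (1 : (Sob 2)ˣ) * (1 : (Sob 2)ˣ) := Sob.ext_evAt fun p => by
    rw [hQp, hf]; simp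
  obtain ⟨r, hr, hr2⟩ := Sob.exists_sqrt (1 : (Sob 2)ˣ) (fun p => by simp)
  rw [← hQf] at hr hr2
  have hrQ : ContDiffAt ℝ 2 (fun u => r (Q u)) f := hr.comp f hQ
  have hunit : ∀ᶠ u in 𝓝 f, IsUnit (r (Q u)) ∧ ∀ p (t : ℝ), 0 ≤ t → Sob.evAt p (Q u) = t →
      0 < t ∧ Sob.evAt p (r (Q u)) = (√t : ℝ) := hQ.continuousAt.tendsto.eventually hr2
  obtain ⟨v, hv⟩ := (hunit.self_of_nhds).1
  have hinv0 : ContDiffAt ℝ 2 Ring.inverse (r (Q f)) := by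
    rw [← hv]; exact contDiffAt_ringInverse ℝ v
  have hinv : ContDiffAt ℝ 2 (fun u => Ring.inverse (r (Q u))) f :=
    ContDiffAt.comp (g := Ring.inverse) f hinv0 hrQ
  refine ⟨fun u i => Ring.inverse (r (Q u)) * toSob (coordC i) u, fun i => hinv.mul (hJ i), ?_⟩
  filter_upwards [hunit] with u hu p i
  obtain ⟨h1, h2⟩ := hu.2 p _ (sq_nonneg _) (hQp u p)
  rw [map_mul, Sob.evAt_inverse hu.1, h2, Real.sqrt_sq (norm_nonneg _), represents_toSob u p i]
  simp [radial]

theorem g₁₁_eq (F : ℝ × ℝ → E4) (p : ℝ × ℝ) :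
    g₁₁ F p = dot (fun i => pd₁ F p i) (fun i => pd₁ F p i) := inner_eq_dot _ _

theorem g₁₂_eq (F : ℝ × ℝ → E4) (p : ℝ × ℝ) :
    g₁₂ F p = dot (fun i => pd₁ F p i) (fun i => pd₂ F p i) := inner_eq_dot _ _

theorem g₂₂_eq (F : ℝ × ℝ → E4) (p : ℝ × ℝ) :
    g₂₂ F p = dot (fun i => pd₂ F p i) (fun i => pd₂ F p i) := inner_eq_dot _ _

theorem gdet_eq (F : ℝ × ℝ → E4) (p : ℝ × ℝ) :
    gdet F p = gram (fun i => pd₁ F p i) (fun i => pd₂ F p i) := by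
  rw [gdet, g₁₁_eq, g₁₂_eq, g₂₂_eq, gram]

theorem evAt_dot {j : ℕ} {X Y : Fin 4 → Sob j} {F G : ℝ × ℝ → E4} (hX : Represents X F)
    (hY : Represents Y G) (p : ℝ × ℝ) :
    Sob.evAt p (dot X Y) = ((dot (fun i => F p i) (fun i => G p i) : ℝ) : ℂ) := by
  change _ = Complex.ofRealHom (dot _ _)
  rw [map_dot, map_dot]
  simp only [hX p, hY p]
  rfl

theorem evAt_gram {j : ℕ} {X Y : Fin 4 → Sob j} {F G : ℝ × ℝ → E4} (hX : Represents X F)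
    (hY : Represents Y G) (p : ℝ × ℝ) :
    Sob.evAt p (gram X Y) = ((gram (fun i => F p i) (fun i => G p i) : ℝ) : ℂ) := by
  change _ = Complex.ofRealHom (gram _ _)
  rw [map_gram, map_gram]
  simp only [hX p, hY p]
  rfl

theorem gdet_nonneg (F : ℝ × ℝ → E4) (p : ℝ × ℝ) : 0 ≤ gdet F p := by
  have h := real_inner_mul_inner_self_le (pd₁ F p) (pd₂ F p)
  rw [gdet, g₁₁, g₁₂, g₂₂, sq]
  linarith

theorem g₁₁_pos_of_gdet_pos {F : ℝ × ℝ → E4} {p : ℝ × ℝ} (h : 0 < gdet F p) : 0 < g₁₁ F p := by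
  have h0 : 0 ≤ g₁₁ F p := real_inner_self_nonneg
  refine h0.lt_of_ne fun h1 => ?_
  rw [gdet, ← h1] at h
  nlinarith [sq_nonneg (g₁₂ F p)]

theorem gdet_pos_of_injective {F : ℝ × ℝ → E4} {p : ℝ × ℝ}
    (h : Function.Injective (fderiv ℝ F p)) : 0 < gdet F p := by
  have hx : pd₁ F p ≠ 0 := fun h0 => by
    have : ((1, 0) : ℝ × ℝ) = 0 := h (by rw [map_zero]; exact h0)
    simp at this
  have h11 : 0 < g₁₁ F p := real_inner_self_pos.2 hx
  set a := g₁₁ F p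
  set b := g₁₂ F p
  -- the square of the norm of this vector is `g₁₁` times the determinant
  have hz : (-b) • pd₁ F p + a • pd₂ F p ≠ 0 := fun h0 => by
    have : ((-b, a) : ℝ × ℝ) = 0 := h (by
      rw [map_zero, ← h0, pd₁, pd₂, ← map_smul, ← map_smul, ← map_add]
      simp)
    rw [Prod.mk_eq_zero] at this
    exact h11.ne' this.2
  have hpos := real_inner_self_pos.2 hz
  have e : ⟪(-b) • pd₁ F p + a • pd₂ F p, (-b) • pd₁ F p + a • pd₂ F p⟫ = a * gdet F p := by
    have e2 : ⟪pd₂ F p, pd₁ F p⟫ = b := real_inner_comm _ _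
    rw [inner_add_add_self]
    simp only [real_inner_smul_left, real_inner_smul_right, e2]
    change -b * (-b * a) + a * (-b * b) + -b * (a * b) + a * (a * g₂₂ F p) =
      a * (a * g₂₂ F p - b ^ 2)
    ring
  rw [e] at hpos
  exact pos_of_mul_pos_right hpos h11.le

/-- The metric near a smooth immersion: the area density and `g₁₁` stay positive, and the area
density depends smoothly on the map. -/
theorem exists_metric {f : W42 E4} (hf : IsSmoothImmersion f) :
    ∃ (N : W42 E4 → Fin 4 → Sob 2) (S : W42 E4 → Sob 1), (∀ i, ContDiffAt ℝ 2 (fun u => N u i) f) ∧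
      ContDiffAt ℝ 2 S f ∧ ∀ᶠ u in 𝓝 f, Represents (N u) (radial u) ∧ IsUnit (S u) ∧
        IsUnit (dot (fun i => Sob.D₁ (N u i)) (fun i => Sob.D₁ (N u i))) ∧
        ∀ p, 0 < gdet (radial u) p ∧ Sob.evAt p (S u) = (√(gdet (radial u) p) : ℝ) := by
  obtain ⟨hper, hsm, hn1, hinj⟩ := hf
  obtain ⟨N, hN, hNr⟩ := exists_radial hn1
  have hrf : radial f = f := radial_of_norm_eq_one hn1
  have hD1 : ∀ i, ContDiffAt ℝ 2 (fun u => Sob.D₁ (N u i)) f := fun i =>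
    ((Sob.D₁ (j := 1)).restrictScalars ℝ).contDiff.contDiffAt.comp f (hN i)
  have hD2 : ∀ i, ContDiffAt ℝ 2 (fun u => Sob.D₂ (N u i)) f := fun i =>
    ((Sob.D₂ (j := 1)).restrictScalars ℝ).contDiff.contDiffAt.comp f (hN i)
  have hG := ContDiffAt.gram hD1 hD2
  have hG11 := ContDiffAt.dot hD1 hD1
  have hNf := hNr.self_of_nhds
  rw [hrf] at hNf
  have hgpos : ∀ p, 0 < gdet f p := fun p => gdet_pos_of_injective (hinj p)
  have h11pos : ∀ p, 0 < g₁₁ f p := fun p => g₁₁_pos_of_gdet_pos (hgpos p)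
  have hp1 := hper.pd₁
  have hp2 := hper.pd₂
  have hc1 := contDiff_pd₁ hsm
  have hc2 := contDiff_pd₂ hsm
  have c11 : ContDiff ℝ (⊤ : ℕ∞) (g₁₁ f) := hc1.inner ℝ hc1
  have cdet : ContDiff ℝ (⊤ : ℕ∞) (gdet f) :=
    ((hc1.inner ℝ hc1).mul (hc2.inner ℝ hc2)).sub ((hc1.inner ℝ hc2).pow 2)
  -- the area density `s` and the coefficient `v = g₁₁` at `f` are units; this persists nearby
  obtain ⟨s, hs⟩ := Sob.exists_unit 1 (u := fun p => ((√(gdet f p) : ℝ) : ℂ))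
    (fun x y => by
      simp only [gdet, g₁₁, g₁₂, g₂₂, (hp1 x y).1, (hp1 x y).2, (hp2 x y).1, (hp2 x y).2, and_self])
    (Complex.ofRealCLM.contDiff.comp (cdet.sqrt fun p => (hgpos p).ne'))
    (fun p => by exact_mod_cast (Real.sqrt_pos.2 (hgpos p)).ne')
  obtain ⟨v, hv⟩ := Sob.exists_unit 1 (u := fun p => (g₁₁ f p : ℂ))
    (fun x y => by simp only [g₁₁, (hp1 x y).1, (hp1 x y).2, and_self])
    (Complex.ofRealCLM.contDiff.comp c11) (fun p => by exact_mod_cast (h11pos p).ne')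
  have hGf : gram (fun i => Sob.D₁ (N f i)) (fun i => Sob.D₂ (N f i)) = s * s :=
    Sob.ext_evAt fun p => by
      rw [evAt_gram hNf.pd₁ hNf.pd₂, ← gdet_eq, map_mul, hs, ← Complex.ofReal_mul,
        Real.mul_self_sqrt (hgpos p).le]
  have hG11f : dot (fun i => Sob.D₁ (N f i)) (fun i => Sob.D₁ (N f i)) = v :=
    Sob.ext_evAt fun p => by
      rw [evAt_dot hNf.pd₁ hNf.pd₁, ← g₁₁_eq, hv]
  obtain ⟨r, hr, hr2⟩ := Sob.exists_sqrt s (fun p => by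
    rw [hs]; exact ⟨by simpa using hgpos p, by simp⟩)
  rw [← hGf] at hr hr2
  refine ⟨N, fun u => r (gram (fun i => Sob.D₁ (N u i)) (fun i => Sob.D₂ (N u i))), hN,
    hr.comp f hG, ?_⟩
  have hU : ∀ᶠ u in 𝓝 f, IsUnit (dot (fun i => Sob.D₁ (N u i)) (fun i => Sob.D₁ (N u i))) := by
    refine hG11.continuousAt.tendsto.eventually ?_
    rw [hG11f]
    exact Units.nhds v
  filter_upwards [hNr, hG.continuousAt.tendsto.eventually hr2, hU] with u h1 h2 h3
  refine ⟨h1, h2.1, h3, fun p => ?_⟩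
  refine h2.2 p _ (gdet_nonneg _ p) ?_
  rw [evAt_gram h1.pd₁ h1.pd₂, ← gdet_eq]

end CWillmore

/-! ### Smoothness of the Willmore energy -/

namespace CWillmore

theorem inner_unitNormal (F : ℝ × ℝ → E4) (p : ℝ × ℝ) (z : E4) :
    ⟪z, unitNormal F p⟫ = (√(gdet F p))⁻¹ * tripleDot (fun i => F p i) (fun i => pd₁ F p i)
      (fun i => pd₂ F p i) (fun i => z i) := by
  rw [unitNormal, real_inner_smul_right, inner_eq_dot, dot, tripleDot]
  congr 1
  exact Finset.sum_congr rfl fun k _ => mul_comm _ _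

/-- The integrand of the Willmore energy is a polynomial in the derivatives of the map, the area
density and its inverse. -/
theorem willmore_density_eq {F : ℝ × ℝ → E4} {p : ℝ × ℝ} (h : 0 < gdet F p) :
    (meanCurvature F p ^ 2 + 1) * √(gdet F p) =
      curvatureNumerator (fun i => F p i) (fun i => pd₁ F p i) (fun i => pd₂ F p i)
        (fun i => pd₁ (pd₁ F) p i) (fun i => pd₁ (pd₂ F) p i) (fun i => pd₂ (pd₂ F) p i) ^ 2 *
        (√(gdet F p))⁻¹ ^ 5 * (1 / 4) + √(gdet F p) := by
  rw [meanCurvature, inner_unitNormal, inner_unitNormal, inner_unitNormal, g₁₁_eq, g₁₂_eq, g₂₂_eq,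
    curvatureNumerator]
  set s := √(gdet F p) with hs
  have hs0 : 0 < s := Real.sqrt_pos.2 h
  have hg : gdet F p = s ^ 2 := (Real.sq_sqrt h.le).symm
  rw [hg]
  field_simp
  ring

/-- Evaluation of bounded continuous functions, as a ring homomorphism. -/
noncomputable def evBC (p : ℝ × ℝ) : BC →+* ℂ where
  toFun u := u p
  map_one' := rfl
  map_mul' _ _ := rfl
  map_zero' := rfl
  map_add' _ _ := rfl

theorem evBC_ev {j : ℕ} (p : ℝ × ℝ) (u : Sob j) : evBC p (Sob.ev u) = Sob.evAt p u := rfl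

/-- The second derivatives of maps of class `W^{4,2}` are continuous, so the integrand of the
Willmore energy is a smooth function with values in the Banach algebra of bounded continuous
functions. -/
theorem contDiffAt_willmore {f : W42 E4} (hf : IsSmoothImmersion f) :
    ContDiffAt ℝ 2 (fun u : W42 E4 => willmore (radial u)) f := by
  obtain ⟨N, S, hN, hS, hev⟩ := exists_metric hf
  have lift : ∀ {j : ℕ} {g : W42 E4 → Sob j}, ContDiffAt ℝ 2 g f →
      ContDiffAt ℝ 2 (fun u => Sob.ev (g u)) f := fun {j} {g} hg =>
    ((Sob.evL (j := j)).restrictScalars ℝ).contDiff.contDiffAt.comp f hg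
  have d1 : ∀ {j : ℕ} {g : W42 E4 → Sob (j + 1)}, ContDiffAt ℝ 2 g f →
      ContDiffAt ℝ 2 (fun u => Sob.D₁ (g u)) f := fun {j} {g} hg =>
    ((Sob.D₁ (j := j)).restrictScalars ℝ).contDiff.contDiffAt.comp f hg
  have d2 : ∀ {j : ℕ} {g : W42 E4 → Sob (j + 1)}, ContDiffAt ℝ 2 g f →
      ContDiffAt ℝ 2 (fun u => Sob.D₂ (g u)) f := fun {j} {g} hg =>
    ((Sob.D₂ (j := j)).restrictScalars ℝ).contDiff.contDiffAt.comp f hg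
  obtain ⟨v, hv⟩ := hev.self_of_nhds.2.1
  have hinv0 : ContDiffAt ℝ 2 Ring.inverse (S f) := by
    rw [← hv]; exact contDiffAt_ringInverse ℝ v
  have hinv : ContDiffAt ℝ 2 (fun u => Ring.inverse (S u)) f :=
    ContDiffAt.comp (g := Ring.inverse) f hinv0 hS
  let num : W42 E4 → BC := fun u => curvatureNumerator (fun i => Sob.ev (N u i))
    (fun i => Sob.ev (Sob.D₁ (N u i))) (fun i => Sob.ev (Sob.D₂ (N u i)))
    (fun i => Sob.ev (Sob.D₁ (Sob.D₁ (N u i)))) (fun i => Sob.ev (Sob.D₁ (Sob.D₂ (N u i))))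
    (fun i => Sob.ev (Sob.D₂ (Sob.D₂ (N u i))))
  have hnum : ContDiffAt ℝ 2 num f :=
    ContDiffAt.curvatureNumerator (fun i => lift (hN i)) (fun i => lift (d1 (hN i)))
      (fun i => lift (d2 (hN i))) (fun i => lift (d1 (d1 (hN i)))) (fun i => lift (d1 (d2 (hN i))))
      (fun i => lift (d2 (d2 (hN i))))
  let dens : W42 E4 → BC := fun u =>
    num u ^ 2 * Sob.ev (Ring.inverse (S u)) ^ 5 * algebraMap ℂ BC (1 / 4) + Sob.ev (S u)
  have hdens : ContDiffAt ℝ 2 dens f :=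
    (((hnum.pow 2).mul ((lift hinv).pow 5)).mul contDiffAt_const).add (lift hS)
  have hI : ContDiffAt ℝ 2 (fun u => (integralBC (dens u)).re) f :=
    (Complex.reCLM.comp (integralBC.restrictScalars ℝ)).contDiff.contDiffAt.comp f hdens
  refine hI.congr_of_eventuallyEq ?_
  filter_upwards [hev] with u hu
  obtain ⟨hR, hU, -, hg⟩ := hu
  have key : ∀ p, dens u p =
      (((meanCurvature (radial u) p ^ 2 + 1) * √(gdet (radial u) p) : ℝ) : ℂ) := by
    intro p
    rw [willmore_density_eq (hg p).1]
    change evBC p (num u ^ 2 * Sob.ev (Ring.inverse (S u)) ^ 5 * algebraMap ℂ BC (1 / 4) +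
      Sob.ev (S u)) = Complex.ofRealHom _
    have hnump : evBC p (num u) = Complex.ofRealHom (curvatureNumerator (fun i => radial u p i)
        (fun i => pd₁ (radial u) p i) (fun i => pd₂ (radial u) p i)
        (fun i => pd₁ (pd₁ (radial u)) p i) (fun i => pd₁ (pd₂ (radial u)) p i)
        (fun i => pd₂ (pd₂ (radial u)) p i)) := by
      rw [map_curvatureNumerator, map_curvatureNumerator]
      simp only [evBC_ev]
      simp only [hR p, hR.pd₁ p, hR.pd₂ p, hR.pd₁.pd₁ p, hR.pd₂.pd₁ p, hR.pd₂.pd₂ p]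
      rfl
    rw [map_add, map_mul, map_mul, map_pow, map_pow, hnump, evBC_ev, evBC_ev,
      Sob.evAt_inverse hU, (hg p).2]
    change _ * _ * (1 / 4 : ℂ) + _ = _
    simp
  have hint : integralBC (dens u) = ((willmore (radial u) : ℝ) : ℂ) := by
    rw [integralBC_apply, integral_congr_ae (ae_of_all _ key)]
    exact integral_ofReal
  rw [hint, Complex.ofReal_re]

end CWillmore

/-! ### Perturbations of diffeomorphisms of the plane -/

namespace CWillmore

theorem Periodic₂.eq_fract {W : Type*} {u : ℝ × ℝ → W} (h : Periodic₂ u) (x y : ℝ) :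
    u (x, y) = u (Int.fract x, Int.fract y) := by
  have hx : Function.Periodic (fun x => u (x, Int.fract y)) 1 := fun x => (h x _).1
  have hy : Function.Periodic (fun y => u (x, y)) 1 := fun y => (h x y).2
  have e1 := hy.sub_int_mul_eq (x := y) ⌊y⌋
  have e2 := hx.sub_int_mul_eq (x := x) ⌊x⌋
  rw [mul_one] at e1 e2
  exact e1.symm.trans e2.symm

theorem Periodic₂.exists_pos_le {u : ℝ × ℝ → ℝ} (h : Periodic₂ u) (hc : Continuous u)
    (h0 : ∀ p, 0 < u p) : ∃ c > 0, ∀ p, c ≤ u p := by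
  have hK : IsCompact (Icc (0 : ℝ) 1 ×ˢ Icc (0 : ℝ) 1) := isCompact_Icc.prod isCompact_Icc
  obtain ⟨q, -, hq⟩ := hK.exists_isMinOn ⟨(0, 0), by simp⟩ hc.continuousOn
  refine ⟨u q, h0 q, fun ⟨x, y⟩ => ?_⟩
  rw [h.eq_fract x y]
  have hmem : (Int.fract x, Int.fract y) ∈ Icc (0 : ℝ) 1 ×ˢ Icc (0 : ℝ) 1 :=
    ⟨⟨Int.fract_nonneg x, (Int.fract_lt_one x).le⟩, ⟨Int.fract_nonneg y, (Int.fract_lt_one y).le⟩⟩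
  exact hq hmem

/-- The map `(x, y) ↦ x + τ y + v(x, y)` of the plane: a map of tori, compatible with the markings,
from the standard torus to the torus with parameter `τ`. -/
noncomputable def marked (τ : ℂ) (v : Sob 2) (p : ℝ × ℝ) : ℂ :=
  (p.1 : ℂ) + τ * (p.2 : ℂ) + Sob.evAt p v

theorem hasFDerivAt_marked (τ : ℂ) (v : Sob 2) (p : ℝ × ℝ) :
    HasFDerivAt (marked τ v)
      (Sob.gradL (1 + Sob.evAt p (Sob.D₁ v)) (τ + Sob.evAt p (Sob.D₂ v))) p := by
  have h1 : HasFDerivAt (fun p : ℝ × ℝ => (p.1 : ℂ) + τ * (p.2 : ℂ)) (Sob.gradL 1 τ) p := by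
    have : (fun p : ℝ × ℝ => (p.1 : ℂ) + τ * (p.2 : ℂ)) = Sob.gradL 1 τ := by
      funext q; simp [mul_comm]
    rw [this]
    exact (Sob.gradL 1 τ).hasFDerivAt
  refine (h1.add (Sob.hasFDerivAt v p)).congr_fderiv ?_
  ext <;> simp [Sob.evAt_apply]

theorem pd₁_marked (τ : ℂ) (v : Sob 2) (p : ℝ × ℝ) :
    pd₁ (marked τ v) p = 1 + Sob.evAt p (Sob.D₁ v) := by
  rw [pd₁, (hasFDerivAt_marked τ v p).fderiv]
  simp

theorem pd₂_marked (τ : ℂ) (v : Sob 2) (p : ℝ × ℝ) :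
    pd₂ (marked τ v) p = τ + Sob.evAt p (Sob.D₂ v) := by
  rw [pd₂, (hasFDerivAt_marked τ v p).fderiv]
  simp

theorem norm_gradL_le (a b : ℂ) : ‖Sob.gradL a b‖ ≤ ‖a‖ + ‖b‖ := by
  refine ContinuousLinearMap.opNorm_le_bound _ (by positivity) fun q => ?_
  rw [Sob.gradL_apply, add_mul]
  refine (norm_add_le _ _).trans ?_
  rw [norm_smul, norm_smul, mul_comm ‖q.1‖, mul_comm ‖q.2‖]
  gcongr
  · exact norm_fst_le q
  · exact norm_snd_le q

/-- Orientation: the determinant of the linear map with columns `a`, `b`. -/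
def detC (a b : ℂ) : ℝ := a.re * b.im - a.im * b.re

theorem mul_norm_le_norm_gradL {a b : ℂ} {A d : ℝ} (ha : ‖a‖ ≤ A) (hb : ‖b‖ ≤ A)
    (hd0 : 0 ≤ d) (hd : d ≤ detC a b) (q : ℝ × ℝ) : d * ‖q‖ ≤ A * ‖Sob.gradL a b q‖ := by
  set z := Sob.gradL a b q with hz
  have hdet : ∀ z w : ℂ, |detC z w| ≤ ‖z‖ * ‖w‖ := by
    intro z w
    have e : detC z w = ((starRingEnd ℂ) z * w).im := by simp [detC]; ring
    rw [e]
    refine (Complex.abs_im_le_norm _).trans_eq ?_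
    rw [norm_mul, RCLike.norm_conj]
  have hA : 0 ≤ A := (norm_nonneg _).trans ha
  have e1 : detC z b = q.1 * detC a b := by
    rw [hz, Sob.gradL_apply]; simp [detC]; ring
  have e2 : detC a z = q.2 * detC a b := by
    rw [hz, Sob.gradL_apply]; simp [detC]; ring
  have h1 : d * |q.1| ≤ A * ‖z‖ := by
    have := hdet z b
    rw [e1, abs_mul, abs_of_nonneg (hd0.trans hd)] at this
    calc d * |q.1| ≤ detC a b * |q.1| := by gcongr
      _ ≤ ‖z‖ * ‖b‖ := by linarith
      _ ≤ ‖z‖ * A := by gcongr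
      _ = _ := mul_comm _ _
  have h2 : d * |q.2| ≤ A * ‖z‖ := by
    have := hdet a z
    rw [e2, abs_mul, abs_of_nonneg (hd0.trans hd)] at this
    calc d * |q.2| ≤ detC a b * |q.2| := by gcongr
      _ ≤ ‖a‖ * ‖z‖ := by linarith
      _ ≤ A * ‖z‖ := by gcongr
  rcases le_total ‖q.1‖ ‖q.2‖ with h | h
  · rw [Prod.norm_def, max_eq_right h]; exact h2
  · rw [Prod.norm_def, max_eq_left h]; exact h1

/-- A map `ℝ² → ℂ` that is `C¹`-close to a diffeomorphism with uniformly invertible derivative is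
bijective: after composition with the inverse diffeomorphism, it is a perturbation of the identity
by a contraction. -/
theorem bijective_of_close {Φ₀ Φ : ℝ × ℝ → ℂ} (hb : Function.Bijective Φ₀)
    {D₀ D : ℝ × ℝ → ℝ × ℝ →L[ℝ] ℂ} (h₀ : ∀ p, HasFDerivAt Φ₀ (D₀ p) p) (hc : Continuous D₀)
    (h : ∀ p, HasFDerivAt Φ (D p) p) {k ε : ℝ} (hε : ε < k) (hk : ∀ p q, k * ‖q‖ ≤ ‖D₀ p q‖)
    (hD : ∀ p, ‖D p - D₀ p‖ ≤ ε) : Function.Bijective Φ := by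
  have hε0 : 0 ≤ ε := (norm_nonneg _).trans (hD 0)
  have hk0 : 0 < k := hε0.trans_lt hε
  obtain ⟨Ψ, hΨ1, hΨ2⟩ := Function.bijective_iff_has_inverse.1 hb
  have hinj : ∀ p, Function.Injective (D₀ p) := fun p => by
    rw [injective_iff_map_eq_zero]
    intro q hq
    have := hk p q
    rw [hq, norm_zero] at this
    exact norm_le_zero_iff.1 (nonpos_of_mul_nonpos_right this hk0)
  have hfin : Module.finrank ℝ (ℝ × ℝ) = Module.finrank ℝ ℂ := by simp
  let e : ∀ p, (ℝ × ℝ) ≃L[ℝ] ℂ := fun p =>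
    (LinearEquiv.ofInjectiveOfFinrankEq (D₀ p : ℝ × ℝ →ₗ[ℝ] ℂ)
      (hinj p) hfin).toContinuousLinearEquiv
  have he : ∀ p q, e p q = D₀ p q := fun p q => rfl
  have hΨ : ∀ z, HasFDerivAt Ψ ((e (Ψ z)).symm : ℂ →L[ℝ] ℝ × ℝ) z := by
    intro z
    have hs : HasStrictFDerivAt Φ₀ (e (Ψ z) : ℝ × ℝ →L[ℝ] ℂ) (Ψ z) := by
      have h1 := hasStrictFDerivAt_of_hasFDerivAt_of_continuousAt
        (Eventually.of_forall h₀ : ∀ᶠ p in 𝓝 (Ψ z), HasFDerivAt Φ₀ (D₀ p) p) hc.continuousAt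
      exact h1.congr_fderiv (by ext <;> rfl)
    have h2 := hs.to_local_left_inverse (g := Ψ) (Eventually.of_forall hΨ1)
    rw [hΨ2 z] at h2
    exact h2.hasFDerivAt
  have hnorm : ∀ z, ‖((e (Ψ z)).symm : ℂ →L[ℝ] ℝ × ℝ)‖ ≤ k⁻¹ := by
    intro z
    refine ContinuousLinearMap.opNorm_le_bound _ (by positivity) fun x => ?_
    have h1 := hk (Ψ z) ((e (Ψ z)).symm x)
    rw [← he, ContinuousLinearEquiv.apply_symm_apply] at h1
    rw [inv_mul_eq_div, le_div_iff₀ hk0, mul_comm]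
    exact h1
  -- `Φ ∘ Ψ = id + P` with a contraction `P`, so each value `c` is taken at the unique fixed point
  -- of `z ↦ c - P z`
  let P : ℂ → ℂ := fun z => Φ (Ψ z) - z
  have hP : ∀ z, HasFDerivAt P ((D (Ψ z) - D₀ (Ψ z)).comp
      ((e (Ψ z)).symm : ℂ →L[ℝ] ℝ × ℝ)) z := by
    intro z
    refine (((h (Ψ z)).comp z (hΨ z)).sub (hasFDerivAt_id z)).congr_fderiv ?_
    rw [ContinuousLinearMap.sub_comp]
    congr 1
    ext1 x
    change x = D₀ (Ψ z) ((e (Ψ z)).symm x)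
    rw [← he, ContinuousLinearEquiv.apply_symm_apply]
  have hlt : ε * k⁻¹ < 1 := by rwa [← div_eq_mul_inv, div_lt_one hk0]
  have hcontr : ∀ x y, ‖P x - P y‖ ≤ ε * k⁻¹ * ‖x - y‖ := by
    intro x y
    refine convex_univ.norm_image_sub_le_of_norm_hasFDerivWithin_le
      (fun z _ => (hP z).hasFDerivWithinAt) (fun z _ => ?_) (mem_univ y) (mem_univ x)
    refine (ContinuousLinearMap.opNorm_comp_le _ _).trans ?_
    gcongr
    · exact hD _
    · exact hnorm z
  have hcon : ∀ c : ℂ, ContractingWith (Real.toNNReal (ε * k⁻¹)) fun z => c - P z := by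
    intro c
    refine ⟨?_, LipschitzWith.of_dist_le_mul fun x y => ?_⟩
    · rw [← Real.toNNReal_one]
      exact (Real.toNNReal_lt_toNNReal_iff one_pos).2 hlt
    · rw [Real.coe_toNNReal _ (by positivity), dist_eq_norm, dist_eq_norm, sub_sub_sub_cancel_left,
        norm_sub_rev x y]
      exact hcontr y x
  have hfix : ∀ c z, Function.IsFixedPt (fun z => c - P z) z ↔ Φ (Ψ z) = c := by
    intro c z
    simp only [Function.IsFixedPt, P]
    constructor
    · intro h; linear_combination -h
    · intro h; linear_combination -h
  constructor
  · intro p q hpq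
    have h1 : Function.IsFixedPt (fun z => Φ p - P z) (Φ₀ p) := (hfix _ _).2 (by rw [hΨ1])
    have h2 : Function.IsFixedPt (fun z => Φ p - P z) (Φ₀ q) := (hfix _ _).2 (by rw [hΨ1, hpq])
    exact hb.1 ((hcon (Φ p)).fixedPoint_unique' h1 h2)
  · intro c
    exact ⟨Ψ _, (hfix c _).1 (hcon c).fixedPoint_isFixedPt⟩

/-- Let `x`, `y`, `z` be the coefficients of a metric. The linear map with columns `a`, `b` is
conformal and orientation preserving if and only if `b = σ a ≠ 0`, where `σ = (y + i √det) / x`. -/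
theorem conformal_iff {a b : ℂ} {x y z : ℝ} (hx : 0 < x) (hdet : 0 < x * z - y ^ 2) :
    ((∃ r : ℝ, 0 < r ∧ x = r * ⟪a, a⟫ ∧ y = r * ⟪a, b⟫ ∧ z = r * ⟪b, b⟫) ∧ 0 < detC a b) ↔
      a ≠ 0 ∧ b = ((y : ℂ) + Complex.I * (√(x * z - y ^ 2) : ℝ)) * (x : ℂ)⁻¹ * a := by
  have hin : ∀ a b : ℂ, ⟪a, b⟫ = a.re * b.re + a.im * b.im := fun a b => by
    rw [Complex.inner]; simp; ring
  have hxc : (x : ℂ) ≠ 0 := by exact_mod_cast hx.ne'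
  constructor
  · rintro ⟨⟨r, hr, h1, h2, h3⟩, hd⟩
    have ha : a ≠ 0 := fun h => by simp [h, detC] at hd
    refine ⟨ha, ?_⟩
    have hs : √(x * z - y ^ 2) = r * detC a b := by
      rw [← Real.sqrt_sq (mul_pos hr hd).le]
      congr 1
      rw [h1, h2, h3, hin, hin, hin, detC]; ring
    rw [hs]
    have e : (x : ℂ) * b = ((y : ℂ) + Complex.I * (r * detC a b : ℝ)) * a := by
      rw [h1, h2, hin, hin, detC]
      apply Complex.ext <;> simp <;> ring
    field_simp
    rw [mul_comm b, e]
  · rintro ⟨ha, hb⟩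
    set s := √(x * z - y ^ 2) with hs
    have hs0 : 0 < s := Real.sqrt_pos.2 hdet
    have hs2 : s ^ 2 = x * z - y ^ 2 := Real.sq_sqrt hdet.le
    have hn : 0 < a.re ^ 2 + a.im ^ 2 := by
      have := Complex.normSq_pos.2 ha
      rw [Complex.normSq_apply] at this
      nlinarith
    have e : b = (((y / x : ℝ) : ℂ) + Complex.I * ((s / x : ℝ) : ℂ)) * a := by
      rw [hb]; push_cast; field_simp
    have hre : b.re = y / x * a.re - s / x * a.im := by rw [e]; simp
    have him : b.im = y / x * a.im + s / x * a.re := by rw [e]; simp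
    refine ⟨⟨x / (a.re ^ 2 + a.im ^ 2), by positivity, ?_, ?_, ?_⟩, ?_⟩
    · rw [hin]; field_simp
    · rw [hin, hre, him]; field_simp; ring
    · rw [hin, hre, him]
      have : z = (y ^ 2 + s ^ 2) / x := by rw [hs2]; field_simp; ring_nf
      rw [this]; field_simp; ring
    · rw [detC, hre, him]
      have : a.re * (y / x * a.im + s / x * a.re) - a.im * (y / x * a.re - s / x * a.im) =
          s / x * (a.re ^ 2 + a.im ^ 2) := by ring
      rw [this]; positivity

end CWillmore

/-! ### The Beltrami-type equation -/

namespace CWillmore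

namespace Sob

/-- The symbol of the inverse of the operator `∂₂ - i M ∂₁` on functions of mean zero. -/
noncomputable def parametrixSymbol (M : ℝ) (n : ℤ × ℤ) : ℂ :=
  if n = 0 then 0 else (2 * Real.pi * Complex.I * (n.2 - Complex.I * M * n.1))⁻¹

theorem abs_le_norm_elliptic (M : ℝ) (n : ℤ × ℤ) :
    |(n.2 : ℝ)| ≤ ‖(n.2 - Complex.I * M * n.1 : ℂ)‖ ∧
      |M * n.1| ≤ ‖(n.2 - Complex.I * M * n.1 : ℂ)‖ := by
  refine ⟨?_, ?_⟩
  · simpa using Complex.abs_re_le_norm (n.2 - Complex.I * M * n.1 : ℂ)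
  · simpa using Complex.abs_im_le_norm (n.2 - Complex.I * M * n.1 : ℂ)

theorem elliptic_ne_zero {M : ℝ} (hM : 1 ≤ M) {n : ℤ × ℤ} (hn : n ≠ 0) :
    (n.2 - Complex.I * M * n.1 : ℂ) ≠ 0 := by
  intro h
  obtain ⟨h1, h2⟩ := abs_le_norm_elliptic M n
  rw [h, norm_zero] at h1 h2
  have e2 : (n.2 : ℝ) = 0 := abs_nonpos_iff.1 h1
  have e1 : M * n.1 = 0 := abs_nonpos_iff.1 h2
  have e3 : (n.1 : ℝ) = 0 := (mul_eq_zero.1 e1).resolve_left (by linarith)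
  exact hn (Prod.ext (by exact_mod_cast e3) (by exact_mod_cast e2))

theorem symbol_mul_parametrix {M : ℝ} (hM : 1 ≤ M) {n : ℤ × ℤ} (hn : n ≠ 0) :
    2 * Real.pi * Complex.I * (n.2 - Complex.I * M * n.1) * parametrixSymbol M n = 1 := by
  rw [parametrixSymbol, if_neg hn]
  exact mul_inv_cancel₀ (mul_ne_zero (by simp [Real.pi_ne_zero]) (elliptic_ne_zero hM hn))

theorem norm_parametrix_le {M : ℝ} (hM : 1 ≤ M) (n : ℤ × ℤ) :
    wt n * ‖parametrixSymbol M n‖ ≤ 4 := by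
  by_cases hn : n = 0
  · simp [parametrixSymbol, hn]
  obtain ⟨h1, h2⟩ := abs_le_norm_elliptic M n
  set E := ‖(n.2 - Complex.I * M * n.1 : ℂ)‖ with hE
  have hE0 : 0 < E := norm_pos_iff.2 (elliptic_ne_zero hM hn)
  have h3 : |(n.1 : ℝ)| ≤ E := by
    rw [abs_mul, abs_of_nonneg (by linarith : (0 : ℝ) ≤ M)] at h2
    nlinarith [abs_nonneg (n.1 : ℝ)]
  have h4 : 1 ≤ |(n.1 : ℝ)| + |(n.2 : ℝ)| := by
    by_contra hlt
    push Not at hlt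
    have a1 : |n.1| < 1 := by
      have : |(n.1 : ℝ)| < 1 := by linarith [abs_nonneg (n.2 : ℝ)]
      exact_mod_cast this
    have a2 : |n.2| < 1 := by
      have : |(n.2 : ℝ)| < 1 := by linarith [abs_nonneg (n.1 : ℝ)]
      exact_mod_cast this
    exact hn (Prod.ext (Int.abs_lt_one_iff.1 a1) (Int.abs_lt_one_iff.1 a2))
  rw [parametrixSymbol, if_neg hn, norm_inv, norm_mul, norm_two_pi_I, ← hE,
    ← div_eq_mul_inv, div_le_iff₀ (by positivity)]
  unfold wt
  nlinarith [Real.pi_gt_three]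

/-- The inverse of the operator `∂₂ - i M ∂₁` on functions of mean zero. -/
noncomputable def parametrix {M : ℝ} (hM : 1 ≤ M) : Sob 1 →L[ℂ] Sob 2 :=
  multiplier (parametrixSymbol M) (sobConst 2 / sobConst 1 * 4)
    (by have := sobConst_pos 1; have := sobConst_pos 2; positivity) fun n => by
      have h1 := sobConst_pos 1
      have h2 := sobConst_pos 2
      have h3 := wt_pos n
      rw [norm_mul, norm_mul, Complex.norm_real, Complex.norm_real,
        Real.norm_of_nonneg (sobWeight_pos 2 n).le,
        Real.norm_of_nonneg (inv_nonneg.2 (sobWeight_pos _ n).le)]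
      calc sobWeight 2 n * ‖parametrixSymbol M n‖ * (sobWeight 1 n)⁻¹
          = sobConst 2 / sobConst 1 * (wt n * ‖parametrixSymbol M n‖) := by
            rw [sobWeight, sobWeight]; field_simp; ring
        _ ≤ _ := by gcongr; exact norm_parametrix_le hM n

theorem coef_parametrix {M : ℝ} (hM : 1 ≤ M) (u : Sob 1) (n : ℤ × ℤ) :
    coef (parametrix hM u) n = parametrixSymbol M n * coef u n :=
  coef_multiplier _ _ _ _ u n

theorem coef_D₁_parametrix {M : ℝ} (hM : 1 ≤ M) (u : Sob 1) (n : ℤ × ℤ) :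
    coef (D₁ (parametrix hM u)) n =
      (2 * Real.pi * Complex.I * n.1 * parametrixSymbol M n) * coef u n := by
  rw [coef_D₁, coef_parametrix]; ring

/-- The constant matters: if `σ` takes values in the upper half plane, then `|σ - i M|` is less than
`M` for large `M`, but only slightly. -/
theorem norm_D₁_parametrix_le {M : ℝ} (hM : 1 ≤ M) (n : ℤ × ℤ) :
    ‖(2 * Real.pi * Complex.I * n.1 * parametrixSymbol M n : ℂ)‖ ≤ M⁻¹ := by
  have hM0 : 0 < M := by linarith
  by_cases hn : n = 0
  · simp only [hn, parametrixSymbol, if_true, mul_zero, norm_zero]; positivity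
  have hE0 : 0 < ‖(n.2 - Complex.I * M * n.1 : ℂ)‖ := norm_pos_iff.2 (elliptic_ne_zero hM hn)
  have h2 := (abs_le_norm_elliptic M n).2
  rw [abs_mul, abs_of_pos hM0] at h2
  have e1 : ‖(2 * Real.pi * Complex.I * n.1 : ℂ)‖ = 2 * Real.pi * |(n.1 : ℝ)| := by
    rw [norm_mul, norm_two_pi_I, Complex.norm_intCast]
  rw [parametrixSymbol, if_neg hn, norm_mul, e1, norm_inv, norm_mul, norm_two_pi_I,
    ← div_eq_mul_inv, div_le_iff₀ (by positivity), inv_mul_eq_div, le_div_iff₀ hM0]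
  nlinarith [Real.pi_pos]

/-- Every function is its mean plus `∂₂ v - i M ∂₁ v`, where `v` is given by the parametrix. -/
theorem parametrix_identity {M : ℝ} (hM : 1 ≤ M) (w : Sob 1) :
    algebraMap ℂ (Sob 1) (coef w 0) + D₂ (parametrix hM w) -
      (Complex.I * M) • D₁ (parametrix hM w) = w := by
  refine ext_coef fun n => ?_
  rw [coef_sub, coef_add, coef_smul, coef_algebraMap, coef_D₁, coef_D₂, coef_parametrix]
  by_cases hn : n = 0
  · simp [hn]
  · rw [if_neg hn]
    linear_combination (coef w n) * symbol_mul_parametrix hM hn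

/-- The parametrix recovers the derivatives of `v` from `τ + ∂₂ v - i M ∂₁ v`. -/
theorem parametrix_apply {M : ℝ} (hM : 1 ≤ M) (τ : ℂ) (v : Sob 2) :
    coef (algebraMap ℂ (Sob 1) τ + D₂ v - (Complex.I * M) • D₁ v) 0 = τ ∧
    D₁ (parametrix hM (algebraMap ℂ (Sob 1) τ + D₂ v - (Complex.I * M) • D₁ v)) = D₁ v ∧
    D₂ (parametrix hM (algebraMap ℂ (Sob 1) τ + D₂ v - (Complex.I * M) • D₁ v)) = D₂ v := by
  have hc : ∀ n, coef (algebraMap ℂ (Sob 1) τ + D₂ v - (Complex.I * M) • D₁ v) n =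
      (if n = 0 then τ else 0) +
        2 * Real.pi * Complex.I * (n.2 - Complex.I * M * n.1) * coef v n := fun n => by
    rw [coef_sub, coef_add, coef_smul, coef_algebraMap, coef_D₁, coef_D₂]; ring
  refine ⟨?_, ext_coef fun n => ?_, ext_coef fun n => ?_⟩
  · rw [hc]; simp
  · rw [coef_D₁, coef_D₁, coef_parametrix, hc]
    by_cases hn : n = 0
    · simp [hn]
    · rw [if_neg hn]
      linear_combination (2 * Real.pi * Complex.I * n.1 * coef v n) * symbol_mul_parametrix hM hn
  · rw [coef_D₂, coef_D₂, coef_parametrix, hc]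
    by_cases hn : n = 0
    · simp [hn]
    · rw [if_neg hn]
      linear_combination (2 * Real.pi * Complex.I * n.2 * coef v n) * symbol_mul_parametrix hM hn

/-- The operator of the Beltrami-type equation `∂₂Φ = σ ∂₁Φ`, composed with the parametrix: the map
`Φ = x + τ y + v` solves the equation if and only if `w = τ + ∂₂ v - i M ∂₁ v` is mapped to `σ`. By
definition it is `1 - (σ - i M) R`, where `R` is the Fourier multiplier `∂₁ (∂₂ - i M ∂₁)⁻¹`. -/
noncomputable def beltrami {M : ℝ} (hM : 1 ≤ M) (σ : Sob 1) : Sob 1 →L[ℝ] Sob 1 :=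
  1 - (ContinuousLinearMap.mul ℝ (Sob 1) (σ - algebraMap ℂ (Sob 1) (Complex.I * M))).comp
    ((D₁.comp (parametrix hM)).restrictScalars ℝ)

theorem beltrami_apply {M : ℝ} (hM : 1 ≤ M) (σ w : Sob 1) :
    beltrami hM σ w = algebraMap ℂ (Sob 1) (coef w 0) + D₂ (parametrix hM w) -
      σ * D₁ (parametrix hM w) := by
  have h := parametrix_identity hM w
  change w - (σ - algebraMap ℂ (Sob 1) (Complex.I * M)) * D₁ (parametrix hM w) = _
  rw [Algebra.smul_def] at h
  linear_combination -h

theorem beltrami_apply_eq {M : ℝ} (hM : 1 ≤ M) (σ : Sob 1) (τ : ℂ) (v : Sob 2) :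
    beltrami hM σ (algebraMap ℂ (Sob 1) τ + D₂ v - (Complex.I * M) • D₁ v) =
      algebraMap ℂ (Sob 1) τ + D₂ v - σ * D₁ v := by
  obtain ⟨h1, h2, h3⟩ := parametrix_apply hM τ v
  rw [beltrami_apply, h1, h2, h3]

/-- The operator of the Beltrami-type equation is invertible if `σ` is smooth with values in the
upper half plane: for large `M`, the values lie in a disc around `i M` of radius less than `M`. -/
theorem exists_isUnit_beltrami {σ : Sob 1} (hσ : ContDiff ℝ (⊤ : ℕ∞) (ev σ)) {c : ℝ} (hc : 0 < c)
    (him : ∀ p, c ≤ (evAt p σ).im) : ∃ (M : ℝ) (hM : 1 ≤ M), IsUnit (beltrami hM σ) := by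
  set A := ‖ev σ‖ with hA
  have hA0 : 0 ≤ A := norm_nonneg _
  set M := max (max 1 c) (A ^ 2 / c) with hMdef
  have hM : 1 ≤ M := (le_max_left _ _).trans (le_max_left _ _)
  have hMc : c ≤ M := (le_max_right _ _).trans (le_max_left _ _)
  have hMA : A ^ 2 ≤ M * c := (div_le_iff₀ hc).1 (le_max_right _ _)
  have hM0 : 0 < M := by linarith
  refine ⟨M, hM, ?_⟩
  set s := σ - algebraMap ℂ (Sob 1) (Complex.I * M) with hs
  have hsp : ∀ p, ev s p = ev σ p - Complex.I * M := fun p => by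
    rw [hs, map_sub, AlgHom.commutes]; rfl
  obtain ⟨s', hs'⟩ := exists_of_contDiff 3 (u := ev s) s.periodic (by
    rw [show ⇑(ev s) = fun p => ev σ p - Complex.I * M from funext hsp]
    exact hσ.sub contDiff_const)
  have hsum : Summable fun n => wt n ^ 3 * ‖coef s n‖ := by
    have := summable_wt_coef s'
    simpa only [coef, hs'] using this
  refine isUnit_one_sub_mul_multiplier s (q := √(M ^ 2 - M * c)) (μ := M⁻¹) (fun p => ?_) hsum _ _
    (fun u n => coef_D₁_parametrix hM u n) (norm_D₁_parametrix_le hM) ?_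
  · refine Real.le_sqrt_of_sq_le ?_
    have h1 : ‖ev σ p‖ ^ 2 ≤ A ^ 2 := by
      have := (ev σ).norm_coe_le_norm p
      gcongr
    have h2 := him p
    rw [evAt_apply] at h2
    -- `|σ - i M|² = |σ|² - 2 M Im σ + M² ≤ M² - M c`, since `|σ|² ≤ M c ≤ M Im σ`
    rw [hsp, ← Complex.normSq_eq_norm_sq, Complex.normSq_apply]
    rw [← Complex.normSq_eq_norm_sq, Complex.normSq_apply] at h1
    simp only [Complex.sub_re, Complex.sub_im, Complex.mul_re, Complex.mul_im, Complex.I_re,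
      Complex.I_im, Complex.ofReal_re, Complex.ofReal_im]
    nlinarith
  · rw [← div_eq_mul_inv, div_lt_one hM0, Real.sqrt_lt' hM0]
    have : 0 < M * c := by positivity
    linarith

end Sob

end CWillmore

/-! ### Smoothness of the projection to Teichmüller space -/

namespace CWillmore

/-- The complex structure of the induced metric, as a point of the upper half plane: a map `Φ` to
`ℂ` is conformal and orientation preserving where `∂₂Φ = σ ∂₁Φ ≠ 0`. -/
noncomputable def complexStructure (F : ℝ × ℝ → E4) (p : ℝ × ℝ) : ℂ :=
  ((g₁₂ F p : ℂ) + Complex.I * (√(gdet F p) : ℝ)) * (g₁₁ F p : ℂ)⁻¹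

/-- The complex structure depends smoothly on the immersion. -/
theorem exists_complexStructure {f : W42 E4} (hf : IsSmoothImmersion f) :
    ∃ σ : W42 E4 → Sob 1, ContDiffAt ℝ 2 σ f ∧ ∀ᶠ u : W42 E4 in 𝓝 f,
      (∀ p, 0 < gdet (radial u) p ∧ 0 < g₁₁ (radial u) p) ∧
      ∀ p, Sob.evAt p (σ u) = complexStructure (radial u) p := by
  obtain ⟨N, S, hN, hS, hev⟩ := exists_metric hf
  have hD1 : ∀ i, ContDiffAt ℝ 2 (fun u => Sob.D₁ (N u i)) f := fun i =>
    ((Sob.D₁ (j := 1)).restrictScalars ℝ).contDiff.contDiffAt.comp f (hN i)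
  have hD2 : ∀ i, ContDiffAt ℝ 2 (fun u => Sob.D₂ (N u i)) f := fun i =>
    ((Sob.D₂ (j := 1)).restrictScalars ℝ).contDiff.contDiffAt.comp f (hN i)
  let G₁₁ : W42 E4 → Sob 1 := fun u => dot (fun i => Sob.D₁ (N u i)) (fun i => Sob.D₁ (N u i))
  let G₁₂ : W42 E4 → Sob 1 := fun u => dot (fun i => Sob.D₁ (N u i)) (fun i => Sob.D₂ (N u i))
  have hG11 : ContDiffAt ℝ 2 G₁₁ f := ContDiffAt.dot hD1 hD1
  have hG12 : ContDiffAt ℝ 2 G₁₂ f := ContDiffAt.dot hD1 hD2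
  have hinv : ContDiffAt ℝ 2 (fun u => Ring.inverse (G₁₁ u)) f := by
    obtain ⟨v, hv⟩ := hev.self_of_nhds.2.2.1
    have : ContDiffAt ℝ 2 Ring.inverse (G₁₁ f) := by
      change ContDiffAt ℝ 2 Ring.inverse (dot _ _)
      rw [← hv]; exact contDiffAt_ringInverse ℝ v
    exact ContDiffAt.comp (g := Ring.inverse) f this hG11
  refine ⟨fun u => (G₁₂ u + algebraMap ℂ (Sob 1) Complex.I * S u) * Ring.inverse (G₁₁ u),
    (hG12.add (contDiffAt_const.mul hS)).mul hinv, ?_⟩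
  filter_upwards [hev] with u hu
  obtain ⟨hR, hU, hU11, hg⟩ := hu
  refine ⟨fun p => ⟨(hg p).1, g₁₁_pos_of_gdet_pos (hg p).1⟩, fun p => ?_⟩
  have hI : Sob.evAt p (algebraMap ℂ (Sob 1) Complex.I) = Complex.I := by
    rw [Sob.evAt_apply, AlgHom.commutes]; rfl
  rw [map_mul, map_add, map_mul, hI, Sob.evAt_inverse hU11, (hg p).2,
    evAt_dot hR.pd₁ hR.pd₂, evAt_dot hR.pd₁ hR.pd₁, ← g₁₁_eq, ← g₁₂_eq]
  rfl

/-- For the complex structure of a smooth immersion, the Beltrami-type equation is uniquely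
solvable. -/
theorem exists_isUnit_beltrami_complexStructure {f : ℝ × ℝ → E4} (hf : IsSmoothImmersion f)
    {σ : Sob 1} (hpos : ∀ p, 0 < gdet f p ∧ 0 < g₁₁ f p)
    (hval : ∀ p, Sob.evAt p σ = complexStructure f p) :
    ∃ (M : ℝ) (hM : 1 ≤ M), IsUnit (Sob.beltrami hM σ) := by
  obtain ⟨hper, hsm, -, -⟩ := hf
  have hc1 := contDiff_pd₁ hsm
  have hc2 := contDiff_pd₂ hsm
  have c11 : ContDiff ℝ (⊤ : ℕ∞) (g₁₁ f) := hc1.inner ℝ hc1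
  have c12 : ContDiff ℝ (⊤ : ℕ∞) (g₁₂ f) := hc1.inner ℝ hc2
  have cdet : ContDiff ℝ (⊤ : ℕ∞) (fun p => √(gdet f p)) :=
    (((hc1.inner ℝ hc1).mul (hc2.inner ℝ hc2)).sub ((hc1.inner ℝ hc2).pow 2)).sqrt
      fun p => (hpos p).1.ne'
  have hp1 := hper.pd₁
  have hp2 := hper.pd₂
  obtain ⟨c, hc0, hc⟩ := Periodic₂.exists_pos_le (u := fun p => √(gdet f p) / g₁₁ f p)
    (fun x y => by
      simp only [gdet, g₁₁, g₁₂, g₂₂, (hp1 x y).1, (hp1 x y).2, (hp2 x y).1, (hp2 x y).2,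
        and_self])
    (cdet.continuous.div c11.continuous fun p => (hpos p).2.ne')
    (fun p => div_pos (Real.sqrt_pos.2 (hpos p).1) (hpos p).2)
  refine Sob.exists_isUnit_beltrami ?_ hc0 fun p => ?_
  · rw [show ⇑(Sob.ev σ) = complexStructure f from funext hval]
    unfold complexStructure
    refine ContDiff.mul ?_ (ContDiff.inv (Complex.ofRealCLM.contDiff.comp c11) fun p => ?_)
    · exact (Complex.ofRealCLM.contDiff.comp c12).add
        (contDiff_const.mul (Complex.ofRealCLM.contDiff.comp cdet))
    · exact_mod_cast (hpos p).2.ne'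
  · refine (hc p).trans_eq ?_
    rw [hval, complexStructure, ← Complex.ofReal_inv, Complex.im_mul_ofReal]
    simp [div_eq_mul_inv]

/-- A conformal class is a solution `Φ = marked τ v` of the Beltrami-type equation
`∂₂Φ = σ ∂₁Φ`. -/
theorem hasConformalClass_iff {F : ℝ × ℝ → E4} (hpos : ∀ p, 0 < gdet F p ∧ 0 < g₁₁ F p)
    {σ : Sob 1} (hval : ∀ p, Sob.evAt p σ = complexStructure F p) {τ : ℂ} :
    HasConformalClass F τ ↔ 0 < τ.im ∧ ∃ v : Sob 2, Function.Bijective (marked τ v) ∧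
      (∀ p, 1 + Sob.evAt p (Sob.D₁ v) ≠ 0) ∧
      algebraMap ℂ (Sob 1) τ + Sob.D₂ v - σ * Sob.D₁ v = σ := by
  have key : ∀ v : Sob 2, ((∀ p, 0 < detC (pd₁ (marked τ v) p) (pd₂ (marked τ v) p)) ∧
      ∀ p, ∃ r : ℝ, 0 < r ∧ g₁₁ F p = r * ⟪pd₁ (marked τ v) p, pd₁ (marked τ v) p⟫ ∧
        g₁₂ F p = r * ⟪pd₁ (marked τ v) p, pd₂ (marked τ v) p⟫ ∧
        g₂₂ F p = r * ⟪pd₂ (marked τ v) p, pd₂ (marked τ v) p⟫) ↔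
      (∀ p, 1 + Sob.evAt p (Sob.D₁ v) ≠ 0) ∧
        algebraMap ℂ (Sob 1) τ + Sob.D₂ v - σ * Sob.D₁ v = σ := by
    intro v
    have hp := fun p => conformal_iff (a := pd₁ (marked τ v) p) (b := pd₂ (marked τ v) p)
      (hpos p).2 (hpos p).1
    have heq : algebraMap ℂ (Sob 1) τ + Sob.D₂ v - σ * Sob.D₁ v = σ ↔
        ∀ p, pd₂ (marked τ v) p = complexStructure F p * pd₁ (marked τ v) p := by
      have h1 : ∀ p, Sob.evAt p (algebraMap ℂ (Sob 1) τ + Sob.D₂ v - σ * Sob.D₁ v) =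
          τ + Sob.evAt p (Sob.D₂ v) - complexStructure F p * Sob.evAt p (Sob.D₁ v) := fun p => by
        have hconst : Sob.evAt p (algebraMap ℂ (Sob 1) τ) = τ := by
          rw [Sob.evAt_apply, AlgHom.commutes]; rfl
        rw [map_sub, map_add, map_mul, hconst, hval]
      constructor
      · intro h p
        have h2 := h1 p
        rw [h, hval] at h2
        rw [pd₁_marked, pd₂_marked]
        linear_combination -h2
      · intro h
        refine Sob.ext_evAt fun p => ?_
        have h2 := h p
        rw [pd₁_marked, pd₂_marked] at h2
        rw [h1, hval]
        linear_combination h2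
    rw [heq]
    constructor
    · rintro ⟨h1, h2⟩
      have h3 := fun p => (hp p).1 ⟨h2 p, h1 p⟩
      refine ⟨fun p => ?_, fun p => (h3 p).2⟩
      rw [← pd₁_marked τ]
      exact (h3 p).1
    · rintro ⟨h1, h2⟩
      have h3 := fun p => (hp p).2 ⟨by rw [pd₁_marked]; exact h1 p, h2 p⟩
      exact ⟨fun p => (h3 p).2, fun p => (h3 p).1⟩
  constructor
  · rintro ⟨h0, Φ, ⟨v, hv⟩, h1, h2, h3⟩
    have e : Φ = marked τ (toSob (ContinuousLinearMap.id ℝ ℂ) v) := by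
      funext p
      rw [hv, marked, Sob.evAt_apply, ev_toSob]
      rfl
    rw [e] at h1 h2 h3
    exact ⟨h0, _, h1, (key _).1 ⟨h2, h3⟩⟩
  · rintro ⟨h0, v, h1, h2⟩
    obtain ⟨h3, h4⟩ := (key v).2 h2
    obtain ⟨w, hw⟩ := exists_W42_of_sob (ContinuousLinearMap.id ℝ ℂ) v
    exact ⟨h0, marked τ v, ⟨w, fun p => by rw [hw]; rfl⟩, h1, h3, h4⟩

theorem detC_marked_pos {F : ℝ × ℝ → E4} {σ : Sob 1} (hpos : ∀ p, 0 < gdet F p ∧ 0 < g₁₁ F p)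
    (hval : ∀ p, Sob.evAt p σ = complexStructure F p) {τ : ℂ} {v : Sob 2}
    (h1 : ∀ p, 1 + Sob.evAt p (Sob.D₁ v) ≠ 0)
    (h2 : algebraMap ℂ (Sob 1) τ + Sob.D₂ v - σ * Sob.D₁ v = σ) (p : ℝ × ℝ) :
    0 < detC (1 + Sob.evAt p (Sob.D₁ v)) (τ + Sob.evAt p (Sob.D₂ v)) := by
  refine ((conformal_iff (hpos p).2 (hpos p).1).2 ⟨h1 p, ?_⟩).2
  have h3 := congrArg (Sob.evAt p) h2
  have hconst : Sob.evAt p (algebraMap ℂ (Sob 1) τ) = τ := by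
    rw [Sob.evAt_apply, AlgHom.commutes]; rfl
  rw [map_sub, map_add, map_mul, hconst, hval] at h3
  change _ = complexStructure F p * _
  linear_combination h3

theorem continuous_evAt {j : ℕ} (v : Sob j) : Continuous fun p => Sob.evAt p v :=
  (Sob.ev v).continuous

/-- The derivative of an orientation preserving local diffeomorphism `marked τ v` is uniformly
invertible. -/
theorem exists_mul_norm_le_norm_gradL {τ : ℂ} {v : Sob 2}
    (hdet : ∀ p, 0 < detC (1 + Sob.evAt p (Sob.D₁ v)) (τ + Sob.evAt p (Sob.D₂ v))) :
    ∃ k > 0, ∀ p q, k * ‖q‖ ≤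
      ‖Sob.gradL (1 + Sob.evAt p (Sob.D₁ v)) (τ + Sob.evAt p (Sob.D₂ v)) q‖ := by
  have hcd : Continuous fun p =>
      detC (1 + Sob.evAt p (Sob.D₁ v)) (τ + Sob.evAt p (Sob.D₂ v)) := by
    have h1 : Continuous fun p => 1 + Sob.evAt p (Sob.D₁ v) :=
      continuous_const.add (continuous_evAt _)
    have h2 : Continuous fun p => τ + Sob.evAt p (Sob.D₂ v) :=
      continuous_const.add (continuous_evAt _)
    exact ((Complex.continuous_re.comp h1).mul (Complex.continuous_im.comp h2)).sub
      ((Complex.continuous_im.comp h1).mul (Complex.continuous_re.comp h2))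
  obtain ⟨d, hd0, hd⟩ := Periodic₂.exists_pos_le (u := fun p =>
    detC (1 + Sob.evAt p (Sob.D₁ v)) (τ + Sob.evAt p (Sob.D₂ v))) (fun x y => by
      simp only [Sob.evAt_apply, ((Sob.D₁ v).periodic x y).1, ((Sob.D₁ v).periodic x y).2,
        ((Sob.D₂ v).periodic x y).1, ((Sob.D₂ v).periodic x y).2, and_self]) hcd hdet
  set A := 1 + ‖τ‖ + ‖Sob.ev (Sob.D₁ v)‖ + ‖Sob.ev (Sob.D₂ v)‖ with hA
  have n1 := norm_nonneg τ
  have n2 := norm_nonneg (Sob.ev (Sob.D₁ v))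
  have n3 := norm_nonneg (Sob.ev (Sob.D₂ v))
  have hA0 : 0 < A := by linarith
  refine ⟨d / A, by positivity, fun p q => ?_⟩
  have ha : ‖1 + Sob.evAt p (Sob.D₁ v)‖ ≤ A := by
    have h1 := norm_add_le 1 (Sob.evAt p (Sob.D₁ v))
    have h2 : ‖Sob.evAt p (Sob.D₁ v)‖ ≤ _ := (Sob.ev (Sob.D₁ v)).norm_coe_le_norm p
    rw [norm_one] at h1
    linarith
  have hb : ‖τ + Sob.evAt p (Sob.D₂ v)‖ ≤ A := by
    have h1 := norm_add_le τ (Sob.evAt p (Sob.D₂ v))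
    have h2 : ‖Sob.evAt p (Sob.D₂ v)‖ ≤ _ := (Sob.ev (Sob.D₂ v)).norm_coe_le_norm p
    linarith
  have := mul_norm_le_norm_gradL ha hb hd0.le (hd p) q
  rw [div_mul_eq_mul_div, div_le_iff₀ hA0]
  linarith

/-- Small perturbations of a diffeomorphism `marked τ₀ v₀` are bijective immersions. -/
theorem bijective_marked_of_close {τ₀ τ : ℂ} {v₀ v : Sob 2} (hb : Function.Bijective (marked τ₀ v₀))
    {k : ℝ} (hk0 : 0 < k) (hk : ∀ p q, k * ‖q‖ ≤
      ‖Sob.gradL (1 + Sob.evAt p (Sob.D₁ v₀)) (τ₀ + Sob.evAt p (Sob.D₂ v₀)) q‖)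
    (h0 : ‖τ - τ₀‖ < k / 4)
    (h1 : ∀ p, ‖Sob.evAt p (Sob.D₁ v) - Sob.evAt p (Sob.D₁ v₀)‖ < k / 4)
    (h2 : ∀ p, ‖Sob.evAt p (Sob.D₂ v) - Sob.evAt p (Sob.D₂ v₀)‖ < k / 4) :
    Function.Bijective (marked τ v) ∧ ∀ p, 1 + Sob.evAt p (Sob.D₁ v) ≠ 0 := by
  refine ⟨bijective_of_close hb (hasFDerivAt_marked τ₀ v₀) ?_ (hasFDerivAt_marked τ v)
    (by linarith : 3 * k / 4 < k) hk fun p => ?_, fun p h => ?_⟩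
  · exact Sob.gradLL.continuous.comp ((continuous_const.add (continuous_evAt (Sob.D₁ v₀))).prodMk
      (continuous_const.add (continuous_evAt (Sob.D₂ v₀))))
  -- the three errors add up to less than `3k/4`
  · have e : Sob.gradL (1 + Sob.evAt p (Sob.D₁ v)) (τ + Sob.evAt p (Sob.D₂ v)) -
        Sob.gradL (1 + Sob.evAt p (Sob.D₁ v₀)) (τ₀ + Sob.evAt p (Sob.D₂ v₀)) =
        Sob.gradL (Sob.evAt p (Sob.D₁ v) - Sob.evAt p (Sob.D₁ v₀))
          ((τ - τ₀) + (Sob.evAt p (Sob.D₂ v) - Sob.evAt p (Sob.D₂ v₀))) := by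
      ext <;> simp; ring
    rw [e]
    refine (norm_gradL_le _ _).trans ?_
    have := norm_add_le (τ - τ₀) (Sob.evAt p (Sob.D₂ v) - Sob.evAt p (Sob.D₂ v₀))
    linarith [h1 p, h2 p]
  · have h3 := hk p (1, 0)
    rw [Sob.gradL_apply] at h3
    have h4 : ‖((1 : ℝ), (0 : ℝ))‖ = 1 := by simp [Prod.norm_def]
    rw [h4, one_smul, zero_smul, add_zero, mul_one] at h3
    have h5 := h1 p
    have h6 : Sob.evAt p (Sob.D₁ v) = -1 := by linear_combination h
    rw [h6, norm_sub_rev, sub_neg_eq_add, add_comm] at h5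
    linarith

theorem contDiffAt_beltrami {X : Type*} [NormedAddCommGroup X] [NormedSpace ℝ X] {M : ℝ}
    (hM : 1 ≤ M) {σ : X → Sob 1} {x : X} (hσ : ContDiffAt ℝ 2 σ x) :
    ContDiffAt ℝ 2 (fun u => Sob.beltrami hM (σ u)) x :=
  contDiffAt_const.sub (((ContinuousLinearMap.mul ℝ (Sob 1)).contDiff.contDiffAt.comp x
    (hσ.sub contDiffAt_const)).clm_comp contDiffAt_const)

/-- Near a smooth immersion with a conformal class, all immersions have a unique conformal class,
which depends smoothly on the immersion: the equation for the conformal diffeomorphism and the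
conformal class is linear, and uniquely solvable for small perturbations of the metric. -/
theorem exists_contDiffAt_conformalClass {f : W42 E4} (hf : IsSmoothImmersion f) {τ₀ : ℂ}
    (hτ : HasConformalClass f τ₀) : ∃ T : W42 E4 → ℂ, ContDiffAt ℝ 2 T f ∧
      ∀ᶠ u : W42 E4 in 𝓝 f, HasConformalClass (radial u) (T u) ∧
        ∀ τ, HasConformalClass (radial u) τ → τ = T u := by
  obtain ⟨σ, hσ, hσp⟩ := exists_complexStructure hf
  have hrf : radial f = f := radial_of_norm_eq_one hf.2.2.1
  obtain ⟨hpos₀, hval₀⟩ := hσp.self_of_nhds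
  rw [hrf] at hpos₀ hval₀
  obtain ⟨M, hM, hunit⟩ := exists_isUnit_beltrami_complexStructure hf hpos₀ hval₀
  have hB : ContDiffAt ℝ 2 (fun u => Sob.beltrami hM (σ u)) f := contDiffAt_beltrami hM hσ
  have hBu : ∀ᶠ u in 𝓝 f, IsUnit (Sob.beltrami hM (σ u)) := by
    obtain ⟨U, hU⟩ := hunit
    refine hB.continuousAt.tendsto.eventually ?_
    rw [← hU]
    exact Units.nhds U
  -- `w = τ + ∂₂ v - i M ∂₁ v` encodes the conformal class `τ`, its mean, and the diffeomorphism
  obtain ⟨w, hwdef⟩ : ∃ w : W42 E4 → Sob 1,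
    w = fun u => Ring.inverse (Sob.beltrami hM (σ u)) (σ u) := ⟨_, rfl⟩
  have hw : ContDiffAt ℝ 2 w f := by
    obtain ⟨U, hU⟩ := hunit
    have h1 : ContDiffAt ℝ 2 Ring.inverse (Sob.beltrami hM (σ f)) := by
      rw [← hU]; exact contDiffAt_ringInverse ℝ U
    rw [hwdef]
    exact (ContDiffAt.comp (g := Ring.inverse) f h1 hB).clm_apply hσ
  have hwu : ∀ u, IsUnit (Sob.beltrami hM (σ u)) → Sob.beltrami hM (σ u) (w u) = σ u := by
    intro u hu
    rw [hwdef]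
    exact DFunLike.congr_fun (Ring.mul_inverse_cancel _ hu) (σ u)
  have hwu' : ∀ u, IsUnit (Sob.beltrami hM (σ u)) → ∀ x, Sob.beltrami hM (σ u) x = σ u →
      x = w u := by
    intro u hu x hx
    have h := DFunLike.congr_fun (Ring.inverse_mul_cancel _ hu) x
    change Ring.inverse (Sob.beltrami hM (σ u)) (Sob.beltrami hM (σ u) x) = x at h
    rw [hx] at h
    rw [hwdef]
    exact h.symm
  obtain ⟨T, hTdef⟩ : ∃ T : W42 E4 → ℂ, T = fun u => Sob.coef (w u) 0 := ⟨_, rfl⟩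
  have hT : ContDiffAt ℝ 2 T f := by
    rw [hTdef]
    exact ((Sob.coefL (j := 1) 0).restrictScalars ℝ).contDiff.contDiffAt.comp f hw
  -- a conformal diffeomorphism solves the linear equation, so it is given by the parametrix
  have hsolve : ∀ u, IsUnit (Sob.beltrami hM (σ u)) → ∀ τ (v : Sob 2),
      algebraMap ℂ (Sob 1) τ + Sob.D₂ v - σ u * Sob.D₁ v = σ u →
      τ = T u ∧ Sob.D₁ (Sob.parametrix hM (w u)) = Sob.D₁ v ∧
        Sob.D₂ (Sob.parametrix hM (w u)) = Sob.D₂ v := by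
    intro u hu τ v h
    have h1 := hwu' u hu _ ((Sob.beltrami_apply_eq hM (σ u) τ v).trans h)
    obtain ⟨p1, p2, p3⟩ := Sob.parametrix_apply hM τ v
    rw [h1] at p1 p2 p3
    rw [hTdef]
    exact ⟨p1.symm, p2, p3⟩
  obtain ⟨hτ0, v₀, hbij₀, hne₀, heq₀⟩ := (hasConformalClass_iff hpos₀ hval₀).1 hτ
  obtain ⟨hTf, p2, p3⟩ := hsolve f hunit τ₀ v₀ heq₀
  obtain ⟨k, hk0, hk⟩ := exists_mul_norm_le_norm_gradL (detC_marked_pos hpos₀ hval₀ hne₀ heq₀)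
  have hk4 : 0 < k / 4 := by positivity
  have t1 : Tendsto (fun u => Sob.D₁ (Sob.parametrix hM (w u))) (𝓝 f) (𝓝 (Sob.D₁ v₀)) := by
    rw [← p2]
    exact ((Sob.D₁.comp (Sob.parametrix hM)).continuous.continuousAt.tendsto).comp
      hw.continuousAt.tendsto
  have t2 : Tendsto (fun u => Sob.D₂ (Sob.parametrix hM (w u))) (𝓝 f) (𝓝 (Sob.D₂ v₀)) := by
    rw [← p3]
    exact ((Sob.D₂.comp (Sob.parametrix hM)).continuous.continuousAt.tendsto).comp
      hw.continuousAt.tendsto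
  have t3 : ∀ᶠ u in 𝓝 f, ‖T u - τ₀‖ < k / 4 := by
    have : Tendsto T (𝓝 f) (𝓝 τ₀) := by rw [hTf]; exact hT.continuousAt.tendsto
    filter_upwards [this (Metric.ball_mem_nhds τ₀ hk4)] with u hu
    exact mem_ball_iff_norm.1 hu
  have him : ∀ᶠ u in 𝓝 f, 0 < (T u).im := by
    have h1 : ContinuousAt (fun u => (T u).im) f :=
      Complex.continuous_im.continuousAt.comp hT.continuousAt
    exact h1.eventually_const_lt (by rw [hTf] at hτ0; exact hτ0)
  refine ⟨T, hT, ?_⟩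
  filter_upwards [hσp, hBu, t1.eventually (Sob.evAt_sub_lt _ hk4),
    t2.eventually (Sob.evAt_sub_lt _ hk4), t3, him] with u hu1 hu2 c1 c2 c3 hu4
  obtain ⟨hpos, hval⟩ := hu1
  rw [hasConformalClass_iff hpos hval]
  obtain ⟨b1, b2⟩ := bijective_marked_of_close hbij₀ hk0 hk c3 c1 c2
  refine ⟨⟨hu4, _, b1, b2, ?_⟩, fun τ h => ?_⟩
  · rw [hTdef, ← Sob.beltrami_apply hM]
    exact hwu u hu2
  · obtain ⟨-, v, -, -, h1⟩ := (hasConformalClass_iff hpos hval).1 h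
    exact (hsolve u hu2 τ v h1).1

end CWillmore

/-! ### Normal and tangential variations -/

namespace CWillmore

/-- Near a smooth immersion with a conformal class, the projection to Teichmüller space is smooth
and takes the value of the conformal class. -/
theorem contDiffAt_teichmuller {f : W42 E4} (hf : IsSmoothImmersion f) {τ : ℂ}
    (hτ : HasConformalClass f τ) :
    ContDiffAt ℝ 2 (fun u : W42 E4 => teichmuller (radial u)) f ∧ teichmuller (radial f) = τ := by
  obtain ⟨T, hT, hev⟩ := exists_contDiffAt_conformalClass hf hτ
  have h : ∀ᶠ u : W42 E4 in 𝓝 f, teichmuller (radial u) = T u := by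
    filter_upwards [hev] with u hu
    have hex : ∃ τ, HasConformalClass (radial u) τ := ⟨_, hu.1⟩
    rw [teichmuller, dif_pos hex]
    exact hu.2 _ hex.choose_spec
  refine ⟨hT.congr_of_eventuallyEq h, ?_⟩
  rw [h.self_of_nhds]
  refine (hev.self_of_nhds.2 τ ?_).symm
  rwa [radial_of_norm_eq_one hf.2.2.1]

/-- The coordinates of the value at a point, as continuous functionals. -/
noncomputable def coordAt (p : ℝ × ℝ) (i : Fin 4) : W42 E4 →L[ℝ] ℝ :=
  Complex.reCLM.comp (((BoundedContinuousFunction.evalCLM ℂ p).restrictScalars ℝ).comp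
    ((Sob.evL.restrictScalars ℝ).comp (toSob (coordC i))))

theorem coordAt_apply (p : ℝ × ℝ) (i : Fin 4) (u : W42 E4) : coordAt p i u = u p i := by
  change (Sob.ev (toSob (coordC i) u) p).re = _
  rw [ev_toSob]
  rfl

/-- The normal part of a field along `f` is a bounded multiple of `f`. -/
theorem exists_normalPart (f ξ : W42 E4) : ∃ η : W42 E4, (∀ p, η p = ⟪f p, ξ p⟫ • f p) ∧
    ∃ C : ℝ, 0 < C ∧ ∀ p, |⟪f p, ξ p⟫| < C := by
  let q : Sob 2 := dot (fun i => toSob (coordC i) f) (fun i => toSob (coordC i) ξ)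
  have hq : ∀ p, Sob.evAt p q = ((⟪f p, ξ p⟫ : ℝ) : ℂ) := fun p => by
    rw [inner_eq_dot]
    exact evAt_dot (represents_toSob f) (represents_toSob ξ) p
  have hex : ∀ i : Fin 4, ∃ v : W42 E4, ∀ p,
      v p = (⟪f p, ξ p⟫ * f p i) • EuclideanSpace.single i (1 : ℝ) := by
    intro i
    obtain ⟨v, hv⟩ := exists_W42_of_sob
      (Complex.reCLM.smulRight (EuclideanSpace.single i (1 : ℝ))) (q * toSob (coordC i) f)
    refine ⟨v, fun p => ?_⟩
    rw [hv, ← Sob.evAt_apply, map_mul, hq, represents_toSob f p i, ← Complex.ofReal_mul]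
    rfl
  choose v hv using hex
  refine ⟨v 0 + v 1 + v 2 + v 3, fun p => ?_, ‖Sob.ev q‖ + 1, by positivity, fun p => ?_⟩
  · simp only [W42.add_apply, hv]
    ext j
    fin_cases j <;> simp
  · have h1 : ‖Sob.evAt p q‖ ≤ _ := (Sob.ev q).norm_coe_le_norm p
    rw [hq, Complex.norm_real, Real.norm_eq_abs] at h1
    linarith

/-- Normal variations do not change the radial projection to the sphere. -/
theorem radial_add_smul_normalPart {f η : W42 E4} {n : ℝ × ℝ → ℝ} (hη : ∀ p, η p = n p • f p)
    {C : ℝ} (hC : 0 < C) (hn : ∀ p, |n p| < C) :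
    ∀ᶠ t : ℝ in 𝓝 0, radial (f + t • η : W42 E4) = radial f := by
  have h : ∀ᶠ t : ℝ in 𝓝 0, |t| < C⁻¹ := by
    have : Metric.ball (0 : ℝ) C⁻¹ ∈ 𝓝 (0 : ℝ) := Metric.ball_mem_nhds _ (by positivity)
    filter_upwards [this] with t ht
    simpa using ht
  filter_upwards [h] with t ht
  funext p
  have h1 : |t * n p| < 1 := by
    rw [abs_mul]
    calc |t| * |n p| ≤ |t| * C := by gcongr; exact (hn p).le
      _ < C⁻¹ * C := by gcongr
      _ = 1 := inv_mul_cancel₀ hC.ne'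
  have h2 : 0 < 1 + t * n p := by linarith [neg_abs_le (t * n p)]
  have h3 : (f + t • η : W42 E4) p = (1 + t * n p) • f p := by
    rw [W42.add_apply, W42.smul_apply, hη, smul_smul, add_smul, one_smul]
  rw [radial, radial, h3, norm_smul, Real.norm_of_nonneg h2.le, smul_smul, mul_inv,
    mul_right_comm, inv_mul_cancel₀ h2.ne', one_mul]

theorem hasDerivAt_add_smul {Q : W42 E4 → ℝ} {f φ : W42 E4} (hQ : DifferentiableAt ℝ Q f) :
    HasDerivAt (fun t : ℝ => Q (f + t • φ)) (fderiv ℝ Q f φ) 0 := by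
  have h1 : HasDerivAt (fun t : ℝ => f + t • φ) φ 0 := by
    simpa using ((hasDerivAt_id (0 : ℝ)).smul_const φ).const_add f
  have h2 : HasFDerivAt Q (fderiv ℝ Q f) (f + (0 : ℝ) • φ) := by
    simpa using hQ.hasFDerivAt
  exact h2.comp_hasDerivAt 0 h1

/-- The first variation is the derivative of the functional composed with the radial
projection. -/
theorem firstVariation_eq {𝓕 : (ℝ × ℝ → E4) → ℝ} {f : W42 E4}
    (h : DifferentiableAt ℝ (fun u : W42 E4 => 𝓕 (radial u)) f) (φ : W42 E4) :
    firstVariation 𝓕 f φ = fderiv ℝ (fun u : W42 E4 => 𝓕 (radial u)) f φ :=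
  (hasDerivAt_add_smul h).deriv

theorem fderiv_normalPart_eq_zero {𝓕 : (ℝ × ℝ → E4) → ℝ} {f η : W42 E4}
    (h : DifferentiableAt ℝ (fun u : W42 E4 => 𝓕 (radial u)) f) {n : ℝ × ℝ → ℝ}
    (hη : ∀ p, η p = n p • f p) {C : ℝ} (hC : 0 < C) (hn : ∀ p, |n p| < C) :
    fderiv ℝ (fun u : W42 E4 => 𝓕 (radial u)) f η = 0 := by
  have h1 := hasDerivAt_add_smul (φ := η) h
  have h2 : (fun t : ℝ => 𝓕 (radial (f + t • η : W42 E4))) =ᶠ[𝓝 0] fun _ => 𝓕 (radial f) := by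
    filter_upwards [radial_add_smul_normalPart hη hC hn] with t ht
    rw [ht]
  exact h1.unique ((hasDerivAt_const (0 : ℝ) (𝓕 (radial f))).congr_of_eventuallyEq h2)

/-- The constrained Willmore equation holds in all directions, not only in tangential ones, for the
functionals composed with the radial projection. -/
theorem IsConstrainedWillmore.fderiv_eq {f : W42 E4} {α β : ℝ} (h : IsConstrainedWillmore f α β)
    (hf : ∀ p, ‖f p‖ = 1)
    (hW : DifferentiableAt ℝ (fun u : W42 E4 => willmore (radial u)) f)
    (h₁ : DifferentiableAt ℝ (fun u : W42 E4 => teich₁ (radial u)) f)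
    (h₂ : DifferentiableAt ℝ (fun u : W42 E4 => teich₂ (radial u)) f) :
    fderiv ℝ (fun u : W42 E4 => willmore (radial u)) f =
      α • fderiv ℝ (fun u : W42 E4 => teich₁ (radial u)) f +
        β • fderiv ℝ (fun u : W42 E4 => teich₂ (radial u)) f := by
  ext ξ
  obtain ⟨η, hη, C, hC, hn⟩ := exists_normalPart f ξ
  have ht : IsTangentField f (ξ - η : W42 E4) := fun p => by
    rw [W42.sub_apply, inner_sub_right, hη, inner_smul_right, real_inner_self_eq_norm_sq, hf]
    ring
  have e := h _ ht
  rw [firstVariation_eq hW, firstVariation_eq h₁, firstVariation_eq h₂, map_sub, map_sub, map_sub,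
    fderiv_normalPart_eq_zero hW hη hC hn, fderiv_normalPart_eq_zero h₁ hη hC hn,
    fderiv_normalPart_eq_zero h₂ hη hC hn, sub_zero, sub_zero, sub_zero] at e
  exact e

/-- The derivative of a curve of maps to the sphere is a tangent field. -/
theorem isTangentField_of_hasDerivWithinAt {c : ℝ → W42 E4} {φ : W42 E4} {S : Set ℝ} {s : ℝ}
    (hS : UniqueDiffWithinAt ℝ S s) (hs : s ∈ S) (hc : HasDerivWithinAt c φ S s)
    (h1 : ∀ t ∈ S, ∀ p, ‖c t p‖ = 1) : IsTangentField (c s) φ := by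
  intro p
  have hi : ∀ i, HasDerivWithinAt (fun t => coordAt p i (c t)) (coordAt p i φ) S s := fun i =>
    (coordAt p i).hasFDerivAt.comp_hasDerivWithinAt s hc
  have hsum : HasDerivWithinAt (fun t => ∑ i, coordAt p i (c t) * coordAt p i (c t))
      (∑ i, (coordAt p i φ * coordAt p i (c s) + coordAt p i (c s) * coordAt p i φ)) S s :=
    HasDerivWithinAt.fun_sum fun i _ => (hi i).mul (hi i)
  have hconst : HasDerivWithinAt (fun t => ∑ i, coordAt p i (c t) * coordAt p i (c t)) 0 S s := by
    have e : ∀ t ∈ S, ∑ i, coordAt p i (c t) * coordAt p i (c t) = 1 := fun t ht => by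
      have := real_inner_self_eq_norm_sq (c t p)
      rw [h1 t ht p, inner_eq_dot, dot] at this
      simpa only [coordAt_apply, one_pow] using this
    exact (hasDerivWithinAt_const s S (1 : ℝ)).congr e (e s hs)
  have e := hS.eq_deriv _ hsum hconst
  rw [inner_eq_dot, dot]
  simp only [coordAt_apply] at e
  rw [Finset.sum_congr rfl fun i _ => (by ring : φ p i * c s p i + c s p i * φ p i =
    2 * (c s p i * φ p i)), ← Finset.mul_sum] at e
  linarith

end CWillmore

/-! ### Lagrange multipliers along a curve -/

namespace CWillmore

section Lagrange

variable {X : Type*} [NormedAddCommGroup X] [NormedSpace ℝ X]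

/-- The derivative of a functional along a curve of constrained critical points. -/
theorem hasDerivAt_of_lagrange {W A B : X → ℝ} {α β x y s : ℝ} {c : ℝ → X}
    (hW : DifferentiableAt ℝ W (c s)) (hA : DifferentiableAt ℝ A (c s))
    (hB : DifferentiableAt ℝ B (c s))
    (h : fderiv ℝ W (c s) = α • fderiv ℝ A (c s) + β • fderiv ℝ B (c s))
    (hc : DifferentiableAt ℝ c s) (hx : HasDerivAt (fun t => A (c t)) x s)
    (hy : HasDerivAt (fun t => B (c t)) y s) :
    HasDerivAt (fun t => W (c t)) (α * x + β * y) s := by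
  have h1 := hA.hasFDerivAt.comp_hasDerivAt s hc.hasDerivAt
  have h2 := hB.hasFDerivAt.comp_hasDerivAt s hc.hasDerivAt
  have h3 := hW.hasFDerivAt.comp_hasDerivAt s hc.hasDerivAt
  rw [h, add_apply, smul_apply,
    smul_apply, h1.unique hx, h2.unique hy] at h3
  exact h3

/-- The second derivative along a line. -/
theorem iteratedDeriv_two_add_smul {P : X → ℝ} {f : X} (φ : X) (hP : ContDiffAt ℝ 2 P f) :
    iteratedDeriv 2 (fun t : ℝ => P (f + t • φ)) 0 = fderiv ℝ (fderiv ℝ P) f φ φ := by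
  have hl : ∀ t : ℝ, HasDerivAt (fun t : ℝ => f + t • φ) φ t := fun t => by
    simpa using ((hasDerivAt_id t).smul_const φ).const_add f
  have h0 : f + (0 : ℝ) • φ = f := by rw [zero_smul, add_zero]
  have hev : ∀ᶠ t : ℝ in 𝓝 0, ContDiffAt ℝ 2 P (f + t • φ) := by
    have h1 : Tendsto (fun t : ℝ => f + t • φ) (𝓝 0) (𝓝 f) := by
      have := (hl 0).continuousAt.tendsto
      rwa [h0] at this
    exact h1.eventually (hP.eventually (by simp))
  have hd : deriv (fun t : ℝ => P (f + t • φ)) =ᶠ[𝓝 0] fun t => fderiv ℝ P (f + t • φ) φ := by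
    filter_upwards [hev] with t ht
    have h1 : HasFDerivAt P (fderiv ℝ P (f + t • φ)) (f + t • φ) :=
      (ht.differentiableAt (by simp)).hasFDerivAt
    exact (h1.comp_hasDerivAt t (hl t)).deriv
  have h2 : HasFDerivAt (fderiv ℝ P) (fderiv ℝ (fderiv ℝ P) f) (f + (0 : ℝ) • φ) := by
    rw [h0]
    exact ((hP.fderiv_right (m := 1) (by norm_num)).differentiableAt (by simp)).hasFDerivAt
  have h3 : HasDerivAt (fun t : ℝ => fderiv ℝ P (f + t • φ)) (fderiv ℝ (fderiv ℝ P) f φ) 0 :=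
    h2.comp_hasDerivAt 0 (hl 0)
  have h4 : HasDerivAt (fun t : ℝ => fderiv ℝ P (f + t • φ) φ) (fderiv ℝ (fderiv ℝ P) f φ φ) 0 := by
    have h5 := h3.clm_apply (hasDerivAt_const (0 : ℝ) φ)
    rw [map_zero, add_zero] at h5
    exact h5
  rw [iteratedDeriv_succ, iteratedDeriv_one, hd.deriv_eq, h4.deriv]

/-- Let `c` be a curve of constrained critical points of `W` with multipliers `α`, `β`, where the
constraint `A (c s) = s²` degenerates at `s = 0`. The differential of the penalized functional `P`
with the multipliers at `s = 0` vanishes at `c 0`. Along the curve, `DP (c s) (c' s)` is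
`2s (α s - α 0)`, and its derivative `0` at `s = 0` is the second derivative of `P` in the
direction `c' 0`. -/
theorem second_fderiv_eq_zero_of_lagrange {W A B : X → ℝ} {α β : ℝ → ℝ} {c : ℝ → X} {s₀ b : ℝ}
    (hs₀ : 0 < s₀) (hW : ∀ s ∈ Ico 0 s₀, ContDiffAt ℝ 2 W (c s))
    (hA : ∀ s ∈ Ico 0 s₀, ContDiffAt ℝ 2 A (c s)) (hB : ∀ s ∈ Ico 0 s₀, ContDiffAt ℝ 2 B (c s))
    (hc : ContDiffOn ℝ 2 c (Ico 0 s₀)) (hcA : ∀ s ∈ Ico 0 s₀, A (c s) = s ^ 2)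
    (hcB : ∀ s ∈ Ico 0 s₀, B (c s) = b) (hα : ContinuousWithinAt α (Ico 0 s₀) 0)
    (hβ : ContinuousWithinAt β (Ico 0 s₀) 0)
    (h : ∀ s ∈ Ioo 0 s₀,
      fderiv ℝ W (c s) = α s • fderiv ℝ A (c s) + β s • fderiv ℝ B (c s)) :
    fderiv ℝ (fderiv ℝ fun u => W u - α 0 * A u - β 0 * B u) (c 0)
      (derivWithin c (Ico 0 s₀) 0) (derivWithin c (Ico 0 s₀) 0) = 0 := by
  set P : X → ℝ := fun u => W u - α 0 * A u - β 0 * B u with hPdef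
  set S := Ico (0 : ℝ) s₀ with hS
  have h0 : (0 : ℝ) ∈ S := ⟨le_rfl, hs₀⟩
  have hu : UniqueDiffOn ℝ S := uniqueDiffOn_Ico 0 s₀
  have hfd : ∀ s ∈ S, fderiv ℝ P (c s) =
      fderiv ℝ W (c s) - α 0 • fderiv ℝ A (c s) - β 0 • fderiv ℝ B (c s) := by
    intro s hs
    have a1 := ((hW s hs).differentiableAt (by simp)).hasFDerivAt
    have a2 := ((hA s hs).differentiableAt (by simp)).hasFDerivAt
    have a3 := ((hB s hs).differentiableAt (by simp)).hasFDerivAt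
    exact ((a1.sub (a2.const_mul (α 0))).sub (a3.const_mul (β 0))).fderiv
  have hP : ContDiffAt ℝ 2 P (c 0) :=
    ((hW 0 h0).sub (contDiffAt_const.mul (hA 0 h0))).sub (contDiffAt_const.mul (hB 0 h0))
  have hcont : ∀ {Q : X → ℝ}, (∀ s ∈ S, ContDiffAt ℝ 2 Q (c s)) →
      ContinuousWithinAt (fun s => fderiv ℝ Q (c s)) S 0 := fun {Q} hQ =>
    ContinuousAt.comp_continuousWithinAt
      (((hQ 0 h0).fderiv_right (m := 1) (by norm_num)).continuousAt)
      (hc.continuousOn 0 h0)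
  have hmem : ∀ᶠ s in 𝓝[>] (0 : ℝ), s ∈ Ioo 0 s₀ := Ioo_mem_nhdsGT hs₀
  have hle : 𝓝[>] (0 : ℝ) ≤ 𝓝[S] 0 := by
    rw [← nhdsWithin_Ioo_eq_nhdsGT hs₀]
    exact nhdsWithin_mono _ Ioo_subset_Ico_self
  -- the Lagrange equation passes to the limit
  have hcrit : fderiv ℝ P (c 0) = 0 := by
    have l1 : Tendsto (fun s => fderiv ℝ W (c s)) (𝓝[>] 0) (𝓝 (fderiv ℝ W (c 0))) :=
      (hcont hW).tendsto.mono_left hle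
    have l2 : Tendsto (fun s => α s • fderiv ℝ A (c s) + β s • fderiv ℝ B (c s)) (𝓝[>] 0)
        (𝓝 (α 0 • fderiv ℝ A (c 0) + β 0 • fderiv ℝ B (c 0))) :=
      ((hα.smul (hcont hA)).add (hβ.smul (hcont hB))).tendsto.mono_left hle
    have l3 : (fun s => fderiv ℝ W (c s)) =ᶠ[𝓝[>] 0]
        fun s => α s • fderiv ℝ A (c s) + β s • fderiv ℝ B (c s) := by
      filter_upwards [hmem] with s hs using h s hs
    have e := tendsto_nhds_unique (l1.congr' l3) l2
    rw [hfd 0 h0, e]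
    abel
  have hcd : ∀ s ∈ S, HasDerivWithinAt c (derivWithin c S s) S s := fun s hs =>
    ((hc.differentiableOn (by simp)) s hs).hasDerivWithinAt
  have hcA' : ∀ s ∈ S, fderiv ℝ A (c s) (derivWithin c S s) = 2 * s := by
    intro s hs
    have a1 := ((hA s hs).differentiableAt (by simp)).hasFDerivAt.comp_hasDerivWithinAt s
      (hcd s hs)
    have a2 : HasDerivWithinAt (A ∘ c) (2 * s) S s := by
      have a3 : HasDerivWithinAt (fun s : ℝ => s ^ 2) (2 * s) S s := by
        simpa using (hasDerivAt_pow 2 s).hasDerivWithinAt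
      exact a3.congr hcA (hcA s hs)
    exact (hu s hs).eq_deriv _ a1 a2
  have hcB' : ∀ s ∈ S, fderiv ℝ B (c s) (derivWithin c S s) = 0 := by
    intro s hs
    have a1 := ((hB s hs).differentiableAt (by simp)).hasFDerivAt.comp_hasDerivWithinAt s
      (hcd s hs)
    exact (hu s hs).eq_deriv _ a1 ((hasDerivWithinAt_const s S b).congr hcB (hcB s hs))
  -- the term with `β` drops out, because `B` is constant along the curve
  have hval : ∀ s ∈ S, fderiv ℝ P (c s) (derivWithin c S s) = (α s - α 0) * (2 * s) := by
    intro s hs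
    rcases hs.1.eq_or_lt with h1 | h1
    · rw [← h1, hcrit]; simp
    · have e := DFunLike.congr_fun (h s ⟨h1, hs.2⟩) (derivWithin c S s)
      simp only [add_apply, smul_apply, smul_eq_mul,
        hcA' s hs, hcB' s hs] at e
      rw [hfd s hs]
      simp only [sub_apply, smul_apply, smul_eq_mul,
        hcA' s hs, hcB' s hs, e]
      ring
  have hc' : DifferentiableWithinAt ℝ (derivWithin c S) S 0 :=
    ((hc.derivWithin hu (m := 1) (by norm_num)).differentiableOn (by simp)) 0 h0
  have hDP : HasFDerivAt (fderiv ℝ P) (fderiv ℝ (fderiv ℝ P) (c 0)) (c 0) :=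
    ((hP.fderiv_right (m := 1) (by norm_num)).differentiableAt (by simp)).hasFDerivAt
  -- both sides are differentiated at `s = 0`; as `DP (c 0) = 0`, the second derivative of the curve
  -- does not enter
  have hL := (hDP.comp_hasDerivWithinAt 0 (hcd 0 h0)).clm_apply hc'.hasDerivWithinAt
  have hR : HasDerivWithinAt (fun s => (α s - α 0) * (2 * s)) 0 S 0 := by
    rw [hasDerivWithinAt_iff_tendsto_slope]
    have t1 : Tendsto (fun s => (α s - α 0) * 2) (𝓝[S \ {0}] 0) (𝓝 0) := by
      have := ((hα.sub (continuousWithinAt_const (b := α 0))).mul_const (2 : ℝ)).tendsto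
      rw [Pi.sub_apply] at this
      rw [sub_self, zero_mul] at this
      exact this.mono_left (nhdsWithin_mono _ sdiff_subset)
    refine t1.congr' ?_
    filter_upwards [self_mem_nhdsWithin] with s hs
    have : s ≠ 0 := hs.2
    rw [slope_def_field]
    field_simp
    ring
  have e := (hu 0 h0).eq_deriv _ hL (hR.congr hval (hval 0 h0))
  simpa [hcrit] using e

end Lagrange

end CWillmore

/-! ### Families parametrized by the square root of the first conformal parameter -/

namespace CWillmore

section SqrtParam

variable {X : Type*} [NormedAddCommGroup X] [NormedSpace ℝ X] {a₀ b : ℝ} {I : Set ℝ}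
  {f : ℝ → ℝ → X}

theorem sqrt_mem_Ioo {a : ℝ} (ha₀ : 0 < a₀) (ha : a ∈ Ioo 0 (a₀ ^ 2)) : √a ∈ Ioo 0 a₀ :=
  ⟨Real.sqrt_pos.2 ha.1, (Real.sqrt_lt' ha₀).2 ha.2⟩

theorem contDiffAt_sqrt_param (ha₀ : 0 < a₀) (hI : IsOpen I)
    (hf : ContDiffOn ℝ 2 (fun z : ℝ × ℝ => f (z.1 ^ 2) z.2) (Ico 0 a₀ ×ˢ I)) {a : ℝ}
    (ha : a ∈ Ioo 0 (a₀ ^ 2)) (hb : b ∈ I) :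
    ContDiffAt ℝ 2 (fun z : ℝ × ℝ => f (z.1 ^ 2) z.2) (√a, b) :=
  hf.contDiffAt (mem_of_superset ((isOpen_Ioo.prod hI).mem_nhds ⟨sqrt_mem_Ioo ha₀ ha, hb⟩)
    (prod_mono Ioo_subset_Ico_self subset_rfl))

theorem differentiableAt_fst_of_sqrt_param (ha₀ : 0 < a₀) (hI : IsOpen I)
    (hf : ContDiffOn ℝ 2 (fun z : ℝ × ℝ => f (z.1 ^ 2) z.2) (Ico 0 a₀ ×ˢ I)) {a : ℝ}
    (ha : a ∈ Ioo 0 (a₀ ^ 2)) (hb : b ∈ I) : DifferentiableAt ℝ (fun s => f s b) a := by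
  have h1 := (contDiffAt_sqrt_param ha₀ hI hf ha hb).differentiableAt (by simp)
  have h2 : DifferentiableAt ℝ (fun s : ℝ => (√s, b)) a :=
    (Real.hasDerivAt_sqrt ha.1.ne').differentiableAt.prodMk (differentiableAt_const b)
  have h3 : DifferentiableAt ℝ (fun s : ℝ => f (√s ^ 2) b) a :=
    DifferentiableAt.comp (g := fun z : ℝ × ℝ => f (z.1 ^ 2) z.2) a h1 h2
  refine h3.congr_of_eventuallyEq ?_
  filter_upwards [lt_mem_nhds ha.1] with s hs
  rw [Real.sq_sqrt hs.le]

theorem differentiableAt_snd_of_sqrt_param (ha₀ : 0 < a₀) (hI : IsOpen I)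
    (hf : ContDiffOn ℝ 2 (fun z : ℝ × ℝ => f (z.1 ^ 2) z.2) (Ico 0 a₀ ×ˢ I)) {a : ℝ}
    (ha : a ∈ Ioo 0 (a₀ ^ 2)) (hb : b ∈ I) : DifferentiableAt ℝ (fun s => f a s) b := by
  have h1 := (contDiffAt_sqrt_param ha₀ hI hf ha hb).differentiableAt (by simp)
  have h2 : DifferentiableAt ℝ (fun s : ℝ => (√a, s)) b :=
    (differentiableAt_const (√a)).prodMk differentiableAt_id
  have h3 : DifferentiableAt ℝ (fun s : ℝ => f (√a ^ 2) s) b :=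
    DifferentiableAt.comp (g := fun z : ℝ × ℝ => f (z.1 ^ 2) z.2) b h1 h2
  rwa [Real.sq_sqrt ha.1.le] at h3

theorem contDiffOn_sq_param
    (hf : ContDiffOn ℝ 2 (fun z : ℝ × ℝ => f (z.1 ^ 2) z.2) (Ico 0 a₀ ×ˢ I)) (hb : b ∈ I) :
    ContDiffOn ℝ 2 (fun s => f (s ^ 2) b) (Ico 0 a₀) :=
  hf.comp (g := fun z : ℝ × ℝ => f (z.1 ^ 2) z.2) (f := fun s : ℝ => (s, b))
    (contDiff_id.prodMk contDiff_const).contDiffOn fun _ hs => ⟨hs, hb⟩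

theorem tendsto_sqrt_param (ha₀ : 0 < a₀)
    (hf : ContDiffOn ℝ 2 (fun z : ℝ × ℝ => f (z.1 ^ 2) z.2) (Ico 0 a₀ ×ˢ I)) (hb : b ∈ I) :
    Tendsto (fun a => f a b) (𝓝[>] 0) (𝓝 (f 0 b)) := by
  have h1 : Tendsto (fun s => f (s ^ 2) b) (𝓝[Ico 0 a₀] 0) (𝓝 (f 0 b)) := by
    have := (contDiffOn_sq_param hf hb).continuousOn 0 ⟨le_rfl, ha₀⟩
    simpa [ContinuousWithinAt] using this
  have hmem : ∀ᶠ a in 𝓝[>] (0 : ℝ), a ∈ Ioo 0 (a₀ ^ 2) := Ioo_mem_nhdsGT (by positivity)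
  have h2 : Tendsto Real.sqrt (𝓝[>] 0) (𝓝[Ico 0 a₀] 0) := by
    refine tendsto_nhdsWithin_iff.2 ⟨?_, ?_⟩
    · have := (Real.continuous_sqrt.tendsto 0).mono_left (nhdsWithin_le_nhds (s := Ioi (0 : ℝ)))
      rwa [Real.sqrt_zero] at this
    · filter_upwards [hmem] with a ha using Ioo_subset_Ico_self (sqrt_mem_Ioo ha₀ ha)
  refine (h1.comp h2).congr' ?_
  filter_upwards [hmem] with a ha
  rw [Function.comp_apply, Real.sq_sqrt ha.1.le]

end SqrtParam

end CWillmore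

theorem mainTheorem8 (a₀ b₀ : ℝ) (ha₀ : 0 < a₀) (hb₀ : 0 < b₀)
    (f : ℝ → ℝ → CWillmore.W42 CWillmore.E4) (α β : ℝ → ℝ → ℝ)
    -- `f a b`, for `(a, b) ∈ [0, a₀²) × (1 - b₀, 1 + b₀)`, is a smooth immersion
    (himm : ∀ a ∈ Ico 0 (a₀ ^ 2), ∀ b ∈ Ioo (1 - b₀) (1 + b₀),
      CWillmore.IsSmoothImmersion (f a b))
    -- of conformal type `(a, b)`
    (hconf : ∀ a ∈ Ico 0 (a₀ ^ 2), ∀ b ∈ Ioo (1 - b₀) (1 + b₀),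
      CWillmore.HasConformalClass (f a b) ⟨a, b⟩)
    -- the family is `C²` in `(√a, b)` with values in `W^{4,2}`
    (hf : ContDiffOn ℝ 2 (fun z : ℝ × ℝ => f (z.1 ^ 2) z.2)
      (Ico 0 a₀ ×ˢ Ioo (1 - b₀) (1 + b₀)))
    -- and degenerate exactly at `a = 0`
    (hdeg : ∀ b ∈ Ioo (1 - b₀) (1 + b₀), CWillmore.IsCriticalFor CWillmore.teich₁ (f 0 b))
    (hnondeg : ∀ a ∈ Ioo 0 (a₀ ^ 2), ∀ b ∈ Ioo (1 - b₀) (1 + b₀),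
      ¬ CWillmore.IsCriticalFor CWillmore.teich₁ (f a b))
    -- the Lagrange multipliers
    (hEL : ∀ a ∈ Ioo 0 (a₀ ^ 2), ∀ b ∈ Ioo (1 - b₀) (1 + b₀),
      CWillmore.IsConstrainedWillmore (f a b) (α a b) (β a b))
    (hα : ContDiffOn ℝ 2 (fun z : ℝ × ℝ => α (z.1 ^ 2) z.2)
      (Ico 0 a₀ ×ˢ Ioo (1 - b₀) (1 + b₀)))
    (hβ : ContDiffOn ℝ 2 (fun z : ℝ × ℝ => β (z.1 ^ 2) z.2)
      (Ico 0 a₀ ×ˢ Ioo (1 - b₀) (1 + b₀))) :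
    (∀ b ∈ Ioo (1 - b₀) (1 + b₀),
      (∀ a ∈ Ioo 0 (a₀ ^ 2),
        HasDerivAt (fun s => CWillmore.willmore (f s b)) (α a b) a) ∧
      Tendsto (fun a => deriv (fun s => CWillmore.willmore (f s b)) a) (𝓝[>] 0) (𝓝 (α 0 b))) ∧
    (∀ b ∈ Ioo (1 - b₀) (1 + b₀),
      (∀ a ∈ Ioo 0 (a₀ ^ 2),
        HasDerivAt (fun s => CWillmore.willmore (f a s)) (β a b) b) ∧
      Tendsto (fun a => deriv (fun s => CWillmore.willmore (f a s)) b) (𝓝[>] 0) (𝓝 (β 0 b))) ∧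
    ∀ b ∈ Ioo (1 - b₀) (1 + b₀), ∃ φ : CWillmore.W42 CWillmore.E4,
      -- `φ` is the derivative of the family with respect to `√a` at `a = 0`
      HasDerivWithinAt (fun s => f (s ^ 2) b) φ (Ici 0) 0 ∧
      CWillmore.IsTangentField (f 0 b) φ ∧
      ContDiffAt ℝ 2
        (fun t => CWillmore.penalizedWillmore (α 0 b) (β 0 b)
          (CWillmore.variation (f 0 b) φ t)) 0 ∧
      CWillmore.secondVariation (CWillmore.penalizedWillmore (α 0 b) (β 0 b)) (f 0 b) φ = 0 := by
  set I := Ioo (1 - b₀) (1 + b₀) with hI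
  have hIo : IsOpen I := isOpen_Ioo
  -- the functionals on the Banach space, composed with the radial projection to the sphere
  let W : CWillmore.W42 CWillmore.E4 → ℝ := fun u => CWillmore.willmore (CWillmore.radial u)
  let A : CWillmore.W42 CWillmore.E4 → ℝ := fun u => CWillmore.teich₁ (CWillmore.radial u)
  let B : CWillmore.W42 CWillmore.E4 → ℝ := fun u => CWillmore.teich₂ (CWillmore.radial u)
  have hnorm : ∀ a ∈ Ico 0 (a₀ ^ 2), ∀ b ∈ I, ∀ p, ‖f a b p‖ = 1 := fun a ha b hb =>
    (himm a ha b hb).2.2.1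
  have hW : ∀ a ∈ Ico 0 (a₀ ^ 2), ∀ b ∈ I, ContDiffAt ℝ 2 W (f a b) := fun a ha b hb =>
    CWillmore.contDiffAt_willmore (himm a ha b hb)
  have hWval : ∀ a ∈ Ico 0 (a₀ ^ 2), ∀ b ∈ I, W (f a b) = CWillmore.willmore (f a b) :=
    fun a ha b hb => by
      change CWillmore.willmore (CWillmore.radial (f a b)) = _
      rw [CWillmore.radial_of_norm_eq_one (hnorm a ha b hb)]
  have hT := fun a ha b hb => CWillmore.contDiffAt_teichmuller (himm a ha b hb) (hconf a ha b hb)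
  have hA : ∀ a ∈ Ico 0 (a₀ ^ 2), ∀ b ∈ I, ContDiffAt ℝ 2 A (f a b) := fun a ha b hb =>
    Complex.reCLM.contDiff.contDiffAt.comp (f a b) (hT a ha b hb).1
  have hB : ∀ a ∈ Ico 0 (a₀ ^ 2), ∀ b ∈ I, ContDiffAt ℝ 2 B (f a b) := fun a ha b hb =>
    Complex.imCLM.contDiff.contDiffAt.comp (f a b) (hT a ha b hb).1
  have hAval : ∀ a ∈ Ico 0 (a₀ ^ 2), ∀ b ∈ I, A (f a b) = a := fun a ha b hb =>
    congrArg Complex.re (hT a ha b hb).2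
  have hBval : ∀ a ∈ Ico 0 (a₀ ^ 2), ∀ b ∈ I, B (f a b) = b := fun a ha b hb =>
    congrArg Complex.im (hT a ha b hb).2
  have hL : ∀ a ∈ Ioo 0 (a₀ ^ 2), ∀ b ∈ I, fderiv ℝ W (f a b) =
      α a b • fderiv ℝ A (f a b) + β a b • fderiv ℝ B (f a b) := fun a ha b hb => by
    have ha' := Ioo_subset_Ico_self ha
    exact (hEL a ha b hb).fderiv_eq (hnorm a ha' b hb) ((hW a ha' b hb).differentiableAt (by simp))
      ((hA a ha' b hb).differentiableAt (by simp)) ((hB a ha' b hb).differentiableAt (by simp))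
  have hda : ∀ b ∈ I, ∀ a ∈ Ioo 0 (a₀ ^ 2),
      HasDerivAt (fun s => CWillmore.willmore (f s b)) (α a b) a := by
    intro b hb a ha
    have ha' := Ioo_subset_Ico_self ha
    have hev : ∀ᶠ s in 𝓝 a, s ∈ Ico 0 (a₀ ^ 2) :=
      mem_of_superset (isOpen_Ioo.mem_nhds ha) Ioo_subset_Ico_self
    -- along `s ↦ f s b` the first component of the conformal class is `s`, the second is constant
    have h := CWillmore.hasDerivAt_of_lagrange (c := fun s => f s b) (x := 1) (y := 0)
      ((hW a ha' b hb).differentiableAt (by simp))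
      ((hA a ha' b hb).differentiableAt (by simp)) ((hB a ha' b hb).differentiableAt (by simp))
      (hL a ha b hb) (CWillmore.differentiableAt_fst_of_sqrt_param ha₀ hIo hf ha hb)
      ((hasDerivAt_id a).congr_of_eventuallyEq (hev.mono fun s hs => hAval s hs b hb))
      ((hasDerivAt_const a b).congr_of_eventuallyEq (hev.mono fun s hs => hBval s hs b hb))
    rw [mul_one, mul_zero, add_zero] at h
    exact h.congr_of_eventuallyEq (hev.mono fun s hs => (hWval s hs b hb).symm)
  have hdb : ∀ b ∈ I, ∀ a ∈ Ioo 0 (a₀ ^ 2),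
      HasDerivAt (fun s => CWillmore.willmore (f a s)) (β a b) b := by
    intro b hb a ha
    have ha' := Ioo_subset_Ico_self ha
    have hev : ∀ᶠ s in 𝓝 b, s ∈ I := hIo.mem_nhds hb
    -- along `s ↦ f a s` the first component of the conformal class is constant, the second is `s`
    have h := CWillmore.hasDerivAt_of_lagrange (c := fun s => f a s) (x := 0) (y := 1)
      ((hW a ha' b hb).differentiableAt (by simp))
      ((hA a ha' b hb).differentiableAt (by simp)) ((hB a ha' b hb).differentiableAt (by simp))
      (hL a ha b hb) (CWillmore.differentiableAt_snd_of_sqrt_param ha₀ hIo hf ha hb)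
      ((hasDerivAt_const b a).congr_of_eventuallyEq (hev.mono fun s hs => hAval a ha' s hs))
      ((hasDerivAt_id b).congr_of_eventuallyEq (hev.mono fun s hs => hBval a ha' s hs))
    rw [mul_one, mul_zero, zero_add] at h
    exact h.congr_of_eventuallyEq (hev.mono fun s hs => (hWval a ha' s hs).symm)
  have hmem : ∀ᶠ a in 𝓝[>] (0 : ℝ), a ∈ Ioo 0 (a₀ ^ 2) := Ioo_mem_nhdsGT (by positivity)
  refine ⟨fun b hb => ⟨hda b hb, ?_⟩, fun b hb => ⟨hdb b hb, ?_⟩, fun b hb => ?_⟩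
  · exact (CWillmore.tendsto_sqrt_param ha₀ hα hb).congr'
      (hmem.mono fun a ha => (hda b hb a ha).deriv.symm)
  · exact (CWillmore.tendsto_sqrt_param ha₀ hβ hb).congr'
      (hmem.mono fun a ha => (hdb b hb a ha).deriv.symm)
  · have h0 : (0 : ℝ) ∈ Ico 0 a₀ := ⟨le_rfl, ha₀⟩
    have h0' : (0 : ℝ) ∈ Ico 0 (a₀ ^ 2) := ⟨le_rfl, by positivity⟩
    have hsq : ∀ s ∈ Ico 0 a₀, s ^ 2 ∈ Ico 0 (a₀ ^ 2) := fun s hs =>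
      ⟨sq_nonneg s, pow_lt_pow_left₀ hs.2 hs.1 two_ne_zero⟩
    have hz : (0 : ℝ) ^ 2 = 0 := zero_pow two_ne_zero
    have hc := CWillmore.contDiffOn_sq_param hf hb
    have hφ : HasDerivWithinAt (fun s => f (s ^ 2) b)
        (derivWithin (fun s => f (s ^ 2) b) (Ico 0 a₀) 0) (Ico 0 a₀) 0 :=
      ((hc.differentiableOn (by simp)) 0 h0).hasDerivWithinAt
    have htan := CWillmore.isTangentField_of_hasDerivWithinAt (uniqueDiffOn_Ico 0 a₀ 0 h0) h0 hφ
      fun t ht => hnorm _ (hsq t ht) b hb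
    have hD := CWillmore.second_fderiv_eq_zero_of_lagrange (W := W) (A := A) (B := B)
      (α := fun s => α (s ^ 2) b) (β := fun s => β (s ^ 2) b) (c := fun s => f (s ^ 2) b) (b := b)
      ha₀ (fun s hs => hW _ (hsq s hs) b hb) (fun s hs => hA _ (hsq s hs) b hb)
      (fun s hs => hB _ (hsq s hs) b hb) hc (fun s hs => hAval _ (hsq s hs) b hb)
      (fun s hs => hBval _ (hsq s hs) b hb)
      ((CWillmore.contDiffOn_sq_param hα hb).continuousOn 0 h0)
      ((CWillmore.contDiffOn_sq_param hβ hb).continuousOn 0 h0)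
      (fun s hs => hL _ ⟨pow_pos hs.1 2, (hsq s (Ioo_subset_Ico_self hs)).2⟩ b hb)
    simp only [hz] at hD htan
    generalize derivWithin (fun s => f (s ^ 2) b) (Ico 0 a₀) 0 = φ at hφ htan hD
    have hP : ContDiffAt ℝ 2 (fun u => W u - α 0 b * A u - β 0 b * B u) (f 0 b) :=
      ((hW 0 h0' b hb).sub (contDiffAt_const.mul (hA 0 h0' b hb))).sub
        (contDiffAt_const.mul (hB 0 h0' b hb))
    refine ⟨φ, hφ.mono_of_mem_nhdsWithin (Ico_mem_nhdsGE ha₀), htan, ?_, ?_⟩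
    · have h1 : ContDiffAt ℝ 2 (fun t : ℝ => f 0 b + t • φ) 0 :=
        contDiffAt_const.add (contDiffAt_id.smul contDiffAt_const)
      have h2 : f 0 b + (0 : ℝ) • φ = f 0 b := by rw [zero_smul, add_zero]
      rw [← h2] at hP
      exact ContDiffAt.comp (0 : ℝ) hP h1
    · exact (CWillmore.iteratedDeriv_two_add_smul φ hP).trans hD
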